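/- Let $\tau$ be in the upper half-plane ($\mathrm{Im}\,\tau>0$), write $q^r=\mathrm e^{2\pi i r\tau}$ for $r\in\mathbb R$, $\zeta_n=\mathrm e^{2\pi i/n}$, $(a;q)_n=\prod_{k=0}^{n-1}(1-aq^k)$, and for $|q|<1$ let $$\phi(q)=\sum_{n\ge0}\frac{q^{n(n+1)/2}}{(q;q^2)_{n+1}},\quad \psi(q)=\sum_{n\ge0}\frac{q^{(n+1)(n+2)/2}}{(q;q^2)_{n+1}},\quad X(q)=\sum_{n\ge0}\frac{(-1)^nq^{n^2}}{(-q;q)_{2n}},\quad \chi(q)=\sum_{n\ge0}\frac{(-1)^nq^{(n+1)^2}}{(-q;q)_{2n+1}}$$ be the tenth order mock theta functions. Put $$F^{(1)}(\tau)=\begin{pmatrix}q^{1/10}\phi(q^{1/2})\\ q^{-1/10}\psi(q^{1/2})\\ q^{1/10}\phi(-q^{1/2})\\ q^{-1/10}\psi(-q^{1/2})\\ q^{-1/40}X(q)\\ q^{-9/40}\chi(q)\end{pmatrix},\qquad F^{(2)}(\tau)=\begin{pmatrix}\sqrt2\,q^{1/5}\phi(q)\\ \sqrt2\,q^{-1/5}\psi(q)\\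 q^{-1/80}X(q^{1/2})\\ q^{-9/80}\chi(q^{1/2})\\ q^{-1/80}X(-q^{1/2})\\ q^{-9/80}\chi(-q^{1/2})\end{pmatrix}.$$ Let $\theta_2(\tau)=\sum_{n\in\mathbb Z}q^{(n+1/2)^2/2}$, $\theta_3(\tau)=\sum_{n\in\mathbb Z}q^{n^2/2}$, $\theta_4(\tau)=\sum_{n\in\mathbb Z}(-1)^nq^{n^2/2}$. Let $$A=\begin{pmatrix}4&6\\6&4\end{pmatrix},\quad c_1=\begin{pmatrix}-2\\3\end{pmatrix},\quad c_2=\begin{pmatrix}-3\\2\end{pmatrix},\quad e=\begin{pmatrix}1\\1\end{pmatrix},\quad e_x=\begin{pmatrix}1\\0\end{pmatrix},$$ $B(x,y)=x^{\mathrm T}Ay$, $Q(x)=\tfrac12B(x,x)$, $E(z)=2\int_0^z\mathrm e^{-\pi u^2}du$, and for $a,b\in\mathbb R^2$ let $$\vartheta_{a,b}(\tau)=\sum_{\nu\in\mathbb Z^2+a}\left\{E\left(\frac{B(c_1,\nu)}{\sqrt{-Q(c_1)}}(\mathrm{Im}\,\tau)^{1/2}\right)-E\left(\frac{B(c_2,\nu)}{\sqrt{-Q(c_2)}}(\mathrm{Im}\,\tau)^{1/2}\right)\right\}q^{Q(\nu)}\mathrm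 e^{2\pi iB(\nu,b)}$$ be Zwegers' indefinite theta series. For $s,t\in\mathbb R$ let $g_{s,t}(\tau)=\sum_{\sigma\in\mathbb Z+s}\sigma q^{\sigma^2/2}\mathrm e^{2\pi i\sigma t}$. Define $$H^{(1)}(\tau)=\begin{pmatrix}\frac{1}{2\theta_4}\big[\vartheta_{\frac1{10}e,0}-\vartheta_{\frac1{10}e+\frac12e_x,0}-\vartheta_{\frac4{10}e,0}+\vartheta_{\frac4{10}e+\frac12e_x,0}\big]\\ \frac{1}{2\theta_4}\big[\vartheta_{\frac2{10}e,0}-\vartheta_{\frac2{10}e+\frac12e_x,0}-\vartheta_{\frac3{10}e,0}+\vartheta_{\frac3{10}e+\frac12e_x,0}\big]\\ \frac{1}{2\theta_3}\big[\vartheta_{\frac1{10}e,0}-\vartheta_{\frac1{10}e+\frac12e_x,0}+\vartheta_{\frac4{10}e,0}+\vartheta_{\frac4{10}e+\frac12e_x,0}\big]\\ \frac{1}{2\theta_3}\big[-\vartheta_{\frac2{10}e,0}-\vartheta_{\frac2{10}e+\frac12e_x,0}-\vartheta_{\frac3{10}e,0}+\vartheta_{\frac3{10}e+\frac12e_x,0}\big]\\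 \frac1{\theta_2}\vartheta_{\frac1{10}e,0}\\ \frac1{\theta_2}\vartheta_{\frac3{10}e,0}\end{pmatrix}(\tau),$$ $$H^{(2)}(\tau)=\begin{pmatrix}\frac{1}{\sqrt2\,\theta_4(2\tau)}\zeta_5^{-1}\vartheta_{\frac2{10}e,\frac1{20}e}(\tau/2)\\ \frac{1}{\sqrt2\,\theta_4(2\tau)}\zeta_5^{-2}\vartheta_{\frac4{10}e,\frac1{20}e}(\tau/2)\\ \frac1{\theta_2(\tau/2)}\vartheta_{\frac1{10}e,0}(\tau/2)\\ \frac1{\theta_2(\tau/2)}\vartheta_{\frac3{10}e,0}(\tau/2)\\ \frac1{\theta_2(\frac{\tau+1}2)}\zeta_{80}^{-3}\vartheta_{\frac1{10}e,\frac1{20}e}(\tau/2)\\ \frac1{\theta_2(\frac{\tau+1}2)}\zeta_{80}^{21}\vartheta_{\frac3{10}e,\frac1{20}e}(\tau/2)\end{pmatrix},$$ $$g^{(1)}(\tau)=\sqrt{20}\begin{pmatrix}-g_{\frac4{20},0}-g_{\frac6{20},0}\\ -g_{\frac2{20},0}-g_{\frac8{20},0}\\ g_{\frac4{20},0}-g_{\frac6{20},0}\\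 -g_{\frac2{20},0}+g_{\frac8{20},0}\\ g_{\frac1{20},0}-g_{\frac9{20},0}\\ g_{\frac3{20},0}-g_{\frac7{20},0}\end{pmatrix}(20\tau),\qquad g^{(2)}(\tau)=\sqrt{10}\begin{pmatrix}-\sqrt2\,\zeta_5^{-1}g_{\frac8{20},\frac12}\\ \sqrt2\,\zeta_5^{2}g_{\frac4{20},\frac12}\\ g_{\frac1{20},0}-g_{\frac9{20},0}\\ g_{\frac3{20},0}-g_{\frac7{20},0}\\ \zeta_{40}^{-1}g_{\frac1{20},\frac12}-\zeta_{40}^{-9}g_{\frac9{20},\frac12}\\ \zeta_{40}^{-3}g_{\frac3{20},\frac12}+\zeta_{40}^{-7}g_{\frac7{20},\frac12}\end{pmatrix}(10\tau),$$ and, for $j=1,2$, componentwise, $$G^{(j)}(\tau)=-i\int_{-\bar\tau}^{i\infty}\frac{g^{(j)}(z)}{\sqrt{-i(z+\tau)}}\,dz,$$ where the path is the vertical half-line $z=-\bar\tau+iu$, $u>0$, and the square root is the principal one. Then all the series above converge absolutely, the $q$-Pochhammer symbols in the denominators and $\theta_2,\theta_3,\theta_4$ do not vanish, the integrals converge absolutely,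 and for every $\tau$ with $\mathrm{Im}\,\tau>0$ $$F^{(1)}(\tau)=H^{(1)}(\tau)+G^{(1)}(\tau),\qquad F^{(2)}(\tau)=H^{(2)}(\tau)+G^{(2)}(\tau).$$ -/

import Mathlib

namespace TenthOrder

noncomputable section

open Complex MeasureTheory

/-! ### Powers of `q`, roots of unity, and the tenth order mock theta functions -/

/-- `q ^ r = e^{2 π i r τ}`, where `q = e^{2 π i τ}`. -/
def qpow (τ : ℂ) (r : ℝ) : ℂ := exp (2 * Real.pi * I * r * τ)

/-- `ζ_n = e^{2 π i / n}`. -/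
def zeta (n : ℕ) : ℂ := exp (2 * Real.pi * I / n)

/-- The `q`-Pochhammer symbol `(a;q)_n = (1 - a) (1 - a q) ⋯ (1 - a q ^ (n - 1))`. -/
def qPoch (a q : ℂ) (n : ℕ) : ℂ := ∏ k ∈ Finset.range n, (1 - a * q ^ k)

def phiTerm (q : ℂ) (n : ℕ) : ℂ := q ^ (n * (n + 1) / 2) / qPoch q (q ^ 2) (n + 1)

def psiTerm (q : ℂ) (n : ℕ) : ℂ := q ^ ((n + 1) * (n + 2) / 2) / qPoch q (q ^ 2) (n + 1)

def XTerm (q : ℂ) (n : ℕ) : ℂ := (-1) ^ n * q ^ (n ^ 2) / qPoch (-q) q (2 * n)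

def chiTerm (q : ℂ) (n : ℕ) : ℂ := (-1) ^ n * q ^ ((n + 1) ^ 2) / qPoch (-q) q (2 * n + 1)

/-- The tenth order mock theta function `φ(q)`. -/
def phi (q : ℂ) : ℂ := ∑' n : ℕ, phiTerm q n

/-- The tenth order mock theta function `ψ(q)`. -/
def psi (q : ℂ) : ℂ := ∑' n : ℕ, psiTerm q n

/-- The tenth order mock theta function `X(q)`. -/
def X (q : ℂ) : ℂ := ∑' n : ℕ, XTerm q n

/-- The tenth order mock theta function `χ(q)`. -/
def chi (q : ℂ) : ℂ := ∑' n : ℕ, chiTerm q n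

/-- The vector `F⁽¹⁾(τ)`. -/
def F1 (τ : ℂ) : Fin 6 → ℂ :=
  ![qpow τ (1 / 10) * phi (qpow τ (1 / 2)),
    qpow τ (-1 / 10) * psi (qpow τ (1 / 2)),
    qpow τ (1 / 10) * phi (-qpow τ (1 / 2)),
    qpow τ (-1 / 10) * psi (-qpow τ (1 / 2)),
    qpow τ (-1 / 40) * X (qpow τ 1),
    qpow τ (-9 / 40) * chi (qpow τ 1)]

/-- The vector `F⁽²⁾(τ)`. -/
def F2 (τ : ℂ) : Fin 6 → ℂ :=
  ![(√2 : ℝ) * qpow τ (1 / 5) * phi (qpow τ 1),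
    (√2 : ℝ) * qpow τ (-1 / 5) * psi (qpow τ 1),
    qpow τ (-1 / 80) * X (qpow τ (1 / 2)),
    qpow τ (-9 / 80) * chi (qpow τ (1 / 2)),
    qpow τ (-1 / 80) * X (-qpow τ (1 / 2)),
    qpow τ (-9 / 80) * chi (-qpow τ (1 / 2))]

/-! ### Classical theta functions -/

def theta2Term (τ : ℂ) (n : ℤ) : ℂ := qpow τ (((n : ℝ) + 1 / 2) ^ 2 / 2)

def theta3Term (τ : ℂ) (n : ℤ) : ℂ := qpow τ ((n : ℝ) ^ 2 / 2)

def theta4Term (τ : ℂ) (n : ℤ) : ℂ := (-1) ^ n * qpow τ ((n : ℝ) ^ 2 / 2)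

def theta2 (τ : ℂ) : ℂ := ∑' n : ℤ, theta2Term τ n

def theta3 (τ : ℂ) : ℂ := ∑' n : ℤ, theta3Term τ n

def theta4 (τ : ℂ) : ℂ := ∑' n : ℤ, theta4Term τ n

/-! ### Zwegers' indefinite theta series -/

/-- The bilinear form `B(x,y) = xᵀ A y`. -/
def bilin {m : ℕ} (A : Matrix (Fin m) (Fin m) ℤ) (x y : Fin m → ℝ) : ℝ :=
  x ⬝ᵥ (A.map (Int.cast : ℤ → ℝ)).mulVec y

/-- The quadratic form `Q(x) = B(x,x) / 2`. -/
def quad {m : ℕ} (A : Matrix (Fin m) (Fin m) ℤ) (x : Fin m → ℝ) : ℝ := bilin A x x / 2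

/-- The error function `E(z) = 2 ∫_0^z e^{-π u²} du`, on the real line. -/
def E (z : ℝ) : ℝ := 2 * ∫ u in (0 : ℝ)..z, Real.exp (-Real.pi * u ^ 2)

/-- The summand of `ϑ_{a,b}(τ)` at `ν = n + a`, `n ∈ ℤ^m`. -/
def varthetaTerm {m : ℕ} (A : Matrix (Fin m) (Fin m) ℤ) (c₁ c₂ a b : Fin m → ℝ) (τ : ℂ)
    (n : Fin m → ℤ) : ℂ :=
  let ν : Fin m → ℝ := fun i => n i + a i
  ((E (bilin A c₁ ν / √(-quad A c₁) * √τ.im) - E (bilin A c₂ ν / √(-quad A c₂) * √τ.im) : ℝ) : ℂ)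
    * qpow τ (quad A ν) * exp (2 * Real.pi * I * bilin A ν b)

/-- Zwegers' indefinite theta series `ϑ_{a,b}(τ)` for the matrix `A` and the vectors `c₁`, `c₂`. -/
def vartheta {m : ℕ} (A : Matrix (Fin m) (Fin m) ℤ) (c₁ c₂ a b : Fin m → ℝ) (τ : ℂ) : ℂ :=
  ∑' n : Fin m → ℤ, varthetaTerm A c₁ c₂ a b τ n

def A : Matrix (Fin 2) (Fin 2) ℤ := !![4, 6; 6, 4]

def c1 : Fin 2 → ℝ := ![-2, 3]

def c2 : Fin 2 → ℝ := ![-3, 2]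

def e : Fin 2 → ℝ := ![1, 1]

def ex : Fin 2 → ℝ := ![1, 0]

theorem quad_c1_neg : quad A c1 < 0 := by
  norm_num [quad, bilin, A, c1, Matrix.mulVec, dotProduct, Fin.sum_univ_two]

theorem quad_c2_neg : quad A c2 < 0 := by
  norm_num [quad, bilin, A, c2, Matrix.mulVec, dotProduct, Fin.sum_univ_two]

theorem bilin_c1_c2_neg : bilin A c1 c2 < 0 := by
  norm_num [bilin, A, c1, c2, Matrix.mulVec, dotProduct, Fin.sum_univ_two]

/-- `ϑ_{a,b}(τ)` for the specific `A`, `c1`, `c2` above. -/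
def vt (a b : Fin 2 → ℝ) (τ : ℂ) : ℂ := vartheta A c1 c2 a b τ

/-- The completion `H⁽¹⁾(τ)`. -/
def H1 (τ : ℂ) : Fin 6 → ℂ :=
  ![1 / theta4 τ * (1 / 2) *
      (vt ((1 / 10 : ℝ) • e) 0 τ - vt ((1 / 10 : ℝ) • e + (1 / 2 : ℝ) • ex) 0 τ
        - vt ((4 / 10 : ℝ) • e) 0 τ + vt ((4 / 10 : ℝ) • e + (1 / 2 : ℝ) • ex) 0 τ),
    1 / theta4 τ * (1 / 2) *
      (vt ((2 / 10 : ℝ) • e) 0 τ - vt ((2 / 10 : ℝ) • e + (1 / 2 : ℝ) • ex) 0 τ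
        - vt ((3 / 10 : ℝ) • e) 0 τ + vt ((3 / 10 : ℝ) • e + (1 / 2 : ℝ) • ex) 0 τ),
    1 / theta3 τ * (1 / 2) *
      (vt ((1 / 10 : ℝ) • e) 0 τ - vt ((1 / 10 : ℝ) • e + (1 / 2 : ℝ) • ex) 0 τ
        + vt ((4 / 10 : ℝ) • e) 0 τ + vt ((4 / 10 : ℝ) • e + (1 / 2 : ℝ) • ex) 0 τ),
    1 / theta3 τ * (1 / 2) *
      (-vt ((2 / 10 : ℝ) • e) 0 τ - vt ((2 / 10 : ℝ) • e + (1 / 2 : ℝ) • ex) 0 τ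
        - vt ((3 / 10 : ℝ) • e) 0 τ + vt ((3 / 10 : ℝ) • e + (1 / 2 : ℝ) • ex) 0 τ),
    1 / theta2 τ * vt ((1 / 10 : ℝ) • e) 0 τ,
    1 / theta2 τ * vt ((3 / 10 : ℝ) • e) 0 τ]

/-- The completion `H⁽²⁾(τ)`. -/
def H2 (τ : ℂ) : Fin 6 → ℂ :=
  ![1 / ((√2 : ℝ) * theta4 (2 * τ)) * zeta 5 ^ (-1 : ℤ) *
      vt ((2 / 10 : ℝ) • e) ((1 / 20 : ℝ) • e) (τ / 2),
    1 / ((√2 : ℝ) * theta4 (2 * τ)) * zeta 5 ^ (-2 : ℤ) *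
      vt ((4 / 10 : ℝ) • e) ((1 / 20 : ℝ) • e) (τ / 2),
    1 / theta2 (τ / 2) * vt ((1 / 10 : ℝ) • e) 0 (τ / 2),
    1 / theta2 (τ / 2) * vt ((3 / 10 : ℝ) • e) 0 (τ / 2),
    1 / theta2 ((τ + 1) / 2) * zeta 80 ^ (-3 : ℤ) *
      vt ((1 / 10 : ℝ) • e) ((1 / 20 : ℝ) • e) (τ / 2),
    1 / theta2 ((τ + 1) / 2) * zeta 80 ^ (21 : ℤ) *
      vt ((3 / 10 : ℝ) • e) ((1 / 20 : ℝ) • e) (τ / 2)]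

/-! ### Unary theta series, shadows and period integrals -/

/-- The summand of `g_{s,t}(τ)` at `σ = n + s`. -/
def gTerm (s t : ℝ) (τ : ℂ) (n : ℤ) : ℂ :=
  ((n : ℝ) + s : ℝ) * qpow τ (((n : ℝ) + s) ^ 2 / 2) *
    exp (2 * Real.pi * I * ((n : ℝ) + s : ℝ) * t)

/-- The weight `3/2` unary theta series `g_{s,t}(τ)`. -/
def g (s t : ℝ) (τ : ℂ) : ℂ := ∑' n : ℤ, gTerm s t τ n

/-- The shadow vector `g⁽¹⁾(τ)`. -/
def g1 (τ : ℂ) : Fin 6 → ℂ :=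
  ((√20 : ℝ) : ℂ) •
  ![-g (4 / 20) 0 (20 * τ) - g (6 / 20) 0 (20 * τ),
    -g (2 / 20) 0 (20 * τ) - g (8 / 20) 0 (20 * τ),
    g (4 / 20) 0 (20 * τ) - g (6 / 20) 0 (20 * τ),
    -g (2 / 20) 0 (20 * τ) + g (8 / 20) 0 (20 * τ),
    g (1 / 20) 0 (20 * τ) - g (9 / 20) 0 (20 * τ),
    g (3 / 20) 0 (20 * τ) - g (7 / 20) 0 (20 * τ)]

/-- The shadow vector `g⁽²⁾(τ)`. -/
def g2 (τ : ℂ) : Fin 6 → ℂ :=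
  ((√10 : ℝ) : ℂ) •
  ![-(√2 : ℝ) * zeta 5 ^ (-1 : ℤ) * g (8 / 20) (1 / 2) (10 * τ),
    (√2 : ℝ) * zeta 5 ^ (2 : ℤ) * g (4 / 20) (1 / 2) (10 * τ),
    g (1 / 20) 0 (10 * τ) - g (9 / 20) 0 (10 * τ),
    g (3 / 20) 0 (10 * τ) - g (7 / 20) 0 (10 * τ),
    zeta 40 ^ (-1 : ℤ) * g (1 / 20) (1 / 2) (10 * τ)
      - zeta 40 ^ (-9 : ℤ) * g (9 / 20) (1 / 2) (10 * τ),
    zeta 40 ^ (-3 : ℤ) * g (3 / 20) (1 / 2) (10 * τ)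
      + zeta 40 ^ (-7 : ℤ) * g (7 / 20) (1 / 2) (10 * τ)]

/-- The integrand `f(z) (-i (z + τ))^{-1/2} dz/du` along the vertical half-line
`z = -conj τ + i u`, `u > 0`, which runs from `-conj τ` to `i∞`; principal square root. -/
def periodIntegrand (f : ℂ → Fin 6 → ℂ) (τ : ℂ) (j : Fin 6) (u : ℝ) : ℂ :=
  let z : ℂ := -(starRingEnd ℂ) τ + I * u
  f z j / (-I * (z + τ)) ^ (1 / 2 : ℂ) * I

/-- The period integral `-i ∫_{-conj τ}^{i∞} f(z) (-i (z + τ))^{-1/2} dz`, componentwise. -/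
def periodIntegral (f : ℂ → Fin 6 → ℂ) (τ : ℂ) : Fin 6 → ℂ :=
  fun j => -I * ∫ u in Set.Ioi (0 : ℝ), periodIntegrand f τ j u

/-- The nonholomorphic part `G⁽¹⁾(τ)`. -/
def G1 (τ : ℂ) : Fin 6 → ℂ := periodIntegral g1 τ

/-- The nonholomorphic part `G⁽²⁾(τ)`. -/
def G2 (τ : ℂ) : Fin 6 → ℂ := periodIntegral g2 τ

end

end TenthOrder

open TenthOrder

/-! The proof has a holomorphic, a nonholomorphic and an integral ingredient.

Holomorphic: each of φ, ψ, X, χ times a theta series is a Hecke-type double sum of `sg u v` times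
`q` to an indefinite quadratic polynomial. This comes from Bailey pairs. For α_r = (-1)^r
q^{r(r+1)/2} D(r), with D = `diagSum`, the Bailey transforms relative to a = 1 and a = q are
(q)_n/(q)_{2n} and (q)_n/(q)_{2n+1}: Pascal relations between the two kernels and the functional
equations of D give the first-order recurrences `betaOdd_eq` and `betaEven_succ`. Summing the kernel
over n against a suitable weight gives a function of r that satisfies a first-order recurrence, by
telescoping, so it is an explicit power of q (up to sign) times its value δ at r = 0 (for the odd
kernel of χ, a difference of two such powers). Testing on the unit Bailey pair gives δ · theta = 1
(`deltaPhi_mul_theta`, `deltaX_mul_theta`), which evaluates δ and also proves that the theta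
functions do not vanish.

Nonholomorphic: in lattice coordinates, and with τ doubled, the summand of ϑ is (E(√(5y)x) +
E(√(5y)v)) q^{x²+3xv+v²}, where y is the imaginary part. Write E = sgn - `errc`. The sign part is
the Hecke sum. In the `errc` part, x²+3xv+v² = (v+3x/2)² - 5x²/4 makes the sum over v a theta
series. For the shifts that occur, this theta series is either zero or, up to sign, the very theta
function of the Hecke identity. After division only a unary series in `errc` remains
(`indefTheta_X`, `indefTheta_chi`, `indefTheta_phi`, `indefTheta_psi`).

Integral: integrating g term by term along the half-line produces exactly these unary series
(`integral_period_g`).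

Only four base identities are proved in this way. The twelve rows are these four, or follow from
them by τ ↦ 2τ, by τ ↦ τ/2 with a splitting of the lattice by parity, and by τ ↦ τ+1, which changes
the sign of q^{1/2}. -/

namespace TenthOrder
noncomputable section
open Complex MeasureTheory

/-! ### Reciprocal `q`-factorials and Bailey kernels -/

/-- `1 / (q;q)_k` for `k ≥ 0`, extended by zero to negative `k`. -/
def rho (q : ℂ) (k : ℤ) : ℂ := if k < 0 then 0 else (qPoch q q k.toNat)⁻¹

/-- The Bailey kernel relative to `a = 1`. -/
def kerEven (q : ℂ) (n : ℕ) (r : ℤ) : ℂ := rho q (n - r) * rho q (n + r)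

/-- The Bailey kernel relative to `a = q`. -/
def kerOdd (q : ℂ) (n : ℕ) (r : ℤ) : ℂ := rho q (n - r) * rho q (n + r + 1)

/-- The triangular number `r (r + 1) / 2`. -/
def tri (r : ℤ) : ℤ := r * (r + 1) / 2

/-- The sign `(-1) ^ r` of an integer. -/
def alt (r : ℤ) : ℂ := (-1) ^ r

theorem two_mul_tri (r : ℤ) : 2 * tri r = r * (r + 1) := by
  have := Int.even_mul_succ_self r
  unfold tri
  have := this.two_dvd
  omega

theorem alt_add_one (r : ℤ) : alt (r + 1) = -alt r := by
  unfold alt; rw [zpow_add_one₀ (by norm_num)]; ring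

theorem alt_sub_one (r : ℤ) : alt (r - 1) = -alt r := by
  have := alt_add_one (r - 1)
  rw [sub_add_cancel] at this
  rw [this, neg_neg]

theorem alt_neg (r : ℤ) : alt (-r) = alt r := by
  unfold alt; rw [zpow_neg, ← inv_zpow]; norm_num

theorem alt_mul_self (r : ℤ) : alt r * alt r = 1 := by
  unfold alt; rw [← mul_zpow]; norm_num

theorem norm_alt (r : ℤ) : ‖alt r‖ = 1 := by
  unfold alt; rw [norm_zpow]; norm_num

theorem alt_add (r s : ℤ) : alt (r + s) = alt r * alt s := by
  unfold alt; rw [zpow_add₀ (by norm_num)]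

theorem one_sub_pow_ne_zero {q : ℂ} (hq : ‖q‖ < 1) {n : ℕ} (hn : n ≠ 0) : 1 - q ^ n ≠ 0 := by
  intro h
  have h1 : ‖q ^ n‖ = 1 := by rw [← sub_eq_zero.mp h]; simp
  rw [norm_pow] at h1
  have := pow_lt_one₀ (norm_nonneg q) hq hn
  linarith

theorem one_add_pow_ne_zero {q : ℂ} (hq : ‖q‖ < 1) {n : ℕ} (hn : n ≠ 0) : 1 + q ^ n ≠ 0 := by
  intro h
  have h1 : ‖q ^ n‖ = 1 := by
    rw [eq_neg_of_add_eq_zero_right h]; simp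
  rw [norm_pow] at h1
  have := pow_lt_one₀ (norm_nonneg q) hq hn
  linarith

theorem norm_sq_lt_one {q : ℂ} (hq : ‖q‖ < 1) : ‖q ^ 2‖ < 1 := by
  rw [norm_pow]; exact pow_lt_one₀ (norm_nonneg q) hq two_ne_zero

theorem qPoch_succ (a q : ℂ) (n : ℕ) : qPoch a q (n + 1) = qPoch a q n * (1 - a * q ^ n) :=
  Finset.prod_range_succ _ _

theorem qPoch_zero (a q : ℂ) : qPoch a q 0 = 1 := by simp [qPoch]

theorem qPoch_ne_zero {a q : ℂ} (hq : ‖q‖ ≤ 1) (ha : ‖a‖ < 1) (n : ℕ) : qPoch a q n ≠ 0 := by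
  unfold qPoch
  rw [Finset.prod_ne_zero_iff]
  intro k _ h
  have h1 : ‖a * q ^ k‖ = 1 := by rw [← sub_eq_zero.mp h]; simp
  rw [norm_mul, norm_pow] at h1
  have : ‖q‖ ^ k ≤ 1 := pow_le_one₀ (norm_nonneg q) hq
  nlinarith [norm_nonneg a]

theorem rho_of_neg (q : ℂ) {k : ℤ} (hk : k < 0) : rho q k = 0 := by simp [rho, hk]

theorem rho_zero (q : ℂ) : rho q 0 = 1 := by simp [rho, qPoch]

theorem rho_natCast (q : ℂ) (k : ℕ) : rho q k = (qPoch q q k)⁻¹ := by simp [rho]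

/-- Extension by zero keeps the recurrence of 1/(q)_k valid at every integer: at k = 0 the factor 1
- q^k vanishes. Bilateral sums over r therefore never produce boundary terms. -/
theorem rho_sub_one {q : ℂ} (hq : ‖q‖ < 1) (k : ℤ) : rho q (k - 1) = (1 - q ^ k) * rho q k := by
  rcases lt_trichotomy k 0 with h | h | h
  · rw [rho_of_neg q h, rho_of_neg q (by omega), mul_zero]
  · subst h; simp [rho_of_neg]
  · obtain ⟨n, rfl⟩ : ∃ n : ℕ, k = n + 1 := ⟨(k - 1).toNat, by omega⟩
    have h1 := one_sub_pow_ne_zero hq (Nat.succ_ne_zero n)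
    rw [add_sub_cancel_right, rho_natCast]
    have : ((n : ℤ) + 1) = ((n + 1 : ℕ) : ℤ) := by push_cast; rfl
    rw [this, rho_natCast, qPoch_succ, zpow_natCast, mul_inv]
    have h2 : 1 - q * q ^ n = 1 - q ^ (n + 1) := by ring
    rw [h2]
    field_simp

theorem kerEven_neg (q : ℂ) (n : ℕ) (r : ℤ) : kerEven q n (-r) = kerEven q n r := by
  unfold kerEven; rw [sub_neg_eq_add, mul_comm, ← sub_eq_add_neg]

theorem kerOdd_neg (q : ℂ) (n : ℕ) (r : ℤ) : kerOdd q n (-r - 1) = kerOdd q n r := by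
  unfold kerOdd
  rw [mul_comm, show (n : ℤ) + (-r - 1) + 1 = n - r by ring,
    show (n : ℤ) - (-r - 1) = n + r + 1 by ring]

theorem summable_kerEven (q : ℂ) (n : ℕ) (h : ℤ → ℂ) : Summable fun r => kerEven q n r * h r := by
  apply summable_of_ne_finset_zero (s := Finset.Icc (-n : ℤ) n)
  intro r hr
  rw [Finset.mem_Icc, not_and_or] at hr
  unfold kerEven
  rcases hr with hr | hr
  · rw [rho_of_neg q (k := n + r) (by omega)]; ring
  · rw [rho_of_neg q (k := n - r) (by omega)]; ring

theorem summable_kerOdd (q : ℂ) (n : ℕ) (h : ℤ → ℂ) : Summable fun r => kerOdd q n r * h r := by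
  apply summable_of_ne_finset_zero (s := Finset.Icc (-n - 1 : ℤ) n)
  intro r hr
  rw [Finset.mem_Icc, not_and_or] at hr
  unfold kerOdd
  rcases hr with hr | hr
  · rw [rho_of_neg q (k := n + r + 1) (by omega)]; ring
  · rw [rho_of_neg q (k := n - r) (by omega)]; ring

theorem tsum_kerEven_neg (q : ℂ) (n : ℕ) (h : ℤ → ℂ) :
    ∑' r, kerEven q n r * h (-r) = ∑' r, kerEven q n r * h r := by
  rw [← (Equiv.neg ℤ).tsum_eq fun r => kerEven q n r * h r]
  simp [kerEven_neg]

theorem tsum_kerOdd_neg (q : ℂ) (n : ℕ) (h : ℤ → ℂ) :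
    ∑' r, kerOdd q n r * h (-r - 1) = ∑' r, kerOdd q n r * h r := by
  rw [← ((Equiv.neg ℤ).trans (Equiv.subRight 1)).tsum_eq fun r => kerOdd q n r * h r]
  simp [kerOdd_neg]

theorem tsum_kerEven_odd (q : ℂ) (n : ℕ) (h : ℤ → ℂ) (hh : ∀ r, h (-r) = -h r) :
    ∑' r, kerEven q n r * h r = 0 := by
  have := tsum_kerEven_neg q n h
  simp only [hh, mul_neg, tsum_neg] at this
  linear_combination (-1 / 2 : ℂ) * this

theorem tsum_kerOdd_odd (q : ℂ) (n : ℕ) (h : ℤ → ℂ) (hh : ∀ r, h (-r - 1) = -h r) :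
    ∑' r, kerOdd q n r * h r = 0 := by
  have := tsum_kerOdd_neg q n h
  simp only [hh, mul_neg, tsum_neg] at this
  linear_combination (-1 / 2 : ℂ) * this

/-! ### Pascal relations between the kernels relative to a = 1 and a = q. -/

section recurrences
variable {q : ℂ} (hq : ‖q‖ < 1) (hq0 : q ≠ 0) (n : ℕ)
include hq hq0

omit hq0 in
theorem kerEven_add_one (r : ℤ) :
    kerEven q n (r + 1) = (1 - q ^ (n - r)) * kerOdd q n r := by
  unfold kerEven kerOdd
  rw [show (n : ℤ) - (r + 1) = n - r - 1 by ring, rho_sub_one hq, ← add_assoc]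
  ring

omit hq0 in
theorem kerEven_eq (r : ℤ) : kerEven q n r = (1 - q ^ (n + r + 1)) * kerOdd q n r := by
  unfold kerEven kerOdd
  rw [show (n : ℤ) + r = n + r + 1 - 1 by ring, rho_sub_one hq, sub_add_cancel]
  ring

/-- First Pascal relation, from odd to even kernels. -/
theorem tsum_kerOdd_pascal (h : ℤ → ℂ) :
    (1 - q ^ (2 * n + 1)) * ∑' r, kerOdd q n r * h r =
      ∑' r, kerEven q n r * (h (r - 1) + q ^ ((n : ℤ) - r) * h r) := by
  have e1 : ∑' r, kerEven q n r * h (r - 1) = ∑' r, kerEven q n (r + 1) * h r := by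
    rw [← (Equiv.addRight (1 : ℤ)).tsum_eq fun r => kerEven q n r * h (r - 1)]
    simp
  have s1 : Summable fun r => kerEven q n (r + 1) * h r := by
    simp only [kerEven_add_one hq]
    convert summable_kerOdd q n fun r => (1 - q ^ ((n : ℤ) - r)) * h r using 2
    ring
  simp only [mul_add]
  rw [(summable_kerEven q n _).tsum_add (summable_kerEven q n _), e1, ← s1.tsum_add
    (summable_kerEven q n _), ← tsum_mul_left]
  congr 1; ext r
  rw [kerEven_add_one hq, kerEven_eq hq]
  -- With a = q^{n-r} and b = q^{n+r+1}, the relation is 1 - ab = (1 - a) + a(1 - b). The other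
  -- Pascal relations use the same splitting.
  have : q ^ (2 * n + 1) = q ^ ((n : ℤ) - r) * q ^ ((n : ℤ) + r + 1) := by
    rw [← zpow_add₀ hq0, ← zpow_natCast]; congr 1; push_cast; ring
  rw [this]; ring

/-- Second Pascal relation, from odd to even kernels. -/
theorem tsum_kerOdd_pascal' (h : ℤ → ℂ) :
    (1 - q ^ (2 * n + 1)) * ∑' r, kerOdd q n r * h r =
      ∑' r, kerEven q n r * (h r + q ^ ((n : ℤ) + r) * h (r - 1)) := by
  have e1 : ∑' r, kerEven q n r * (q ^ ((n : ℤ) + r) * h (r - 1)) =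
      ∑' r, kerEven q n (r + 1) * (q ^ ((n : ℤ) + r + 1) * h r) := by
    rw [← (Equiv.addRight (1 : ℤ)).tsum_eq
      fun r => kerEven q n r * (q ^ ((n : ℤ) + r) * h (r - 1))]
    simp [add_assoc]
  have s1 : Summable fun r => kerEven q n (r + 1) * (q ^ ((n : ℤ) + r + 1) * h r) := by
    simp only [kerEven_add_one hq]
    convert summable_kerOdd q n fun r =>
      (1 - q ^ ((n : ℤ) - r)) * (q ^ ((n : ℤ) + r + 1) * h r) using 2
    ring
  simp only [mul_add]
  rw [(summable_kerEven q n _).tsum_add (summable_kerEven q n _), e1,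
    ← (summable_kerEven q n _).tsum_add s1, ← tsum_mul_left]
  congr 1; ext r
  rw [kerEven_add_one hq, kerEven_eq hq]
  have : q ^ (2 * n + 1) = q ^ ((n : ℤ) - r) * q ^ ((n : ℤ) + r + 1) := by
    rw [← zpow_add₀ hq0, ← zpow_natCast]; congr 1; push_cast; ring
  rw [this]; ring

/-- Pascal relation from even to odd kernels. -/
theorem tsum_kerEven_pascal (h : ℤ → ℂ) :
    (1 - q ^ (2 * (n + 1))) * ∑' r, kerEven q (n + 1) r * h r =
      ∑' r, kerOdd q n r * (h r + q ^ ((n : ℤ) - r) * h (r + 1)) := by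
  have e1 : ∑' r, kerOdd q n r * (q ^ ((n : ℤ) - r) * h (r + 1)) =
      ∑' r, kerOdd q n (r - 1) * (q ^ ((n : ℤ) + 1 - r) * h r) := by
    rw [← (Equiv.addRight (1 : ℤ)).tsum_eq
      fun r => kerOdd q n (r - 1) * (q ^ ((n : ℤ) + 1 - r) * h r)]
    simp
  have h1 (r : ℤ) : kerOdd q n (r - 1) = (1 - q ^ ((n : ℤ) + 1 + r)) * kerEven q (n + 1) r := by
    unfold kerEven kerOdd
    rw [show (n : ℤ) + (r - 1) + 1 = n + 1 + r - 1 by ring, rho_sub_one hq]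
    push_cast
    rw [show (n : ℤ) - (r - 1) = n + 1 - r by ring]
    ring
  have h2 (r : ℤ) : kerOdd q n r = (1 - q ^ ((n : ℤ) + 1 - r)) * kerEven q (n + 1) r := by
    unfold kerEven kerOdd
    rw [show (n : ℤ) - r = n + 1 - r - 1 by ring, rho_sub_one hq]
    push_cast
    rw [show (n : ℤ) + r + 1 = n + 1 + r by ring]
    ring
  have s1 : Summable fun r => kerOdd q n (r - 1) * (q ^ ((n : ℤ) + 1 - r) * h r) := by
    simp only [h1]
    convert summable_kerEven q (n + 1) fun r =>
      (1 - q ^ ((n : ℤ) + 1 + r)) * (q ^ ((n : ℤ) + 1 - r) * h r) using 2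
    ring
  simp only [mul_add]
  rw [(summable_kerOdd q n _).tsum_add (summable_kerOdd q n _), e1,
    ← (summable_kerOdd q n _).tsum_add s1, ← tsum_mul_left]
  congr 1; ext r
  rw [h1, h2]
  have : q ^ (2 * n + 2) = q ^ ((n : ℤ) + 1 - r) * q ^ ((n : ℤ) + 1 + r) := by
    rw [← zpow_add₀ hq0, ← zpow_natCast]; congr 1; push_cast; ring
  rw [mul_one, this]; ring

/-! ### The unit Bailey pairs -/

/-- The same α summed against the odd kernel vanishes, being antisymmetric under r ↦ -r-1. The
second Pascal relation turns that zero into (1 - q^n) times the even sum. -/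
theorem tsum_kerEven_unit :
    ∑' r, kerEven q n r * (alt r * q ^ tri r) = if n = 0 then 1 else 0 := by
  split_ifs with hn
  · subst hn
    rw [tsum_eq_single 0]
    · simp [kerEven, rho_zero, alt, tri]
    · intro r hr
      unfold kerEven
      rcases lt_or_gt_of_ne hr with h | h
      · rw [rho_of_neg q (k := (0 : ℕ) + r) (by simpa using h)]; ring
      · rw [rho_of_neg q (k := (0 : ℕ) - r) (by simpa using h)]; ring
  · have h0 : ∑' r, kerOdd q n r * (alt r * q ^ tri r) = 0 := by
      apply tsum_kerOdd_odd
      intro r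
      have : tri (-r - 1) = tri r := by
        have := two_mul_tri r; have := two_mul_tri (-r - 1); linarith
      rw [this, alt_sub_one, alt_neg]; ring
    have h1 := tsum_kerOdd_pascal' hq hq0 n fun r => alt r * q ^ tri r
    rw [h0, mul_zero] at h1
    have h2 (r : ℤ) : alt r * q ^ tri r + q ^ ((n : ℤ) + r) * (alt (r - 1) * q ^ tri (r - 1)) =
        (1 - q ^ n) * (alt r * q ^ tri r) := by
      have : q ^ ((n : ℤ) + r) * q ^ tri (r - 1) = q ^ n * q ^ tri r := by
        rw [← zpow_natCast, ← zpow_add₀ hq0, ← zpow_add₀ hq0]; congr 1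
        have := two_mul_tri r; have := two_mul_tri (r - 1); linarith
      rw [alt_sub_one]
      linear_combination (-alt r) * this
    simp only [h2, mul_left_comm (kerEven q n _) (1 - q ^ _), tsum_mul_left] at h1
    exact (mul_eq_zero.mp h1.symm).resolve_left (one_sub_pow_ne_zero hq hn)

/-- Since tri r - r = tri(-r), the second Pascal relation reduces this sum to (1 - q^{n+1}) times
the reflected even unit sum. For n = 0 the factors on both sides are 1 - q. -/
theorem tsum_kerOdd_unit :
    ∑' r, kerOdd q n r * (alt r * q ^ (tri r - r)) = if n = 0 then 1 else 0 := by
  have hu := tsum_kerEven_unit hq hq0 n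
  have h1 := tsum_kerOdd_pascal' hq hq0 n fun r => alt r * q ^ (tri r - r)
  have h2 (r : ℤ) : alt r * q ^ (tri r - r) +
      q ^ ((n : ℤ) + r) * (alt (r - 1) * q ^ (tri (r - 1) - (r - 1))) =
        (1 - q ^ (n + 1)) * (alt (-r) * q ^ (tri (-r))) := by
    have e1 : q ^ ((n : ℤ) + r) * q ^ (tri (r - 1) - (r - 1)) = q ^ (n + 1) * q ^ tri (-r) := by
      rw [← zpow_natCast, ← zpow_add₀ hq0, ← zpow_add₀ hq0]; congr 1
      have := two_mul_tri (-r); have := two_mul_tri (r - 1); push_cast; linarith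
    have e2 : tri r - r = tri (-r) := by
      have := two_mul_tri (-r); have := two_mul_tri r; linarith
    rw [alt_sub_one, alt_neg, e2]
    linear_combination (-alt r) * e1
  simp only [h2, mul_left_comm (kerEven q n _) (1 - q ^ _), tsum_mul_left] at h1
  rw [tsum_kerEven_neg q n fun r => alt r * q ^ tri r, hu] at h1
  split_ifs with hn
  · subst hn
    simp only [if_true] at h1
    apply mul_left_cancel₀ (one_sub_pow_ne_zero hq (n := 2 * 0 + 1) (by simp))
    rw [h1]
  · simp only [hn, if_false, mul_zero] at h1
    exact (mul_eq_zero.mp h1).resolve_left (one_sub_pow_ne_zero hq (by simp))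

end recurrences

/-! ### Hecke-type Bailey pairs -/

/-- The indicator of the first quadrant minus the indicator of the open third quadrant. -/
def sg (u v : ℤ) : ℤ := (if 0 ≤ u ∧ 0 ≤ v then 1 else 0) - (if u < 0 ∧ v < 0 then 1 else 0)

/-- The anti-diagonal sums `∑_{u+v=r} sg(u,v) q^{uv}`. -/
def diagSum (q : ℂ) (r : ℤ) : ℂ := ∑' u : ℤ, (sg u (r - u) : ℂ) * q ^ (u * (r - u))

theorem summable_diagSum (r : ℤ) (h : ℤ → ℂ) :
    Summable fun u : ℤ => (sg u (r - u) : ℂ) * h u := by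
  apply summable_of_ne_finset_zero (s := Finset.Icc (-|r|) |r|)
  intro u hu
  rw [Finset.mem_Icc, not_and_or] at hu
  have : sg u (r - u) = 0 := by
    unfold sg
    have h1 := le_abs_self r
    have h2 := neg_abs_le r
    split_ifs <;> first | rfl | omega
  simp [this]

/-- Negating (u, v) exchanges the quadrants up to the axes: sg(-u,-v) + sg(u,v) counts u = 0 and v =
0, and there q^{uv} = 1. This is where the constant 2 comes from. -/
theorem diagSum_neg (q : ℂ) (r : ℤ) : diagSum q (-r) = 2 - diagSum q r := by
  have h1 : diagSum q (-r) = ∑' u : ℤ, (sg (-u) (-(r - u)) : ℂ) * q ^ (u * (r - u)) := by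
    unfold diagSum
    rw [← (Equiv.neg ℤ).tsum_eq fun u => (sg u (-r - u) : ℂ) * q ^ (u * (-r - u))]
    congr 1; ext u
    simp only [Equiv.neg_apply]
    congr 2 <;> [congr 2; skip] <;> ring
  have h2 (u : ℤ) : (sg (-u) (-(r - u)) : ℂ) * q ^ (u * (r - u)) =
      ((if u = 0 then 1 else 0) + (if u = r then 1 else 0)) -
        (sg u (r - u) : ℂ) * q ^ (u * (r - u)) := by
    have h3 : sg (-u) (-(r - u)) = (if u = 0 then 1 else 0) + (if u = r then 1 else 0)
        - sg u (r - u) := by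
      unfold sg
      split_ifs <;> omega
    rw [h3]
    push_cast
    split_ifs with a b b
    · subst a; simp
    · subst a; simp
    · subst b; simp
    · simp
  have s1 : HasSum (fun u : ℤ => if u = 0 then (1 : ℂ) else 0) 1 := hasSum_ite_eq 0 1
  have s2 : HasSum (fun u : ℤ => if u = r then (1 : ℂ) else 0) 1 := hasSum_ite_eq r 1
  rw [h1]
  simp only [h2]
  rw [((s1.add s2).sub (summable_diagSum r _).hasSum).tsum_eq]
  unfold diagSum
  norm_num

/-- Shift both coordinates by one. The exponent (u+1)(v+1) equals uv + (r+1), and the quadrant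
indicator gains only the points u = -1 and v = -1, each with exponent zero. -/
theorem diagSum_add_two {q : ℂ} (hq0 : q ≠ 0) (r : ℤ) :
    diagSum q (r + 2) = 2 + q ^ (r + 1) * diagSum q r := by
  have h1 : diagSum q (r + 2) =
      ∑' u : ℤ, (sg (u + 1) (r - u + 1) : ℂ) * q ^ ((u + 1) * (r - u + 1)) := by
    unfold diagSum
    rw [← (Equiv.addRight (1 : ℤ)).tsum_eq fun u => (sg u (r + 2 - u) : ℂ) * q ^ (u * (r + 2 - u))]
    congr 1; ext u
    simp only [Equiv.coe_addRight]
    rw [show r + 2 - (u + 1) = r - u + 1 by ring]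
  have h2 (u : ℤ) : (sg (u + 1) (r - u + 1) : ℂ) * q ^ ((u + 1) * (r - u + 1)) =
      ((if u = -1 then 1 else 0) + (if u = r + 1 then 1 else 0)) +
        q ^ (r + 1) * ((sg u (r - u) : ℂ) * q ^ (u * (r - u))) := by
    have h3 : sg (u + 1) (r - u + 1) = (if u = -1 then 1 else 0) + (if u = r + 1 then 1 else 0)
        + sg u (r - u) := by
      unfold sg
      split_ifs <;> omega
    rw [h3, show (u + 1) * (r - u + 1) = (r + 1) + u * (r - u) by ring, zpow_add₀ hq0]
    push_cast
    have h4 (h : u = -1 ∨ u = r + 1) : q ^ (r + 1) * q ^ (u * (r - u)) = 1 := by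
      rw [← zpow_add₀ hq0, show (r + 1) + u * (r - u) = (u + 1) * (r - u + 1) by ring]
      rcases h with h | h <;> subst h <;> simp
    split_ifs with a b b
    · linear_combination 2 * h4 (Or.inl a)
    · linear_combination h4 (Or.inl a)
    · linear_combination h4 (Or.inr b)
    · ring
  have s1 : HasSum (fun u : ℤ => if u = -1 then (1 : ℂ) else 0) 1 := hasSum_ite_eq (-1) 1
  have s2 : HasSum (fun u : ℤ => if u = r + 1 then (1 : ℂ) else 0) 1 := hasSum_ite_eq (r + 1) 1
  rw [h1]
  simp only [h2]
  rw [((s1.add s2).add ((summable_diagSum r _).hasSum.mul_left _)).tsum_eq]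
  unfold diagSum
  norm_num

/-- The inhomogeneous terms of the two functional equations cancel, leaving a pure antisymmetry; the
vanishing sums below rest on it. -/
theorem diagSum_neg_sub_one {q : ℂ} (hq0 : q ≠ 0) (r : ℤ) :
    diagSum q (-r - 1) = -(q ^ r * diagSum q (r - 1)) := by
  rw [show -r - 1 = -(r + 1) by ring, diagSum_neg, show r + 1 = (r - 1) + 2 by ring,
    diagSum_add_two hq0, sub_add_cancel]
  ring

theorem diagSum_zero (q : ℂ) : diagSum q 0 = 1 := by
  have := diagSum_neg q 0
  rw [neg_zero] at this
  linear_combination this / 2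

section pairs
variable {q : ℂ} (hq : ‖q‖ < 1) (hq0 : q ≠ 0) (n : ℕ)
include hq0

/-- `β_n = (q)_n / (q)_{2n}`, given as the Bailey transform of its Hecke-type partner. -/
def betaEven (q : ℂ) (n : ℕ) : ℂ := ∑' r, kerEven q n r * (alt r * q ^ tri r * diagSum q r)

/-- `β_n = (q)_n / (q)_{2n+1}`, given as the Bailey transform of its Hecke-type partner. -/
def betaOdd (q : ℂ) (n : ℕ) : ℂ := ∑' r, kerOdd q n r * (alt r * q ^ tri r * diagSum q r)

omit hq0 in
theorem betaEven_zero : betaEven q 0 = 1 := by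
  unfold betaEven
  rw [tsum_eq_single 0]
  · simp [kerEven, rho_zero, alt, tri, diagSum_zero]
  · intro r hr
    unfold kerEven
    rcases lt_or_gt_of_ne hr with h | h
    · rw [rho_of_neg q (k := (0 : ℕ) + r) (by simpa using h)]; ring
    · rw [rho_of_neg q (k := (0 : ℕ) - r) (by simpa using h)]; ring

theorem tsum_kerEven_diagSum_pred :
    ∑' r, kerEven q n r * (alt r * q ^ tri r * diagSum q (r - 1)) = 0 := by
  apply tsum_kerEven_odd
  intro r
  have : q ^ tri (-r) * q ^ r = q ^ tri r := by
    rw [← zpow_add₀ hq0]; congr 1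
    have := two_mul_tri r; have := two_mul_tri (-r); linarith
  rw [diagSum_neg_sub_one hq0, alt_neg, ← this]
  ring

include hq

/-- The second Pascal relation splits the sum into a D(r) part, which is `betaEven`, and a multiple
of the D(r-1) part, which is odd in r and vanishes. -/
theorem betaOdd_eq : (1 - q ^ (2 * n + 1)) * betaOdd q n = betaEven q n := by
  unfold betaOdd betaEven
  rw [tsum_kerOdd_pascal' hq hq0]
  have h2 (r : ℤ) : kerEven q n r * (alt r * q ^ tri r * diagSum q r +
      q ^ ((n : ℤ) + r) * (alt (r - 1) * q ^ tri (r - 1) * diagSum q (r - 1))) =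
      kerEven q n r * (alt r * q ^ tri r * diagSum q r)
      - q ^ n * (kerEven q n r * (alt r * q ^ tri r * diagSum q (r - 1))) := by
    have : q ^ ((n : ℤ) + r) * q ^ tri (r - 1) = q ^ n * q ^ tri r := by
      rw [← zpow_natCast, ← zpow_add₀ hq0, ← zpow_add₀ hq0]; congr 1
      have := two_mul_tri r; have := two_mul_tri (r - 1); linarith
    rw [alt_sub_one]
    linear_combination (-alt r * diagSum q (r - 1) * kerEven q n r) * this
  simp only [h2]
  rw [(summable_kerEven q n _).tsum_sub ((summable_kerEven q n _).mul_left _), tsum_mul_left,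
    tsum_kerEven_diagSum_pred hq0]
  ring

/-- The even-to-odd Pascal relation gives (1 - q^{2n+2}) β = (1 - q^{n+1}) `betaOdd`. The shifted
sum with D(r+1) again equals `betaOdd`: reflect r ↦ -r-1 and use D(-r) = 2 - D(r), where the
constant 2 contributes an antisymmetric sum. -/
theorem betaEven_succ : (1 + q ^ (n + 1)) * betaEven q (n + 1) = betaOdd q n := by
  have h0 : ∑' r, kerOdd q n r * (alt r * q ^ tri r) = 0 := by
    apply tsum_kerOdd_odd
    intro r
    have : tri (-r - 1) = tri r := by
      have := two_mul_tri r; have := two_mul_tri (-r - 1); linarith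
    rw [this, alt_sub_one, alt_neg]; ring
  have h1 := tsum_kerEven_pascal hq hq0 n fun r => alt r * q ^ tri r * diagSum q r
  have h2 (r : ℤ) : kerOdd q n r * (alt r * q ^ tri r * diagSum q r +
      q ^ ((n : ℤ) - r) * (alt (r + 1) * q ^ tri (r + 1) * diagSum q (r + 1))) =
      kerOdd q n r * (alt r * q ^ tri r * diagSum q r)
      - q ^ (n + 1) * (kerOdd q n r * (alt r * q ^ tri r * diagSum q (r + 1))) := by
    have : q ^ ((n : ℤ) - r) * q ^ tri (r + 1) = q ^ (n + 1) * q ^ tri r := by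
      rw [← zpow_natCast, ← zpow_add₀ hq0, ← zpow_add₀ hq0]; congr 1
      have := two_mul_tri r; have := two_mul_tri (r + 1); push_cast; linarith
    rw [alt_add_one]
    linear_combination (-alt r * diagSum q (r + 1) * kerOdd q n r) * this
  have h3 : ∑' r, kerOdd q n r * (alt r * q ^ tri r * diagSum q (r + 1)) = betaOdd q n := by
    rw [← tsum_kerOdd_neg]
    unfold betaOdd
    have h4 (r : ℤ) : kerOdd q n r *
        (alt (-r - 1) * q ^ tri (-r - 1) * diagSum q (-r - 1 + 1)) =
        kerOdd q n r * (alt r * q ^ tri r * diagSum q r) -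
        2 * (kerOdd q n r * (alt r * q ^ tri r)) := by
      have : tri (-r - 1) = tri r := by
        have := two_mul_tri r; have := two_mul_tri (-r - 1); linarith
      rw [this, alt_sub_one, alt_neg, sub_add_cancel, diagSum_neg]
      ring
    simp only [h4]
    rw [(summable_kerOdd q n _).tsum_sub ((summable_kerOdd q n _).mul_left _), tsum_mul_left, h0]
    ring
  simp only [h2] at h1
  rw [(summable_kerOdd q n _).tsum_sub ((summable_kerOdd q n _).mul_left _), tsum_mul_left,
    h3] at h1
  apply mul_left_cancel₀ (one_sub_pow_ne_zero hq (n := n + 1) (by simp))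
  change (1 - q ^ (2 * (n + 1))) * betaEven q (n + 1) = betaOdd q n - _ * betaOdd q n at h1
  linear_combination h1

/-- A companion Bailey pair: the extra factor q^{n+1} in β is what separates ψ from φ, and, in base
q², what produces χ. -/
theorem tsum_kerOdd_diagSum_succ :
    ∑' r, kerOdd q n r * (alt r * q ^ tri (r + 1) * diagSum q r) =
      q ^ (n + 1) * betaOdd q n := by
  have h1 := tsum_kerOdd_pascal hq hq0 n fun r => alt r * q ^ tri (r + 1) * diagSum q r
  have h2 (r : ℤ) : kerEven q n r * (alt (r - 1) * q ^ tri (r - 1 + 1) * diagSum q (r - 1) +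
      q ^ ((n : ℤ) - r) * (alt r * q ^ tri (r + 1) * diagSum q r)) =
      q ^ (n + 1) * (kerEven q n r * (alt r * q ^ tri r * diagSum q r))
      - kerEven q n r * (alt r * q ^ tri r * diagSum q (r - 1)) := by
    have : q ^ ((n : ℤ) - r) * q ^ tri (r + 1) = q ^ (n + 1) * q ^ tri r := by
      rw [← zpow_natCast, ← zpow_add₀ hq0, ← zpow_add₀ hq0]; congr 1
      have := two_mul_tri r; have := two_mul_tri (r + 1); push_cast; linarith
    rw [alt_sub_one, sub_add_cancel]
    linear_combination (alt r * diagSum q r * kerEven q n r) * this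
  simp only [h2] at h1
  rw [((summable_kerEven q n _).mul_left _).tsum_sub (summable_kerEven q n _), tsum_mul_left,
    tsum_kerEven_diagSum_pred hq0] at h1
  apply mul_left_cancel₀ (one_sub_pow_ne_zero hq (n := 2 * n + 1) (by simp))
  rw [h1, mul_left_comm, betaOdd_eq hq hq0]
  unfold betaEven
  ring

end pairs

/-! ### Crude bounds and summability -/

theorem norm_qPoch_le {a q : ℂ} (hq : ‖q‖ ≤ 1) (ha : ‖a‖ ≤ 1) (n : ℕ) : ‖qPoch a q n‖ ≤ 2 ^ n := by
  induction n with
  | zero => simp [qPoch_zero]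
  | succ n ih =>
    rw [qPoch_succ, norm_mul, pow_succ]
    have h1 : ‖a * q ^ n‖ ≤ 1 := by
      rw [norm_mul, norm_pow]
      exact mul_le_one₀ ha (by positivity) (pow_le_one₀ (norm_nonneg _) hq)
    have h2 : ‖1 - a * q ^ n‖ ≤ 2 := by
      calc ‖1 - a * q ^ n‖ ≤ ‖(1 : ℂ)‖ + ‖a * q ^ n‖ := norm_sub_le _ _
        _ ≤ 2 := by rw [norm_one]; linarith
    exact mul_le_mul ih h2 (norm_nonneg _) (by positivity)

theorem norm_inv_qPoch_le {a q : ℂ} {s : ℝ} (hs : s < 1) (hq : ‖q‖ ≤ 1) (ha : ‖a‖ ≤ s) (n : ℕ) :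
    ‖(qPoch a q n)⁻¹‖ ≤ ((1 - s)⁻¹) ^ n := by
  induction n with
  | zero => simp [qPoch_zero]
  | succ n ih =>
    rw [qPoch_succ, mul_inv, norm_mul, pow_succ]
    have h1 : ‖a * q ^ n‖ ≤ s := by
      rw [norm_mul, norm_pow]
      calc ‖a‖ * ‖q‖ ^ n ≤ ‖a‖ * 1 := by gcongr; exact pow_le_one₀ (norm_nonneg _) hq
        _ ≤ s := by linarith
    have h2 : 1 - s ≤ ‖1 - a * q ^ n‖ := by
      have := norm_sub_norm_le (1 : ℂ) (a * q ^ n)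
      rw [norm_one] at this; linarith
    have h3 : ‖(1 - a * q ^ n)⁻¹‖ ≤ (1 - s)⁻¹ := by
      rw [norm_inv]; exact inv_anti₀ (by linarith) h2
    have : 0 < 1 - s := by linarith
    exact mul_le_mul ih h3 (norm_nonneg _) (by positivity)

theorem natTri_succ (n : ℕ) : (n + 1) * (n + 1 + 1) / 2 = n * (n + 1) / 2 + (n + 1) := by
  have h1 := (Nat.even_mul_succ_self n).two_dvd
  have h2 := (Nat.even_mul_succ_self (n + 1)).two_dvd
  have h3 : (n + 1) * (n + 1 + 1) = n * (n + 1) + 2 * (n + 1) := by ring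
  omega

theorem natTri_le_sq (n : ℕ) : n * (n + 1) / 2 ≤ n ^ 2 := by
  rcases n with _ | n
  · simp
  · apply Nat.div_le_of_le_mul
    nlinarith

theorem summable_pow_tri {s : ℝ} (hs0 : 0 ≤ s) (hs : s < 1) (D : ℝ) :
    Summable fun n : ℕ => s ^ (n * (n + 1) / 2) * D ^ n := by
  apply summable_of_ratio_norm_eventually_le (r := 1 / 2) (by norm_num)
  have ht : Filter.Tendsto (fun n : ℕ => s ^ (n + 1) * |D|) Filter.atTop (nhds (0 * |D|)) :=
    ((tendsto_pow_atTop_nhds_zero_of_lt_one hs0 hs).comp (Filter.tendsto_add_atTop_nat 1)).mul_const _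
  rw [zero_mul] at ht
  filter_upwards [ht.eventually_le_const (show (0 : ℝ) < 1 / 2 by norm_num)] with n hn
  rw [natTri_succ, pow_add, pow_succ D, norm_mul, norm_mul, norm_mul, norm_mul,
    Real.norm_of_nonneg (pow_nonneg hs0 _), Real.norm_of_nonneg (pow_nonneg hs0 _),
    Real.norm_eq_abs D]
  calc _ = (s ^ (n + 1) * |D|) * (s ^ (n * (n + 1) / 2) * ‖D ^ n‖) := by ring
    _ ≤ _ := by gcongr

/-- The product vanishes unless both indices are nonnegative, and then it has a + b factors. For
Bailey kernels a + b does not involve r, so the bound is uniform in r. -/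
theorem norm_rho_mul_rho_le {q : ℂ} (hq : ‖q‖ < 1) {a b : ℤ} {m : ℕ} (h : a + b ≤ m) :
    ‖rho q a * rho q b‖ ≤ ((1 - ‖q‖)⁻¹) ^ m := by
  have h0 : 0 < 1 - ‖q‖ := by linarith
  have h1 : 1 ≤ (1 - ‖q‖)⁻¹ := (one_le_inv₀ h0).mpr (by linarith [norm_nonneg q])
  rcases lt_or_ge a 0 with ha | ha
  · rw [rho_of_neg q ha, zero_mul, norm_zero]; positivity
  rcases lt_or_ge b 0 with hb | hb
  · rw [rho_of_neg q hb, mul_zero, norm_zero]; positivity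
  lift a to ℕ using ha
  lift b to ℕ using hb
  rw [rho_natCast, rho_natCast, norm_mul]
  calc _ ≤ ((1 - ‖q‖)⁻¹) ^ a * ((1 - ‖q‖)⁻¹) ^ b :=
        mul_le_mul (norm_inv_qPoch_le hq hq.le le_rfl a) (norm_inv_qPoch_le hq hq.le le_rfl b)
          (norm_nonneg _) (by positivity)
    _ = ((1 - ‖q‖)⁻¹) ^ (a + b) := (pow_add _ _ _).symm
    _ ≤ _ := pow_le_pow_right₀ h1 (by omega)

/-- The quadratic exponent of q beats every geometric factor. The base `Q` of the kernel is kept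
separate because X and χ use kernels in base q². -/
theorem exists_summable_bound {q Q : ℂ} (hq : ‖q‖ < 1) (hQ : ‖Q‖ < 1) (D E : ℝ) (w : ℕ → ℂ)
    (hw : ∀ n, ‖w n‖ ≤ ‖q‖ ^ (n * (n + 1) / 2) * (D ^ n * E)) :
    ∃ B : ℕ → ℝ, Summable B ∧
      ∀ (n : ℕ) (a b : ℤ), a + b ≤ 2 * n + 1 → ‖w n * (rho Q a * rho Q b)‖ ≤ B n := by
  set C := (1 - ‖Q‖)⁻¹
  have hC : 0 ≤ C := inv_nonneg.mpr (by linarith)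
  refine ⟨fun n => (E * C) * (‖q‖ ^ (n * (n + 1) / 2) * (D * C ^ 2) ^ n),
    (summable_pow_tri (norm_nonneg q) hq _).mul_left _, fun n a b hab => ?_⟩
  rw [norm_mul]
  have h1 := norm_rho_mul_rho_le hQ (m := 2 * n + 1) (by push_cast; exact hab)
  calc _ ≤ (‖q‖ ^ (n * (n + 1) / 2) * (D ^ n * E)) * C ^ (2 * n + 1) :=
        mul_le_mul (hw n) h1 (norm_nonneg _) ((norm_nonneg _).trans (hw n))
    _ = (E * C) * (‖q‖ ^ (n * (n + 1) / 2) * (D * C ^ 2) ^ n) := by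
        rw [pow_succ, pow_mul, mul_pow D]; ring

/-- Interchange of summation in the limiting Bailey lemma. -/
theorem tsum_bailey {w : ℕ → ℂ} {K : ℕ → ℤ → ℂ} {a : ℤ → ℂ} {B : ℕ → ℝ} (hB : Summable B)
    (hK : ∀ n r, ‖w n * K n r‖ ≤ B n) (ha : Summable fun r => ‖a r‖) :
    ∑' n, w n * ∑' r, K n r * a r = ∑' r, a r * ∑' n, w n * K n r := by
  have hB0 : ∀ n, 0 ≤ B n := fun n => (norm_nonneg _).trans (hK n 0)
  have hs : Summable (Function.uncurry fun (n : ℕ) (r : ℤ) => w n * K n r * a r) := by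
    refine Summable.of_norm_bounded
      (hB.mul_of_nonneg ha hB0 (fun r => norm_nonneg _)) fun p => ?_
    rw [Function.uncurry, norm_mul]
    exact mul_le_mul_of_nonneg_right (hK _ _) (norm_nonneg _)
  have h := hs.tsum_comm
  simp only [mul_assoc, tsum_mul_left] at h
  rw [← h]
  congr 1; ext r
  rw [← tsum_mul_left]
  congr 1; ext n
  ring

theorem tsum_telescope {G : ℕ → ℂ} (hG : Summable G) (h0 : G 0 = 0) :
    ∑' n, (G (n + 1) - G n) = 0 := by
  rw [((summable_nat_add_iff 1).mpr hG).tsum_sub hG, hG.tsum_eq_zero_add, h0]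
  ring

theorem summable_pow_natAbs {s : ℝ} (hs0 : 0 ≤ s) (hs : s < 1) :
    Summable fun r : ℤ => s ^ r.natAbs := by
  have h := summable_geometric_of_lt_one hs0 hs
  apply Summable.of_nat_of_neg <;> simpa using h

/-- Passing to √‖q‖ halves the growth required of the exponent, and the factor ‖q‖⁻¹ pays for the
additive slack 2, so exponents down to -1 are allowed. -/
theorem norm_zpow_le_sqrt_pow {q : ℂ} (hq : ‖q‖ < 1) (hq0 : q ≠ 0) {e : ℤ} {m : ℕ}
    (h : (m : ℤ) ≤ 2 * e + 2) : ‖q ^ e‖ ≤ ‖q‖⁻¹ * √‖q‖ ^ m := by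
  have hp : 0 < ‖q‖ := norm_pos_iff.mpr hq0
  have h1 : ‖q ^ e‖ = ‖q‖⁻¹ * √‖q‖ ^ (2 * (e + 1)) := by
    rw [norm_zpow, zpow_mul]
    have : √‖q‖ ^ (2 : ℤ) = ‖q‖ := by
      rw [show (2 : ℤ) = ((2 : ℕ) : ℤ) by rfl, zpow_natCast, Real.sq_sqrt hp.le]
    rw [this, zpow_add_one₀ hp.ne']
    field_simp
  rw [h1]
  gcongr
  rw [← zpow_natCast]
  exact zpow_le_zpow_right_of_le_one₀ (Real.sqrt_pos.mpr hp)
    (Real.sqrt_le_one.mpr hq.le) (by linarith)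

theorem summable_zpow_int {q : ℂ} (hq : ‖q‖ < 1) (hq0 : q ≠ 0) (e : ℤ → ℤ)
    (he : ∀ r, |r| ≤ 2 * e r + 2) : Summable fun r : ℤ => ‖q ^ e r‖ := by
  have hs : √‖q‖ < 1 := by rw [Real.sqrt_lt' one_pos]; simpa using hq
  refine Summable.of_nonneg_of_le (fun _ => norm_nonneg _) (fun r => ?_)
    ((summable_pow_natAbs (Real.sqrt_nonneg _) hs).mul_left ‖q‖⁻¹)
  exact norm_zpow_le_sqrt_pow hq hq0 (by rw [Int.natCast_natAbs]; exact he r)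

theorem summable_sg_zpow {q : ℂ} (hq : ‖q‖ < 1) (hq0 : q ≠ 0) (e : ℤ → ℤ → ℤ)
    (he : ∀ u v, sg u v ≠ 0 → |u| + |v| ≤ 2 * e u v) :
    Summable fun p : ℤ × ℤ => ‖(sg p.1 p.2 : ℂ) * q ^ e p.1 p.2‖ := by
  have hs : √‖q‖ < 1 := by rw [Real.sqrt_lt' one_pos]; simpa using hq
  have h1 := summable_pow_natAbs (Real.sqrt_nonneg ‖q‖) hs
  have h2 := (h1.mul_of_nonneg h1 (fun _ => by positivity) (fun _ => by positivity)).mul_left ‖q‖⁻¹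
  refine Summable.of_nonneg_of_le (fun _ => norm_nonneg _) (fun p => ?_) h2
  by_cases h : sg p.1 p.2 = 0
  · rw [h, Int.cast_zero, zero_mul, norm_zero]; positivity
  · have h3 : ‖(sg p.1 p.2 : ℂ)‖ ≤ 1 := by
      unfold sg; split_ifs <;> simp
    rw [norm_mul, ← pow_add]
    calc _ ≤ 1 * ‖q ^ e p.1 p.2‖ := by gcongr
      _ ≤ _ := by
        rw [one_mul]
        apply norm_zpow_le_sqrt_pow hq hq0
        push_cast
        have := he _ _ h
        linarith

/-- Fubini in the coordinates (r, u) with r = u + v. -/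
theorem tsum_diagSum {q : ℂ} {c : ℤ → ℂ}
    (hs : Summable fun p : ℤ × ℤ => ‖c (p.1 + p.2) * ((sg p.1 p.2 : ℂ) * q ^ (p.1 * p.2))‖) :
    (Summable fun r => ‖c r * diagSum q r‖) ∧ ∑' r, c r * diagSum q r =
      ∑' p : ℤ × ℤ, c (p.1 + p.2) * ((sg p.1 p.2 : ℂ) * q ^ (p.1 * p.2)) := by
  let φ : ℤ × ℤ ≃ ℤ × ℤ :=
    { toFun := fun p => (p.2, p.1 - p.2)
      invFun := fun p => (p.1 + p.2, p.1)
      left_inv := fun p => by simp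
      right_inv := fun p => by simp }
  let F : ℤ × ℤ → ℂ := fun p => c p.1 * ((sg p.2 (p.1 - p.2) : ℂ) * q ^ (p.2 * (p.1 - p.2)))
  have hF : Summable fun p => ‖F p‖ := by
    convert φ.summable_iff.mpr hs using 1
    ext p; simp [φ, F]
  have h1 (r : ℤ) : c r * diagSum q r = ∑' u, F (r, u) := by
    unfold diagSum; rw [← tsum_mul_left]
  refine ⟨?_, ?_⟩
  · refine Summable.of_nonneg_of_le (fun _ => norm_nonneg _) (fun r => ?_) hF.prod
    rw [h1]
    exact norm_tsum_le_tsum_norm (hF.prod_factor r)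
  · simp only [h1]
    rw [← hF.of_norm.tsum_prod, ← φ.tsum_eq fun p : ℤ × ℤ =>
      c (p.1 + p.2) * ((sg p.1 p.2 : ℂ) * q ^ (p.1 * p.2))]
    congr 1; ext p; simp [φ, F]

theorem sg_cases {u v : ℤ} (h : sg u v ≠ 0) : (0 ≤ u ∧ 0 ≤ v) ∨ (u < 0 ∧ v < 0) := by
  unfold sg at h; split_ifs at h <;> simp_all

/-- Summation of a sequence against the anti-diagonal sums, as a Hecke-type double sum. -/
theorem tsum_zpow_diagSum {q : ℂ} (hq : ‖q‖ < 1) (hq0 : q ≠ 0) {σ : ℤ → ℂ} (hσ : ∀ r, ‖σ r‖ = 1)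
    (e : ℤ → ℤ) (m : ℕ) (he : ∀ u v, sg u v ≠ 0 → |u| + |v| ≤ 2 * (e (u + v) + m * (u * v))) :
    (Summable fun r => ‖σ r * q ^ e r * diagSum (q ^ m) r‖) ∧
      ∑' r, σ r * q ^ e r * diagSum (q ^ m) r = ∑' p : ℤ × ℤ, (sg p.1 p.2 : ℂ) *
        (σ (p.1 + p.2) * q ^ (e (p.1 + p.2) + m * (p.1 * p.2))) := by
  have h1 (u v : ℤ) : σ (u + v) * q ^ e (u + v) * ((sg u v : ℂ) * (q ^ m) ^ (u * v)) =
      (sg u v : ℂ) * (σ (u + v) * q ^ (e (u + v) + m * (u * v))) := by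
    rw [zpow_add₀ hq0, zpow_mul q m (u * v), zpow_natCast]; ring
  have hs := summable_sg_zpow hq hq0 (fun u v => e (u + v) + m * (u * v)) he
  obtain ⟨h2, h3⟩ := tsum_diagSum (q := q ^ m) (c := fun r => σ r * q ^ e r) (by
    convert hs using 2 with p
    rw [h1, norm_mul, norm_mul, norm_mul, hσ, one_mul])
  refine ⟨h2, ?_⟩
  rw [h3]
  simp only [h1]

/-! ### Limiting Bailey weights: the weight for `φ` and `ψ` -/

/-- The weights of the Bailey lemma with `ρ₁ → ∞`, `ρ₂ = -q`, `a = q`. -/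
def weightPhi (q : ℂ) (n : ℕ) : ℂ := q ^ (n * (n + 1) / 2) * qPoch (-q) q n

/-- The transform of the kernel under `weightPhi`. -/
def deltaPhi (q : ℂ) (r : ℤ) : ℂ := ∑' n, weightPhi q n * kerOdd q n r

section phi
variable {q : ℂ} (hq : ‖q‖ < 1) (hq0 : q ≠ 0)
include hq

theorem norm_weightPhi_le (n : ℕ) : ‖weightPhi q n‖ ≤ ‖q‖ ^ (n * (n + 1) / 2) * (2 ^ n * 1) := by
  unfold weightPhi
  rw [norm_mul, norm_pow, mul_one]
  gcongr
  exact norm_qPoch_le hq.le (by rw [norm_neg]; exact hq.le) n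

theorem weightPhi_bound : ∃ B : ℕ → ℝ, Summable B ∧ ∀ (n : ℕ) (a b : ℤ), a + b ≤ 2 * n + 1 →
    ‖weightPhi q n * (rho q a * rho q b)‖ ≤ B n :=
  exists_summable_bound hq hq 2 1 _ (norm_weightPhi_le hq)

include hq0

/-- Creative telescoping: the difference of the two sides is, term by term, G(n+1) - G(n) with
certificate G(n) = -(1 - q^r) w_n kerEven(n, r). -/
theorem deltaPhi_rec (r : ℤ) : deltaPhi q r = q ^ r * deltaPhi q (r - 1) := by
  obtain ⟨B, hB, hb⟩ := weightPhi_bound hq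
  have s1 (r : ℤ) : Summable fun n => weightPhi q n * kerOdd q n r :=
    Summable.of_norm_bounded hB fun n => hb n _ _ (by linarith)
  have s2 : Summable fun n => weightPhi q n * kerEven q n r :=
    Summable.of_norm_bounded hB fun n => hb n _ _ (by linarith)
  -- The kernel at n = 0 is supported at r = 0, where the factor 1 - q^r is zero.
  have h0 : -(1 - q ^ r) * (weightPhi q 0 * kerEven q 0 r) = 0 := by
    unfold kerEven
    rcases lt_trichotomy r 0 with h | h | h
    · rw [rho_of_neg q (k := (0 : ℕ) + r) (by simpa using h)]; ring
    · subst h; simp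
    · rw [rho_of_neg q (k := (0 : ℕ) - r) (by simpa using h)]; ring
  have h1 := tsum_telescope (s2.mul_left (-(1 - q ^ r))) h0
  have h2 (n : ℕ) : -(1 - q ^ r) * (weightPhi q (n + 1) * kerEven q (n + 1) r) -
      -(1 - q ^ r) * (weightPhi q n * kerEven q n r) =
      weightPhi q n * kerOdd q n r - q ^ r * (weightPhi q n * kerOdd q n (r - 1)) := by
    have e1 : weightPhi q (n + 1) = weightPhi q n * (q ^ (n + 1) * (1 + q ^ (n + 1))) := by
      unfold weightPhi
      rw [natTri_succ, pow_add, qPoch_succ]; ring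
    unfold kerEven kerOdd
    push_cast
    have e2 := rho_sub_one hq (n + 1 - r)
    have e3 := rho_sub_one hq (n + 1 + r)
    rw [show (n : ℤ) + 1 - r - 1 = n - r by ring] at e2
    rw [show (n : ℤ) + 1 + r - 1 = n + r by ring] at e3
    rw [show (n : ℤ) - (r - 1) = n + 1 - r by ring, show (n : ℤ) + (r - 1) + 1 = n + r by ring,
      show (n : ℤ) + r + 1 = n + 1 + r by ring, e1, e2, e3]
    have e4 : q ^ ((n : ℤ) + 1 - r) = q ^ (n + 1) * (q ^ r)⁻¹ := by
      rw [zpow_sub₀ hq0, ← zpow_natCast]; push_cast; rw [div_eq_mul_inv]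
    have e5 : q ^ ((n : ℤ) + 1 + r) = q ^ (n + 1) * q ^ r := by
      rw [zpow_add₀ hq0, ← zpow_natCast]; push_cast; rfl
    rw [e4, e5]
    have : q ^ r ≠ 0 := zpow_ne_zero _ hq0
    field_simp
    ring
  simp only [h2] at h1
  rw [(s1 r).tsum_sub ((s1 (r - 1)).mul_left _), tsum_mul_left] at h1
  exact sub_eq_zero.mp h1

theorem deltaPhi_eq (r : ℤ) : deltaPhi q r = deltaPhi q 0 * q ^ tri r := by
  induction r using Int.induction_on with
  | zero => simp [tri]
  | succ i ih =>
    rw [deltaPhi_rec hq hq0, add_sub_cancel_right, ih, mul_left_comm, ← zpow_add₀ hq0]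
    congr 2
    have := two_mul_tri i; have := two_mul_tri (i + 1); linarith
  | pred i ih =>
    have h1 := deltaPhi_rec hq hq0 (-i)
    rw [ih] at h1
    apply mul_left_cancel₀ (zpow_ne_zero (-(i : ℤ)) hq0)
    rw [← h1, mul_left_comm, ← zpow_add₀ hq0]
    congr 2
    have := two_mul_tri (-i); have := two_mul_tri (-i - 1); linarith

theorem tsum_weightPhi {a : ℤ → ℂ} (ha : Summable fun r => ‖a r‖) :
    ∑' n, weightPhi q n * ∑' r, kerOdd q n r * a r = deltaPhi q 0 * ∑' r, a r * q ^ tri r := by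
  obtain ⟨B, hB, hb⟩ := weightPhi_bound hq
  rw [tsum_bailey (K := kerOdd q) hB (fun n r => hb n _ _ (by linarith)) ha, ← tsum_mul_left]
  congr 1; ext r
  change a r * deltaPhi q r = _
  rw [deltaPhi_eq hq hq0]
  ring

/-- Applying the Bailey transform to the unit pair leaves only n = 0 on one side and δ times a theta
series on the other. This evaluates δ without a product formula. -/
theorem deltaPhi_mul_theta : deltaPhi q 0 * ∑' r, alt r * q ^ (r ^ 2) = 1 := by
  have ha : Summable fun r => ‖alt r * q ^ (tri r - r)‖ := by
    simp only [norm_mul, norm_alt, one_mul]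
    refine summable_zpow_int hq hq0 _ fun r => ?_
    have := two_mul_tri r
    rcases abs_cases r with ⟨h, _⟩ | ⟨h, _⟩ <;> rw [h] <;> nlinarith [sq_nonneg (r - 1)]
  have h := tsum_weightPhi hq hq0 ha
  simp only [tsum_kerOdd_unit hq hq0, mul_ite, mul_one, mul_zero, tsum_ite_eq] at h
  have h2 (r : ℤ) : alt r * q ^ (tri r - r) * q ^ tri r = alt r * q ^ (r ^ 2) := by
    rw [mul_assoc, ← zpow_add₀ hq0]
    congr 2
    have := two_mul_tri r; linarith
  simp only [h2] at h
  rw [← h]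
  simp [weightPhi, qPoch_zero]

/-- This amounts to (-q)_n (q)_n / (q)_{2n+1} = 1/(q;q²)_{n+1}, proved by induction through the two
recurrences for β. -/
theorem weightPhi_mul_betaOdd (n : ℕ) : weightPhi q n * betaOdd q n = phiTerm q n := by
  have h : qPoch (-q) q n * betaOdd q n * qPoch q (q ^ 2) (n + 1) = 1 := by
    induction n with
    | zero =>
      have := betaOdd_eq hq hq0 0
      rw [betaEven_zero] at this
      simp only [qPoch, Finset.range_zero, Finset.prod_empty, zero_add, Finset.range_one,
        Finset.prod_singleton, pow_zero, mul_one]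
      simp only [mul_zero, zero_add, pow_one] at this
      linear_combination this
    | succ n ih =>
      rw [qPoch_succ q (q ^ 2) (n + 1), qPoch_succ]
      have h1 := betaOdd_eq hq hq0 (n + 1)
      have h2 := betaEven_succ hq hq0 n
      have e1 : q * (q ^ 2) ^ (n + 1) = q ^ (2 * (n + 1) + 1) := by ring
      have e2 : 1 - -q * q ^ n = 1 + q ^ (n + 1) := by ring
      rw [e1, e2]
      rw [← h2, ← h1] at ih
      linear_combination ih
  have hne := qPoch_ne_zero (norm_sq_lt_one hq).le hq (n + 1)
  unfold weightPhi phiTerm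
  field_simp
  exact h

/-- Hecke-type double sum for `φ`. -/
theorem phi_mul_theta : phi q * ∑' r, alt r * q ^ (r ^ 2) =
    ∑' p : ℤ × ℤ, (sg p.1 p.2 : ℂ) * (alt (p.1 + p.2) *
      q ^ ((p.1 + p.2) ^ 2 + (p.1 + p.2) + p.1 * p.2)) := by
  have ha := (tsum_zpow_diagSum hq hq0 norm_alt tri 1 fun u v h => by
    have h1 := two_mul_tri (u + v)
    rcases sg_cases h with ⟨h2, h3⟩ | ⟨h2, h3⟩
    · rw [abs_of_nonneg h2, abs_of_nonneg h3]; push_cast; nlinarith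
    · rw [abs_of_neg h2, abs_of_neg h3]; push_cast; nlinarith).1
  have hd := (tsum_zpow_diagSum hq hq0 norm_alt (fun r => r ^ 2 + r) 1 fun u v h => by
    rcases sg_cases h with ⟨h2, h3⟩ | ⟨h2, h3⟩
    · rw [abs_of_nonneg h2, abs_of_nonneg h3]; push_cast; nlinarith
    · rw [abs_of_neg h2, abs_of_neg h3]; push_cast; nlinarith).2
  rw [pow_one] at ha hd
  have h := tsum_weightPhi hq hq0 ha
  have h1 : phi q = deltaPhi q 0 * ∑' r, alt r * q ^ (r ^ 2 + r) * diagSum q r := by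
    unfold phi
    simp only [← weightPhi_mul_betaOdd hq hq0]
    unfold betaOdd
    rw [h]
    congr 2; ext r
    have : q ^ (r ^ 2 + r) = q ^ tri r * q ^ tri r := by
      rw [← zpow_add₀ hq0]; congr 1
      have := two_mul_tri r; linarith
    rw [this]; ring
  rw [h1, mul_right_comm, deltaPhi_mul_theta hq hq0, one_mul, hd]
  simp

/-- Hecke-type double sum for `ψ`. -/
theorem psi_mul_theta : psi q * ∑' r, alt r * q ^ (r ^ 2) =
    ∑' p : ℤ × ℤ, (sg p.1 p.2 : ℂ) * (alt (p.1 + p.2) *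
      q ^ ((p.1 + p.2 + 1) ^ 2 + p.1 * p.2)) := by
  have ha := (tsum_zpow_diagSum hq hq0 norm_alt (fun r => tri (r + 1)) 1 fun u v h => by
    have h1 := two_mul_tri (u + v + 1)
    rcases sg_cases h with ⟨h2, h3⟩ | ⟨h2, h3⟩
    · rw [abs_of_nonneg h2, abs_of_nonneg h3]; push_cast; nlinarith
    · rw [abs_of_neg h2, abs_of_neg h3]; push_cast; nlinarith).1
  have hd := (tsum_zpow_diagSum hq hq0 norm_alt (fun r => (r + 1) ^ 2) 1 fun u v h => by
    rcases sg_cases h with ⟨h2, h3⟩ | ⟨h2, h3⟩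
    · rw [abs_of_nonneg h2, abs_of_nonneg h3]; push_cast; nlinarith
    · rw [abs_of_neg h2, abs_of_neg h3]; push_cast; nlinarith).2
  rw [pow_one] at ha hd
  have h := tsum_weightPhi hq hq0 ha
  have h0 (n : ℕ) : psiTerm q n = weightPhi q n * (q ^ (n + 1) * betaOdd q n) := by
    rw [mul_left_comm, weightPhi_mul_betaOdd hq hq0]
    unfold psiTerm phiTerm
    rw [natTri_succ n, pow_add]; ring
  have h1 : psi q = deltaPhi q 0 * ∑' r, alt r * q ^ ((r + 1) ^ 2) * diagSum q r := by
    unfold psi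
    simp only [h0, ← tsum_kerOdd_diagSum_succ hq hq0]
    rw [h]
    congr 2; ext r
    have : q ^ ((r + 1) ^ 2) = q ^ tri (r + 1) * q ^ tri r := by
      rw [← zpow_add₀ hq0]; congr 1
      have := two_mul_tri r; have := two_mul_tri (r + 1); linarith
    rw [this]; ring
  rw [h1, mul_right_comm, deltaPhi_mul_theta hq hq0, one_mul, hd]
  simp

end phi

/-! ### Limiting Bailey weights: the weights for `X` and `χ` -/

/-- The weights, in base `q²`, of the Bailey lemma with `ρ₁ → ∞`, `ρ₂ = q`, `a = 1`. -/
def weightX (q : ℂ) (n : ℕ) : ℂ := qPoch q (q ^ 2) n * (-1) ^ n * q ^ (n ^ 2)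

/-- The weights, in base `q²`, of the Bailey lemma with `ρ₁ → ∞`, `ρ₂ = q³`, `a = q²`. -/
def weightChi (q : ℂ) (n : ℕ) : ℂ := weightX q n * (1 - q ^ (2 * n + 1))

def deltaX (q : ℂ) (r : ℤ) : ℂ := ∑' n, weightX q n * kerEven (q ^ 2) n r

def deltaChi (q : ℂ) (r : ℤ) : ℂ := ∑' n, weightChi q n * kerOdd (q ^ 2) n r

section X
variable {q : ℂ} (hq : ‖q‖ < 1) (hq0 : q ≠ 0)
include hq

theorem norm_weightX_le (n : ℕ) : ‖weightX q n‖ ≤ ‖q‖ ^ (n * (n + 1) / 2) * (2 ^ n * 1) := by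
  unfold weightX
  rw [norm_mul, norm_mul, norm_pow, norm_pow, norm_neg, norm_one, one_pow, mul_one, mul_one,
    mul_comm]
  gcongr ?_ * ?_
  · exact pow_le_pow_of_le_one (norm_nonneg _) hq.le (natTri_le_sq n)
  · exact norm_qPoch_le (norm_sq_lt_one hq).le hq.le n

theorem norm_weightChi_le (n : ℕ) :
    ‖weightChi q n‖ ≤ ‖q‖ ^ (n * (n + 1) / 2) * (2 ^ n * 2) := by
  unfold weightChi
  rw [norm_mul]
  have h2 : ‖1 - q ^ (2 * n + 1)‖ ≤ 2 := by
    calc ‖1 - q ^ (2 * n + 1)‖ ≤ ‖(1 : ℂ)‖ + ‖q ^ (2 * n + 1)‖ := norm_sub_le _ _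
      _ ≤ 2 := by
        rw [norm_one, norm_pow]
        have := pow_le_one₀ (n := 2 * n + 1) (norm_nonneg q) hq.le
        linarith
  calc _ ≤ (‖q‖ ^ (n * (n + 1) / 2) * (2 ^ n * 1)) * 2 :=
        mul_le_mul (norm_weightX_le hq n) h2 (norm_nonneg _) (by positivity)
    _ = _ := by ring

theorem weightX_bound : ∃ B : ℕ → ℝ, Summable B ∧ ∀ (n : ℕ) (a b : ℤ), a + b ≤ 2 * n + 1 →
    ‖weightX q n * (rho (q ^ 2) a * rho (q ^ 2) b)‖ ≤ B n :=
  exists_summable_bound hq (norm_sq_lt_one hq) 2 1 _ (norm_weightX_le hq)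

theorem weightChi_bound : ∃ B : ℕ → ℝ, Summable B ∧ ∀ (n : ℕ) (a b : ℤ), a + b ≤ 2 * n + 1 →
    ‖weightChi q n * (rho (q ^ 2) a * rho (q ^ 2) b)‖ ≤ B n :=
  exists_summable_bound hq (norm_sq_lt_one hq) 2 2 _ (norm_weightChi_le hq)

include hq0

/-- The telescoping sums behind the recurrences for `deltaX` and `deltaChi`. -/
theorem weightX_telescope (r : ℤ) :
    deltaX q r + deltaX q (r + 1) = deltaChi q r ∧
      deltaX q (r + 1) = -q ^ (2 * r + 1) * deltaX q r := by
  have hQ := norm_sq_lt_one hq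
  obtain ⟨B, hB, hb⟩ := weightX_bound hq
  obtain ⟨B', hB', hb'⟩ := weightChi_bound hq
  have s1 (r : ℤ) : Summable fun n => weightX q n * kerEven (q ^ 2) n r :=
    Summable.of_norm_bounded hB fun n => hb n _ _ (by linarith)
  -- A single certificate G(n) = w_n ρ(n-r-1) ρ(n+r) serves both claims: its difference is the
  -- defect of the first, and -(1 + q^{2r+1}) times it that of the second. It vanishes at n = 0
  -- because -r-1 and r cannot both be nonnegative.
  have s2 : Summable fun n : ℕ =>
      weightX q n * (rho (q ^ 2) (n - r - 1) * rho (q ^ 2) (n + r)) :=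
    Summable.of_norm_bounded hB fun n => hb n _ _ (by linarith)
  have s3 : Summable fun n => weightChi q n * kerOdd (q ^ 2) n r :=
    Summable.of_norm_bounded hB' fun n => hb' n _ _ (by linarith)
  have h0 : weightX q 0 * (rho (q ^ 2) ((0 : ℕ) - r - 1) * rho (q ^ 2) ((0 : ℕ) + r)) = 0 := by
    rcases lt_or_ge r 0 with h | h
    · rw [rho_of_neg _ (k := (0 : ℕ) + r) (by simpa using h)]; ring
    · rw [rho_of_neg _ (k := (0 : ℕ) - r - 1) (by push_cast; linarith)]; ring
  have h1 := tsum_telescope s2 h0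
  have hy : q ^ (2 * r + 1) ≠ 0 := zpow_ne_zero _ hq0
  have e4 (n : ℕ) : (q ^ 2) ^ ((n : ℤ) - r) = q ^ (2 * n + 1) * (q ^ (2 * r + 1))⁻¹ := by
    rw [← zpow_natCast q 2, ← zpow_mul, ← zpow_natCast, ← zpow_neg, ← zpow_add₀ hq0]
    congr 1; push_cast; ring
  have e5 (n : ℕ) : (q ^ 2) ^ ((n : ℤ) + r + 1) = q ^ (2 * n + 1) * q ^ (2 * r + 1) := by
    rw [← zpow_natCast q 2, ← zpow_mul, ← zpow_natCast, ← zpow_add₀ hq0]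
    congr 1; push_cast; ring
  have e2 (n : ℕ) : rho (q ^ 2) (n - r - 1) =
      (1 - q ^ (2 * n + 1) * (q ^ (2 * r + 1))⁻¹) * rho (q ^ 2) (n - r) := by
    rw [rho_sub_one hQ, e4]
  have e3 (n : ℕ) : rho (q ^ 2) (n + r) =
      (1 - q ^ (2 * n + 1) * q ^ (2 * r + 1)) * rho (q ^ 2) (n + r + 1) := by
    rw [← e5, ← rho_sub_one hQ, add_sub_cancel_right]
  have e1 (n : ℕ) : weightX q (n + 1) =
      -(weightX q n * ((1 - q ^ (2 * n + 1)) * q ^ (2 * n + 1))) := by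
    unfold weightX
    rw [qPoch_succ, show (n + 1) ^ 2 = n ^ 2 + (2 * n + 1) by ring, pow_add q]
    ring
  have k1 (n : ℕ) : kerEven (q ^ 2) n r = rho (q ^ 2) (n - r) * rho (q ^ 2) (n + r) := rfl
  have k2 (n : ℕ) : kerEven (q ^ 2) n (r + 1) =
      rho (q ^ 2) (n - r - 1) * rho (q ^ 2) (n + r + 1) := by
    unfold kerEven; congr 2 <;> ring
  have k3 (n : ℕ) : kerOdd (q ^ 2) n r = rho (q ^ 2) (n - r) * rho (q ^ 2) (n + r + 1) := rfl
  have g1 (n : ℕ) : rho (q ^ 2) (((n + 1 : ℕ) : ℤ) - r - 1) = rho (q ^ 2) (n - r) := by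
    congr 1; push_cast; ring
  have g2 (n : ℕ) : rho (q ^ 2) (((n + 1 : ℕ) : ℤ) + r) = rho (q ^ 2) (n + r + 1) := by
    congr 1; push_cast; ring
  simp only [g1, g2] at h1
  constructor
  · have h2 (n : ℕ) : weightX q (n + 1) * (rho (q ^ 2) (n - r) * rho (q ^ 2) (n + r + 1)) -
        weightX q n * (rho (q ^ 2) (n - r - 1) * rho (q ^ 2) (n + r)) =
        weightChi q n * kerOdd (q ^ 2) n r -
          (weightX q n * kerEven (q ^ 2) n r + weightX q n * kerEven (q ^ 2) n (r + 1)) := by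
      rw [k1, k2, k3, e1, e2, e3]
      unfold weightChi
      field_simp
      ring
    simp only [h2] at h1
    rw [s3.tsum_sub ((s1 r).add (s1 (r + 1))), (s1 r).tsum_add (s1 (r + 1))] at h1
    exact (sub_eq_zero.mp h1).symm
  · have h2 (n : ℕ) : weightX q n * kerEven (q ^ 2) n (r + 1) +
        q ^ (2 * r + 1) * (weightX q n * kerEven (q ^ 2) n r) = -(1 + q ^ (2 * r + 1)) *
        (weightX q (n + 1) * (rho (q ^ 2) (n - r) * rho (q ^ 2) (n + r + 1)) -
          weightX q n * (rho (q ^ 2) (n - r - 1) * rho (q ^ 2) (n + r))) := by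
      rw [k1, k2, e1, e2, e3]
      field_simp
      ring
    have h3 : ∑' n, (weightX q n * kerEven (q ^ 2) n (r + 1) +
        q ^ (2 * r + 1) * (weightX q n * kerEven (q ^ 2) n r)) = 0 := by
      simp only [h2, tsum_mul_left, h1, mul_zero]
    rw [(s1 (r + 1)).tsum_add ((s1 r).mul_left _), tsum_mul_left] at h3
    unfold deltaX
    linear_combination h3

theorem deltaX_eq (r : ℤ) : deltaX q r = deltaX q 0 * (alt r * q ^ (r ^ 2)) := by
  induction r using Int.induction_on with
  | zero => simp [alt]
  | succ i ih =>
    rw [(weightX_telescope hq hq0 i).2, ih, alt_add_one,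
      show ((i : ℤ) + 1) ^ 2 = 2 * i + 1 + i ^ 2 by ring, zpow_add₀ hq0 (2 * (i : ℤ) + 1)]
    ring
  | pred i ih =>
    have h1 := (weightX_telescope hq hq0 (-i - 1)).2
    rw [sub_add_cancel, ih] at h1
    apply mul_left_cancel₀ (zpow_ne_zero (2 * (-(i : ℤ) - 1) + 1) hq0)
    have : q ^ ((-(i : ℤ)) ^ 2) = q ^ (2 * (-(i : ℤ) - 1) + 1) * q ^ ((-(i : ℤ) - 1) ^ 2) := by
      rw [← zpow_add₀ hq0]; congr 1; ring
    rw [this] at h1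
    rw [alt_sub_one]
    linear_combination h1

theorem deltaChi_eq (r : ℤ) :
    deltaChi q r = deltaX q 0 * (alt r * (q ^ (r ^ 2) - q ^ ((r + 1) ^ 2))) := by
  rw [← (weightX_telescope hq hq0 r).1, deltaX_eq hq hq0 r, deltaX_eq hq hq0 (r + 1), alt_add_one]
  ring

theorem tsum_weightX {a : ℤ → ℂ} (ha : Summable fun r => ‖a r‖) :
    ∑' n, weightX q n * ∑' r, kerEven (q ^ 2) n r * a r =
      deltaX q 0 * ∑' r, a r * (alt r * q ^ (r ^ 2)) := by
  obtain ⟨B, hB, hb⟩ := weightX_bound hq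
  rw [tsum_bailey (K := kerEven (q ^ 2)) hB (fun n r => hb n _ _ (by linarith)) ha,
    ← tsum_mul_left]
  congr 1; ext r
  change a r * deltaX q r = _
  rw [deltaX_eq hq hq0]
  ring

theorem tsum_weightChi {a : ℤ → ℂ} (ha : Summable fun r => ‖a r‖) :
    ∑' n, weightChi q n * ∑' r, kerOdd (q ^ 2) n r * a r =
      deltaX q 0 * ∑' r, a r * (alt r * (q ^ (r ^ 2) - q ^ ((r + 1) ^ 2))) := by
  obtain ⟨B, hB, hb⟩ := weightChi_bound hq
  rw [tsum_bailey (K := kerOdd (q ^ 2)) hB (fun n r => hb n _ _ (by linarith)) ha,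
    ← tsum_mul_left]
  congr 1; ext r
  change a r * deltaChi q r = _
  rw [deltaChi_eq hq hq0]
  ring

omit hq hq0 in
theorem sq_zpow (q : ℂ) (r : ℤ) : (q ^ 2) ^ r = q ^ (2 * r) := by
  rw [← zpow_natCast q 2, ← zpow_mul]; rfl

/-- The unit pair in base q² again: the two signs cancel, and the exponents r(r+1) and r² add up to
2r² + r. -/
theorem deltaX_mul_theta : deltaX q 0 * ∑' r : ℤ, q ^ (2 * r ^ 2 + r) = 1 := by
  have ha : Summable fun r => ‖alt r * (q ^ 2) ^ tri r‖ := by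
    simp only [norm_mul, norm_alt, one_mul]
    refine summable_zpow_int (norm_sq_lt_one hq) (pow_ne_zero 2 hq0) _ fun r => ?_
    have := two_mul_tri r
    rcases abs_cases r with ⟨h, _⟩ | ⟨h, _⟩ <;> rw [h] <;> nlinarith [sq_nonneg (r + 1)]
  have h := tsum_weightX hq hq0 ha
  simp only [tsum_kerEven_unit (norm_sq_lt_one hq) (pow_ne_zero 2 hq0), mul_ite, mul_one, mul_zero,
    tsum_ite_eq] at h
  have h2 (r : ℤ) : alt r * (q ^ 2) ^ tri r * (alt r * q ^ (r ^ 2)) = q ^ (2 * r ^ 2 + r) := by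
    have : q ^ (2 * r ^ 2 + r) = q ^ (2 * tri r) * q ^ (r ^ 2) := by
      rw [← zpow_add₀ hq0]; congr 1
      have := two_mul_tri r; linarith
    rw [this, sq_zpow]
    linear_combination (q ^ (2 * tri r) * q ^ (r ^ 2)) * alt_mul_self r
  simp only [h2] at h
  rw [← h]
  simp [weightX, qPoch_zero]

/-- In base q², (q;q²)_n times β_n = (q²;q²)_n/(q²;q²)_{2n} is 1/(-q;q)_{2n}; the β recurrences
supply the induction. -/
theorem weightX_mul_betaEven (n : ℕ) : weightX q n * betaEven (q ^ 2) n = XTerm q n := by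
  have hQ := norm_sq_lt_one hq
  have hQ0 := pow_ne_zero 2 hq0
  have h : qPoch q (q ^ 2) n * betaEven (q ^ 2) n * qPoch (-q) q (2 * n) = 1 := by
    induction n with
    | zero => simp [qPoch_zero, betaEven_zero]
    | succ n ih =>
      rw [show 2 * (n + 1) = 2 * n + 1 + 1 by ring, qPoch_succ, qPoch_succ, qPoch_succ]
      have h1 := betaEven_succ hQ hQ0 n
      have h2 := betaOdd_eq hQ hQ0 n
      rw [← h2, ← h1] at ih
      simp only [← pow_mul] at *
      linear_combination ih
  have hne : qPoch (-q) q (2 * n) ≠ 0 := qPoch_ne_zero hq.le (by rwa [norm_neg]) _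
  unfold weightX XTerm
  field_simp
  exact h

/-- The factor q^{2n+2} is the q^{n+1} of `tsum_kerOdd_diagSum_succ` in base q². It exceeds (n+1)² -
n² by one, hence the factor q in front of `chiTerm`. -/
theorem weightChi_mul_betaOdd (n : ℕ) :
    weightChi q n * (q ^ (2 * n + 2) * betaOdd (q ^ 2) n) = q * chiTerm q n := by
  have hQ := norm_sq_lt_one hq
  have hQ0 := pow_ne_zero 2 hq0
  have hne : qPoch (-q) q (2 * n) ≠ 0 := qPoch_ne_zero hq.le (by rwa [norm_neg]) _
  have hne' := one_add_pow_ne_zero hq (n := 2 * n + 1) (by simp)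
  have h1 := weightX_mul_betaEven hq hq0 n
  rw [← betaOdd_eq hQ hQ0] at h1
  have e1 : 1 - (q ^ 2) ^ (2 * n + 1) = (1 - q ^ (2 * n + 1)) * (1 + q ^ (2 * n + 1)) := by ring
  have e2 : 1 - -q * q ^ (2 * n) = 1 + q ^ (2 * n + 1) := by ring
  rw [e1] at h1
  unfold chiTerm
  rw [qPoch_succ, e2]
  unfold XTerm at h1
  field_simp at h1 ⊢
  unfold weightChi
  linear_combination q ^ (2 * n + 2) * h1

/-- Hecke-type double sum for `X`. -/
theorem X_mul_theta : X q * ∑' r : ℤ, q ^ (2 * r ^ 2 + r) =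
    ∑' p : ℤ × ℤ, (sg p.1 p.2 : ℂ) *
      q ^ (2 * (p.1 + p.2) ^ 2 + (p.1 + p.2) + 2 * (p.1 * p.2)) := by
  have ha := (tsum_zpow_diagSum hq hq0 norm_alt (fun r => 2 * tri r) 2 fun u v h => by
    have h1 := two_mul_tri (u + v)
    rcases sg_cases h with ⟨h2, h3⟩ | ⟨h2, h3⟩
    · rw [abs_of_nonneg h2, abs_of_nonneg h3]; push_cast; nlinarith
    · rw [abs_of_neg h2, abs_of_neg h3]; push_cast; nlinarith).1
  have hd := (tsum_zpow_diagSum hq hq0 (σ := fun _ => 1) (fun _ => norm_one)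
    (fun r => 2 * r ^ 2 + r) 2 fun u v h => by
    rcases sg_cases h with ⟨h2, h3⟩ | ⟨h2, h3⟩
    · rw [abs_of_nonneg h2, abs_of_nonneg h3]; push_cast; nlinarith
    · rw [abs_of_neg h2, abs_of_neg h3]; push_cast; nlinarith).2
  simp only [← sq_zpow] at ha
  have h := tsum_weightX hq hq0 ha
  have h1 : X q = deltaX q 0 * ∑' r : ℤ, 1 * q ^ (2 * r ^ 2 + r) * diagSum (q ^ 2) r := by
    unfold X
    simp only [← weightX_mul_betaEven hq hq0]
    unfold betaEven
    rw [h]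
    congr 2; ext r
    have : q ^ (2 * r ^ 2 + r) = q ^ (2 * tri r) * q ^ (r ^ 2) := by
      rw [← zpow_add₀ hq0]; congr 1
      have := two_mul_tri r; linarith
    rw [this, sq_zpow]
    linear_combination (q ^ (2 * tri r) * q ^ (r ^ 2) * diagSum (q ^ 2) r) * alt_mul_self r
  rw [h1, mul_right_comm, deltaX_mul_theta hq hq0, one_mul, hd]
  simp

/-- Hecke-type double sum for `χ`. -/
theorem chi_mul_theta : chi q * ∑' r : ℤ, q ^ (2 * r ^ 2 + r) =
    ∑' p : ℤ × ℤ, (sg p.1 p.2 : ℂ) *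
      q ^ (2 * (p.1 + p.2) ^ 2 + 3 * (p.1 + p.2) + 1 + 2 * (p.1 * p.2)) := by
  have hQ := norm_sq_lt_one hq
  have hQ0 := pow_ne_zero 2 hq0
  have ha := (tsum_zpow_diagSum hq hq0 norm_alt (fun r => 2 * tri (r + 1)) 2 fun u v h => by
    have h1 := two_mul_tri (u + v + 1)
    rcases sg_cases h with ⟨h2, h3⟩ | ⟨h2, h3⟩
    · rw [abs_of_nonneg h2, abs_of_nonneg h3]; push_cast; nlinarith
    · rw [abs_of_neg h2, abs_of_neg h3]; push_cast; nlinarith).1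
  have hd := tsum_zpow_diagSum hq hq0 (σ := fun _ => 1) (fun _ => norm_one)
    (fun r => 2 * r ^ 2 + 3 * r + 1) 2 fun u v h => by
    rcases sg_cases h with ⟨h2, h3⟩ | ⟨h2, h3⟩
    · rw [abs_of_nonneg h2, abs_of_nonneg h3]; push_cast; nlinarith
    · rw [abs_of_neg h2, abs_of_neg h3]; push_cast; nlinarith
  have hd' := (tsum_zpow_diagSum hq hq0 (σ := fun _ => 1) (fun _ => norm_one)
    (fun r => 2 * r ^ 2 + 5 * r + 3) 2 fun u v h => by
    rcases sg_cases h with ⟨h2, h3⟩ | ⟨h2, h3⟩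
    · rw [abs_of_nonneg h2, abs_of_nonneg h3]; push_cast; nlinarith
    · rw [abs_of_neg h2, abs_of_neg h3]; push_cast; nlinarith).1
  simp only [← sq_zpow] at ha
  have h := tsum_weightChi hq hq0 ha
  -- The odd transform has two terms, q^{r²} and q^{(r+1)²}. The second gives this series, which is
  -- antisymmetric under r ↦ -2-r; only the first survives.
  have hodd : ∑' r : ℤ, 1 * q ^ (2 * r ^ 2 + 5 * r + 3) * diagSum (q ^ 2) r = 0 := by
    have h1 : ∑' r : ℤ, 1 * q ^ (2 * r ^ 2 + 5 * r + 3) * diagSum (q ^ 2) r =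
        ∑' r : ℤ, -(1 * q ^ (2 * r ^ 2 + 5 * r + 3) * diagSum (q ^ 2) r) := by
      rw [← (Equiv.subLeft (-2 : ℤ)).tsum_eq]
      congr 1; ext r
      rw [Equiv.subLeft_apply, show -2 - r = -(r + 1) - 1 by ring, diagSum_neg_sub_one hQ0,
        add_sub_cancel_right, sq_zpow, one_mul, one_mul, mul_neg, ← mul_assoc, ← zpow_add₀ hq0]
      congr 3; ring
    rw [tsum_neg] at h1
    linear_combination h1 / 2
  have h1 : q * chi q = q * (deltaX q 0 *
      ∑' r : ℤ, 1 * q ^ (2 * r ^ 2 + 3 * r + 1) * diagSum (q ^ 2) r) := by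
    unfold chi
    rw [← tsum_mul_left]
    simp only [← weightChi_mul_betaOdd hq hq0]
    have h2 (n : ℕ) : q ^ (2 * n + 2) * betaOdd (q ^ 2) n = ∑' r, kerOdd (q ^ 2) n r *
        (alt r * (q ^ 2) ^ tri (r + 1) * diagSum (q ^ 2) r) := by
      rw [tsum_kerOdd_diagSum_succ hQ hQ0]; ring
    simp only [h2]
    rw [h, mul_left_comm q]
    congr 1
    have h3 (r : ℤ) : alt r * (q ^ 2) ^ tri (r + 1) * diagSum (q ^ 2) r *
        (alt r * (q ^ r ^ 2 - q ^ (r + 1) ^ 2)) =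
        q * (1 * q ^ (2 * r ^ 2 + 3 * r + 1) * diagSum (q ^ 2) r) -
        1 * q ^ (2 * r ^ 2 + 5 * r + 3) * diagSum (q ^ 2) r := by
      have e1 : q ^ (2 * tri (r + 1)) * q ^ (r ^ 2) = q * q ^ (2 * r ^ 2 + 3 * r + 1) := by
        rw [← zpow_add₀ hq0, ← zpow_one_add₀ hq0]; congr 1
        have := two_mul_tri (r + 1); linarith
      have e2 : q ^ (2 * tri (r + 1)) * q ^ ((r + 1) ^ 2) = q ^ (2 * r ^ 2 + 5 * r + 3) := by
        rw [← zpow_add₀ hq0]; congr 1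
        have := two_mul_tri (r + 1); linarith
      rw [sq_zpow, one_mul, ← e2]
      linear_combination (diagSum (q ^ 2) r) * e1 + (q ^ (2 * tri (r + 1)) *
        (q ^ (r ^ 2) - q ^ ((r + 1) ^ 2)) * diagSum (q ^ 2) r) * alt_mul_self r
    simp only [h3]
    rw [(hd.1.of_norm.mul_left q).tsum_sub hd'.of_norm, hodd, tsum_mul_left, sub_zero]
  rw [mul_left_cancel₀ hq0 h1, mul_right_comm, deltaX_mul_theta hq hq0, one_mul, hd.2]
  simp

end X

/-! ### Convergence of the mock theta series -/

section convergence
variable {q : ℂ} (hq : ‖q‖ < 1)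
include hq

theorem summable_of_qPoch {a Q : ℂ} (ha : ‖a‖ < 1) (hQ : ‖Q‖ ≤ 1) (k m : ℕ → ℕ) (c : ℕ → ℂ)
    (hc : ∀ n, ‖c n‖ ≤ 1) (hk : ∀ n, n * (n + 1) / 2 ≤ k n) (hm : ∀ n, m n ≤ 2 * n + 1) :
    Summable fun n => c n * q ^ k n / qPoch a Q (m n) := by
  set C := (1 - ‖a‖)⁻¹
  have h0 : 0 < 1 - ‖a‖ := by linarith
  have h1 : 1 ≤ C := (one_le_inv₀ h0).mpr (by linarith [norm_nonneg a])
  refine Summable.of_norm_bounded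
    ((summable_pow_tri (norm_nonneg q) hq (C ^ 2)).mul_left C) fun n => ?_
  rw [div_eq_mul_inv, norm_mul, norm_mul, norm_pow]
  calc _ ≤ 1 * ‖q‖ ^ (n * (n + 1) / 2) * C ^ (2 * n + 1) := by
        gcongr ?_ * ?_ * ?_
        · exact hc n
        · exact pow_le_pow_of_le_one (norm_nonneg _) hq.le (hk n)
        · exact (norm_inv_qPoch_le ha hQ le_rfl _).trans (pow_le_pow_right₀ h1 (hm n))
    _ = _ := by rw [pow_succ, pow_mul]; ring

theorem summable_phiTerm : Summable (phiTerm q) := by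
  convert summable_of_qPoch hq hq (norm_sq_lt_one hq).le (fun n => n * (n + 1) / 2)
    (fun n => n + 1) (fun _ => 1) (fun _ => norm_one.le) (fun _ => le_rfl) (fun n => by omega) using 1
  ext n; simp [phiTerm]

theorem summable_psiTerm : Summable (psiTerm q) := by
  convert summable_of_qPoch hq hq (norm_sq_lt_one hq).le (fun n => (n + 1) * (n + 2) / 2)
    (fun n => n + 1) (fun _ => 1) (fun _ => norm_one.le)
    (fun n => Nat.div_le_div_right (by gcongr <;> omega)) (fun n => by omega) using 1
  ext n; simp [psiTerm]

theorem summable_XTerm : Summable (XTerm q) := by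
  exact summable_of_qPoch hq (by rwa [norm_neg]) hq.le (fun n => n ^ 2)
    (fun n => 2 * n) (fun n => (-1) ^ n) (fun n => by simp) natTri_le_sq (fun n => by omega)

theorem summable_chiTerm : Summable (chiTerm q) := by
  exact summable_of_qPoch hq (by rwa [norm_neg]) hq.le (fun n => (n + 1) ^ 2)
    (fun n => 2 * n + 1) (fun n => (-1) ^ n) (fun n => by simp)
    (fun n => (natTri_le_sq n).trans (by gcongr; omega)) (fun n => by omega)

end convergence

/-! ### The error function and its complement -/

theorem E_neg (x : ℝ) : E (-x) = -E x := by
  unfold E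
  have h := intervalIntegral.integral_comp_neg (fun u => Real.exp (-Real.pi * u ^ 2))
    (a := 0) (b := x)
  simp only [neg_sq, neg_zero] at h
  rw [h, intervalIntegral.integral_symm]
  ring

theorem E_zero : E 0 = 0 := by simp [E]

theorem hasDerivAt_E (x : ℝ) : HasDerivAt E (2 * Real.exp (-Real.pi * x ^ 2)) x := by
  unfold E
  exact (intervalIntegral.integral_hasDerivAt_right
    (Continuous.intervalIntegrable (by fun_prop) _ _)
    (Continuous.stronglyMeasurableAtFilter (by fun_prop) _ _)
    (Continuous.continuousAt (by fun_prop))).const_mul 2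

theorem integrableOn_gaussian : IntegrableOn (fun u => Real.exp (-Real.pi * u ^ 2)) (Set.Ioi 0) :=
  (integrable_exp_neg_mul_sq Real.pi_pos).integrableOn

theorem tendsto_E_atTop : Filter.Tendsto E Filter.atTop (nhds 1) := by
  have h := intervalIntegral_tendsto_integral_Ioi 0 integrableOn_gaussian Filter.tendsto_id
  rw [integral_gaussian_Ioi, div_self Real.pi_pos.ne', Real.sqrt_one] at h
  have := h.const_mul 2
  rw [mul_one_div_cancel (two_ne_zero' ℝ)] at this
  exact this

/-- The complementary error function `sgn(x) - E(x)`. -/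
def errc (x : ℝ) : ℝ := Real.sign x - E x

theorem errc_neg (x : ℝ) : errc (-x) = -errc x := by
  unfold errc; rw [Real.sign_neg, E_neg]; ring

/-- For x > 0, 1 - E(x) is the integral of 2 exp(-π(x+t)²) over t > 0, and (x+t)² ≥ x² + t². -/
theorem errc_bounds {x : ℝ} (hx : 0 < x) : 0 ≤ errc x ∧ errc x ≤ Real.exp (-Real.pi * x ^ 2) := by
  have h1 : ∫ t in Set.Ioi (0 : ℝ), 2 * Real.exp (-Real.pi * (x + t) ^ 2) = 1 - E (x + 0) := by
    refine integral_Ioi_of_hasDerivAt_of_nonneg' (g := fun t => E (x + t)) (fun t _ => ?_)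
      (fun t _ => by positivity) ?_
    · exact (hasDerivAt_E (x + t)).comp_const_add x t
    · exact tendsto_E_atTop.comp (Filter.tendsto_atTop_add_const_left _ _ Filter.tendsto_id)
  unfold errc
  rw [Real.sign_of_pos hx]
  rw [add_zero] at h1
  rw [← h1]
  refine ⟨integral_nonneg fun t => by positivity, ?_⟩
  have h2 : ∫ t in Set.Ioi (0 : ℝ), 2 * Real.exp (-Real.pi * x ^ 2) * Real.exp (-Real.pi * t ^ 2) =
      Real.exp (-Real.pi * x ^ 2) := by
    rw [integral_const_mul, integral_gaussian_Ioi, div_self Real.pi_pos.ne', Real.sqrt_one]; ring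
  rw [← h2]
  refine integral_mono_of_nonneg (Filter.Eventually.of_forall fun t => by positivity)
    (integrableOn_gaussian.const_mul _) ?_
  filter_upwards [ae_restrict_mem measurableSet_Ioi] with t ht
  rw [mul_assoc, ← Real.exp_add]
  have : 0 ≤ x * t := (mul_pos hx ht).le
  have := Real.pi_pos
  gcongr
  nlinarith

theorem abs_errc_le (x : ℝ) : |errc x| ≤ Real.exp (-Real.pi * x ^ 2) := by
  rcases lt_trichotomy x 0 with h | h | h
  · have := errc_bounds (neg_pos.mpr h)
    rw [errc_neg, neg_sq] at this
    rw [abs_of_nonpos (by linarith)]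
    exact this.2
  · subst h; simp [errc, E_zero]
  · have := errc_bounds h
    rw [abs_of_nonneg this.1]; exact this.2

theorem sign_mul_pos {c : ℝ} (hc : 0 < c) (x : ℝ) : Real.sign (c * x) = Real.sign x := by
  rcases lt_trichotomy x 0 with h | h | h
  · rw [Real.sign_of_neg h, Real.sign_of_neg (mul_neg_of_pos_of_neg hc h)]
  · subst h; simp
  · rw [Real.sign_of_pos h, Real.sign_of_pos (mul_pos hc h)]

/-! ### Powers of `q` -/

theorem norm_qpow (τ : ℂ) (r : ℝ) : ‖qpow τ r‖ = Real.exp (-(2 * Real.pi * r * τ.im)) := by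
  unfold qpow
  rw [norm_exp]
  congr 1
  simp

theorem qpow_add (τ : ℂ) (r s : ℝ) : qpow τ (r + s) = qpow τ r * qpow τ s := by
  unfold qpow; rw [← exp_add]; congr 1; push_cast; ring

theorem qpow_ne_zero (τ : ℂ) (r : ℝ) : qpow τ r ≠ 0 := exp_ne_zero _

theorem qpow_mul_left (c : ℝ) (τ : ℂ) (r : ℝ) : qpow (c * τ) r = qpow τ (c * r) := by
  unfold qpow; congr 1; push_cast; ring

theorem qpow_zpow (τ : ℂ) (r : ℝ) (n : ℤ) : qpow τ r ^ n = qpow τ (r * n) := by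
  unfold qpow; rw [← exp_int_mul]; congr 1; push_cast; ring

theorem norm_qpow_lt_one {τ : ℂ} (hτ : 0 < τ.im) {r : ℝ} (hr : 0 < r) : ‖qpow τ r‖ < 1 := by
  rw [norm_qpow, Real.exp_lt_one_iff]
  have := Real.pi_pos
  have : 0 < 2 * Real.pi * r * τ.im := by positivity
  linarith

/-- The exponential `e(x) = e^{2 π i x}` of a real number. -/
def ex1 (x : ℝ) : ℂ := exp (2 * Real.pi * I * x)

theorem ex1_add (x y : ℝ) : ex1 (x + y) = ex1 x * ex1 y := by
  unfold ex1; rw [← exp_add]; congr 1; push_cast; ring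

theorem ex1_zero : ex1 0 = 1 := by simp [ex1]

theorem ex1_int (n : ℤ) : ex1 n = 1 := by
  unfold ex1
  rw [← exp_int_mul_two_pi_mul_I n]; congr 1; push_cast; ring

theorem ex1_half : ex1 (1 / 2) = -1 := by
  unfold ex1
  rw [← exp_pi_mul_I]; congr 1; push_cast; ring

theorem ex1_int_half (n : ℤ) : ex1 (n / 2) = alt n := by
  unfold alt
  rw [← ex1_half]
  unfold ex1
  rw [← exp_int_mul]; congr 1; push_cast; ring

theorem norm_ex1 (x : ℝ) : ‖ex1 x‖ = 1 := by
  unfold ex1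
  rw [norm_exp]
  simp

theorem ex1_add_int (x : ℝ) (n : ℤ) : ex1 (x + n) = ex1 x := by
  rw [ex1_add, ex1_int, mul_one]

theorem qpow_add_one (τ : ℂ) (r : ℝ) : qpow (τ + 1) r = ex1 r * qpow τ r := by
  unfold qpow ex1; rw [← exp_add]; congr 1; ring

/-! ### Gaussian summability -/

theorem summable_gaussian {c : ℝ} (hc : 0 < c) (s : ℝ) :
    Summable fun n : ℤ => Real.exp (-c * ((n : ℝ) + s) ^ 2) := by
  refine Summable.of_nonneg_of_le (fun _ => (Real.exp_pos _).le) (fun n => ?_)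
    ((summable_pow_natAbs (Real.exp_pos (-c)).le (by rw [Real.exp_lt_one_iff]; linarith)).mul_left
      (Real.exp (c * (|s| + 1))))
  rw [← Real.exp_nat_mul, ← Real.exp_add]
  have h1 : ((n.natAbs : ℕ) : ℝ) = |(n : ℝ)| := by
    rw [Nat.cast_natAbs, Int.cast_abs]
  rw [h1]
  have h2 : |(n : ℝ)| ≤ |(n : ℝ) + s| + |s| := by
    calc |(n : ℝ)| = |(n + s) - s| := by ring_nf
      _ ≤ _ := abs_sub _ _
  have h3 : |(n : ℝ) + s| ≤ ((n : ℝ) + s) ^ 2 + 1 := by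
    rw [← sq_abs]; nlinarith [sq_nonneg (|(n : ℝ) + s| - 1), abs_nonneg ((n : ℝ) + s)]
  have h4 : c * |(n : ℝ)| ≤ c * (((n : ℝ) + s) ^ 2 + 1 + |s|) := by gcongr; linarith
  gcongr
  linarith

theorem summable_gaussian_prod {c : ℝ} (hc : 0 < c) (s t : ℝ) : Summable fun p : ℤ × ℤ =>
    Real.exp (-c * (((p.1 : ℝ) + s) ^ 2 + ((p.2 : ℝ) + t) ^ 2)) := by
  convert (summable_gaussian hc s).mul_of_nonneg (summable_gaussian hc t)
    (fun _ => (Real.exp_pos _).le) (fun _ => (Real.exp_pos _).le) using 2 with p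
  rw [← Real.exp_add]; congr 1; ring

/-- Half of the Gaussian absorbs the linear factor. -/
theorem abs_mul_gaussian_le {c : ℝ} (hc : 0 < c) (x : ℝ) :
    |x| * Real.exp (-c * x ^ 2) ≤ (1 + 2 / c) * Real.exp (-(c / 2) * x ^ 2) := by
  have h1 : |x| ≤ 1 + x ^ 2 := by
    rw [← sq_abs]; nlinarith [sq_nonneg (|x| - 1), abs_nonneg x]
  have h2 : c / 2 * x ^ 2 + 1 ≤ Real.exp (c / 2 * x ^ 2) := Real.add_one_le_exp _
  have h3 : |x| ≤ (1 + 2 / c) * Real.exp (c / 2 * x ^ 2) := by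
    have h5 : 1 + x ^ 2 ≤ (1 + 2 / c) * (c / 2 * x ^ 2 + 1) := by
      have : (1 + 2 / c) * (c / 2 * x ^ 2 + 1) = 1 + x ^ 2 + (c / 2 * x ^ 2 + 2 / c) := by
        field_simp; ring
      rw [this]
      have : 0 ≤ c / 2 * x ^ 2 + 2 / c := by positivity
      linarith
    calc |x| ≤ (1 + 2 / c) * (c / 2 * x ^ 2 + 1) := h1.trans h5
      _ ≤ _ := by gcongr
  calc _ ≤ (1 + 2 / c) * Real.exp (c / 2 * x ^ 2) * Real.exp (-c * x ^ 2) := by gcongr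
    _ = _ := by rw [mul_assoc, ← Real.exp_add]; congr 2; ring

theorem norm_qpow_sq (τ : ℂ) (c x : ℝ) :
    ‖qpow τ (c * x ^ 2)‖ = Real.exp (-(2 * Real.pi * c * τ.im) * x ^ 2) := by
  rw [norm_qpow]; congr 1; ring

theorem summable_qpow_sq {τ : ℂ} (hτ : 0 < τ.im) {c : ℝ} (hc : 0 < c) (s : ℝ) :
    Summable fun n : ℤ => ‖qpow τ (c * ((n : ℝ) + s) ^ 2)‖ := by
  simp only [norm_qpow_sq]
  have := Real.pi_pos
  exact summable_gaussian (by positivity) s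

theorem summable_theta2Term {τ : ℂ} (hτ : 0 < τ.im) : Summable (theta2Term τ) := by
  refine (summable_qpow_sq hτ (c := 1 / 2) (by norm_num) (1 / 2)).of_norm.congr fun n => ?_
  unfold theta2Term; congr 1; ring

theorem summable_theta3Term {τ : ℂ} (hτ : 0 < τ.im) : Summable (theta3Term τ) := by
  refine (summable_qpow_sq hτ (c := 1 / 2) (by norm_num) 0).of_norm.congr fun n => ?_
  unfold theta3Term; congr 1; ring

theorem summable_theta4Term {τ : ℂ} (hτ : 0 < τ.im) : Summable (theta4Term τ) := by
  refine Summable.of_norm ?_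
  convert summable_qpow_sq hτ (c := 1 / 2) (by norm_num) 0 using 2 with n
  unfold theta4Term
  rw [norm_mul, ← alt, norm_alt, one_mul]; congr 2; ring

theorem norm_gTerm (s t : ℝ) (τ : ℂ) (n : ℤ) :
    ‖gTerm s t τ n‖ = |(n : ℝ) + s| * Real.exp (-(Real.pi * τ.im) * ((n : ℝ) + s) ^ 2) := by
  unfold gTerm
  have h : exp (2 * Real.pi * I * ((n : ℝ) + s : ℝ) * t) = ex1 (((n : ℝ) + s) * t) := by
    unfold ex1; congr 1; push_cast; ring
  rw [h, norm_mul, norm_mul, norm_ex1, norm_real, norm_qpow, Real.norm_eq_abs, mul_one]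
  congr 2; ring

theorem summable_gTerm {τ : ℂ} (hτ : 0 < τ.im) (s t : ℝ) : Summable (gTerm s t τ) := by
  have hc : 0 < Real.pi * τ.im := mul_pos Real.pi_pos hτ
  refine Summable.of_norm_bounded
    ((summable_gaussian (half_pos hc) s).mul_left (1 + 2 / (Real.pi * τ.im))) fun n => ?_
  rw [norm_gTerm]
  exact abs_mul_gaussian_le hc _

/-! ### Indefinite theta series as sums over `ℤ × ℤ` -/

/-- The sign part of the summand of the indefinite theta series. -/
def signTerm (τ : ℂ) (x v : ℝ) : ℂ :=
  ((Real.sign x + Real.sign v : ℝ) : ℂ) * qpow τ (x ^ 2 + 3 * x * v + v ^ 2)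

/-- The nonholomorphic part of the summand of the indefinite theta series. -/
def errcTerm (τ : ℂ) (x v : ℝ) : ℂ :=
  (errc (√(5 * τ.im) * x) : ℂ) * qpow τ (x ^ 2 + 3 * x * v + v ^ 2)

/-- The summand of the indefinite theta series with quadratic form `x² + 3xv + v²`. -/
def dblTerm (τ : ℂ) (x v : ℝ) : ℂ :=
  ((E (√(5 * τ.im) * x) + E (√(5 * τ.im) * v) : ℝ) : ℂ) * qpow τ (x ^ 2 + 3 * x * v + v ^ 2)

theorem dblTerm_eq {τ : ℂ} (hτ : 0 < τ.im) (x v : ℝ) :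
    dblTerm τ x v = signTerm τ x v - (errcTerm τ x v + errcTerm τ v x) := by
  have hc : 0 < √(5 * τ.im) := Real.sqrt_pos.mpr (by positivity)
  unfold dblTerm signTerm errcTerm errc
  rw [sign_mul_pos hc, sign_mul_pos hc, show v ^ 2 + 3 * v * x + x ^ 2 = x ^ 2 + 3 * x * v + v ^ 2 by
    ring]
  push_cast; ring

theorem dblTerm_neg (τ : ℂ) (x v : ℝ) : dblTerm τ (-x) (-v) = -dblTerm τ x v := by
  unfold dblTerm
  rw [mul_neg, mul_neg, E_neg, E_neg,
    show (-x) ^ 2 + 3 * (-x) * (-v) + (-v) ^ 2 = x ^ 2 + 3 * x * v + v ^ 2 by ring]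
  push_cast; ring

section dbl
variable {τ : ℂ} (hτ : 0 < τ.im)
include hτ

/-- The signs cancel when xv < 0; when xv ≥ 0 the indefinite form is at least x² + v². -/
theorem norm_signTerm_le (x v : ℝ) :
    ‖signTerm τ x v‖ ≤ 2 * Real.exp (-(Real.pi * τ.im / 2) * (x ^ 2 + v ^ 2)) := by
  have hp := mul_pos Real.pi_pos hτ
  unfold signTerm
  rw [norm_mul, norm_real, norm_qpow, Real.norm_eq_abs]
  by_cases h : 0 ≤ x * v
  · have h1 : |Real.sign x + Real.sign v| ≤ 2 := by
      rw [abs_le]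
      rcases Real.sign_apply_eq x with a | a | a <;> rcases Real.sign_apply_eq v with b | b | b <;>
        rw [a, b] <;> norm_num
    gcongr
    nlinarith [mul_nonneg hp.le h, mul_nonneg hp.le (sq_nonneg x), mul_nonneg hp.le (sq_nonneg v)]
  · have h1 : Real.sign x + Real.sign v = 0 := by
      rcases lt_trichotomy x 0 with a | a | a
      · have b : 0 < v := by by_contra hb; exact h (mul_nonneg_of_nonpos_of_nonpos a.le (not_lt.mp hb))
        rw [Real.sign_of_neg a, Real.sign_of_pos b]; norm_num
      · subst a; simp at h
      · have b : v < 0 := by by_contra hb; exact h (mul_nonneg a.le (not_lt.mp hb))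
        rw [Real.sign_of_pos a, Real.sign_of_neg b]; norm_num
    rw [h1, abs_zero, zero_mul]; positivity

/-- The Gaussian decay of `errc` adds 5x² to 2(x²+3xv+v²), and the resulting form 7x²+6xv+2v² is
positive definite. -/
theorem norm_errcTerm_le (x v : ℝ) :
    ‖errcTerm τ x v‖ ≤ Real.exp (-(Real.pi * τ.im / 2) * (x ^ 2 + v ^ 2)) := by
  have hp := mul_pos Real.pi_pos hτ
  unfold errcTerm
  rw [norm_mul, norm_real, norm_qpow, Real.norm_eq_abs]
  calc _ ≤ Real.exp (-Real.pi * (√(5 * τ.im) * x) ^ 2) *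
        Real.exp (-(2 * Real.pi * (x ^ 2 + 3 * x * v + v ^ 2) * τ.im)) := by
        gcongr; exact abs_errc_le _
    _ ≤ _ := by
      rw [← Real.exp_add, mul_pow, Real.sq_sqrt (by positivity)]
      gcongr
      -- This is 7x²+6xv+2v² minus (x²+v²)/2; its discriminant is 36 - 39 < 0.
      have h1 : 0 ≤ 13 / 2 * x ^ 2 + 6 * x * v + 3 / 2 * v ^ 2 := by
        nlinarith [sq_nonneg (2 * x + v), sq_nonneg x, sq_nonneg (x + v), sq_nonneg (13 * x + 6 * v),
          sq_nonneg v]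
      nlinarith [mul_nonneg hp.le h1]

theorem summable_norm_signTerm (s t : ℝ) :
    Summable fun p : ℤ × ℤ => ‖signTerm τ (p.1 + s) (p.2 + t)‖ := by
  have hp := mul_pos Real.pi_pos hτ
  exact Summable.of_nonneg_of_le (fun _ => norm_nonneg _) (fun p => norm_signTerm_le hτ _ _)
    ((summable_gaussian_prod (half_pos hp) s t).mul_left 2)

theorem summable_norm_errcTerm (s t : ℝ) :
    Summable fun p : ℤ × ℤ => ‖errcTerm τ (p.1 + s) (p.2 + t)‖ := by
  have hp := mul_pos Real.pi_pos hτ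
  exact Summable.of_nonneg_of_le (fun _ => norm_nonneg _) (fun p => norm_errcTerm_le hτ _ _)
    (summable_gaussian_prod (half_pos hp) s t)

theorem summable_norm_dblTerm (s t : ℝ) :
    Summable fun p : ℤ × ℤ => ‖dblTerm τ (p.1 + s) (p.2 + t)‖ := by
  have h1 := summable_norm_signTerm hτ s t
  have h2 := summable_norm_errcTerm hτ s t
  have h3 : Summable fun p : ℤ × ℤ => ‖errcTerm τ (p.2 + t) (p.1 + s)‖ :=
    (Equiv.prodComm ℤ ℤ).summable_iff.mp (summable_norm_errcTerm hτ t s)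
  refine Summable.of_nonneg_of_le (fun _ => norm_nonneg _) (fun p => ?_) (h1.add (h2.add h3))
  rw [dblTerm_eq hτ]
  exact (norm_sub_le _ _).trans (add_le_add_right (norm_add_le _ _) _)

end dbl

theorem two_mul_im (τ : ℂ) : (2 * τ).im = 2 * τ.im := by simp

/-- The vectors c₁ and c₂ are dual to the coordinates: B(c₁,ν) = 10ν₀, B(c₂,ν) = -10ν₁ and -Q(c_i) =
10. The minus sign turns the difference of the E's into a sum, and Q is twice x²+3xv+v², whence 2τ.
-/
theorem varthetaTerm_eq (a b : Fin 2 → ℝ) (τ : ℂ) (n : Fin 2 → ℤ) :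
    varthetaTerm A c1 c2 a b τ n = dblTerm (2 * τ) (n 0 + a 0) (n 1 + a 1) *
      ex1 ((n 0 + a 0) * (4 * b 0 + 6 * b 1) + (n 1 + a 1) * (6 * b 0 + 4 * b 1)) := by
  have hs : √(5 * (2 * τ).im) = √10 * √τ.im := by
    rw [two_mul_im, ← mul_assoc, Real.sqrt_mul (by norm_num)]; norm_num
  have hten : √(10 : ℝ) ≠ 0 := by positivity
  have hsq : √(10 : ℝ) * √10 = 10 := Real.mul_self_sqrt (by norm_num)
  have q1 : -quad A c1 = 10 := by
    norm_num [quad, bilin, A, c1, Matrix.mulVec, dotProduct, Fin.sum_univ_two]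
  have q2 : -quad A c2 = 10 := by
    norm_num [quad, bilin, A, c2, Matrix.mulVec, dotProduct, Fin.sum_univ_two]
  have b1 (ν : Fin 2 → ℝ) : bilin A c1 ν = 10 * ν 0 := by
    simp only [bilin, A, c1, Matrix.mulVec, dotProduct, Fin.sum_univ_two, Matrix.map_apply,
      Matrix.of_apply, Matrix.cons_val', Matrix.cons_val_zero, Matrix.cons_val_one,
      Matrix.cons_val_fin_one]
    push_cast; ring
  have b2 (ν : Fin 2 → ℝ) : bilin A c2 ν = -(10 * ν 1) := by
    simp only [bilin, A, c2, Matrix.mulVec, dotProduct, Fin.sum_univ_two, Matrix.map_apply,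
      Matrix.of_apply, Matrix.cons_val', Matrix.cons_val_zero, Matrix.cons_val_one,
      Matrix.cons_val_fin_one]
    push_cast; ring
  have b3 (ν w : Fin 2 → ℝ) : bilin A ν w =
      ν 0 * (4 * w 0 + 6 * w 1) + ν 1 * (6 * w 0 + 4 * w 1) := by
    simp only [bilin, A, Matrix.mulVec, dotProduct, Fin.sum_univ_two, Matrix.map_apply,
      Matrix.of_apply, Matrix.cons_val', Matrix.cons_val_zero, Matrix.cons_val_one,
      Matrix.cons_val_fin_one]
    push_cast; ring
  have e1 (x : ℝ) : 10 * x / √10 * √τ.im = √10 * √τ.im * x := by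
    field_simp; rw [pow_two, hsq]; ring
  have e2 (x : ℝ) : -(10 * x) / √10 * √τ.im = -(√10 * √τ.im * x) := by
    rw [neg_div, neg_mul, e1]
  unfold varthetaTerm dblTerm
  simp only [b1, b2, q1, q2]
  unfold quad
  simp only [b3]
  rw [e1, e2, hs, E_neg, sub_neg_eq_add]
  have h2 : qpow τ ((((n 0 : ℝ) + a 0) * (4 * ((n 0 : ℝ) + a 0) + 6 * ((n 1 : ℝ) + a 1)) +
      ((n 1 : ℝ) + a 1) * (6 * ((n 0 : ℝ) + a 0) + 4 * ((n 1 : ℝ) + a 1))) / 2) =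
      qpow (2 * τ) (((n 0 : ℝ) + a 0) ^ 2 + 3 * ((n 0 : ℝ) + a 0) * ((n 1 : ℝ) + a 1) +
        ((n 1 : ℝ) + a 1) ^ 2) := by
    unfold qpow; congr 1; push_cast; ring
  rw [h2]; rfl

theorem summable_varthetaTerm {τ : ℂ} (hτ : 0 < τ.im) (a b : Fin 2 → ℝ) :
    Summable (varthetaTerm A c1 c2 a b τ) := by
  apply Summable.of_norm
  have h := summable_norm_dblTerm (τ := 2 * τ) (by simpa using hτ) (a 0) (a 1)
  convert (finTwoArrowEquiv ℤ).summable_iff.mpr h using 2 with n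
  rw [varthetaTerm_eq, norm_mul, norm_ex1, mul_one]; rfl

theorem vt_eq (a b : Fin 2 → ℝ) (τ : ℂ) :
    vt a b τ = ∑' p : ℤ × ℤ, dblTerm (2 * τ) (p.1 + a 0) (p.2 + a 1) *
      ex1 ((p.1 + a 0) * (4 * b 0 + 6 * b 1) + (p.2 + a 1) * (6 * b 0 + 4 * b 1)) := by
  unfold vt vartheta
  simp only [varthetaTerm_eq]
  rw [← (finTwoArrowEquiv ℤ).tsum_eq]
  rfl

/-! ### Unary nonholomorphic series and period integrals -/

def unaryTerm (s t c : ℝ) (τ : ℂ) (n : ℤ) : ℂ :=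
  (errc (√(2 * c * τ.im) * (n + s)) : ℂ) * qpow τ (-(c / 2) * ((n : ℝ) + s) ^ 2) * ex1 ((n + s) * t)

/-- The Eichler-type integral of a unary theta series, as a series. -/
def unary (s t c : ℝ) (τ : ℂ) : ℂ := ∑' n : ℤ, unaryTerm s t c τ n

/-- With y the imaginary part of τ and σ = n + s, the power of q grows like exp(πcyσ²), while `errc`
decays at least like exp(-2πcyσ²). -/
theorem norm_unaryTerm_le {c : ℝ} (hc : 0 < c) {τ : ℂ} (hτ : 0 < τ.im) (s t : ℝ) (n : ℤ) :
    ‖unaryTerm s t c τ n‖ ≤ Real.exp (-(Real.pi * c * τ.im) * ((n : ℝ) + s) ^ 2) := by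
  unfold unaryTerm
  rw [norm_mul, norm_mul, norm_ex1, mul_one, norm_qpow_sq, norm_real, Real.norm_eq_abs]
  calc _ ≤ Real.exp (-Real.pi * (√(2 * c * τ.im) * (n + s)) ^ 2) *
        Real.exp (-(2 * Real.pi * -(c / 2) * τ.im) * ((n : ℝ) + s) ^ 2) := by
        gcongr; exact abs_errc_le _
    _ = _ := by
      rw [← Real.exp_add, mul_pow, Real.sq_sqrt (by positivity)]
      congr 1; ring

theorem summable_unaryTerm {c : ℝ} (hc : 0 < c) {τ : ℂ} (hτ : 0 < τ.im) (s t : ℝ) :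
    Summable (unaryTerm s t c τ) := by
  have hp := Real.pi_pos
  exact Summable.of_norm_bounded (summable_gaussian (by positivity) s)
    (norm_unaryTerm_le hc hτ s t)

/-- The integrand is the derivative of E(σ√c √(2y+w))/√c. Positivity of σ makes the integrand
nonnegative, so integrability follows from the limit at infinity. -/
theorem integral_gaussian_div_sqrt {c y σ : ℝ} (hc : 0 < c) (hy : 0 < y) (hσ : 0 < σ) :
    IntegrableOn (fun w => σ * Real.exp (-(Real.pi * c * σ ^ 2) * (2 * y + w)) / √(2 * y + w))
      (Set.Ioi 0) ∧
    ∫ w in Set.Ioi (0 : ℝ), σ * Real.exp (-(Real.pi * c * σ ^ 2) * (2 * y + w)) / √(2 * y + w) =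
      (√c)⁻¹ * errc (√(2 * c * y) * σ) := by
  have hsc : 0 < √c := Real.sqrt_pos.mpr hc
  have hd : ∀ w ∈ Set.Ici (0 : ℝ), HasDerivAt (fun w => (√c)⁻¹ * E (σ * √c * √(2 * y + w)))
      (σ * Real.exp (-(Real.pi * c * σ ^ 2) * (2 * y + w)) / √(2 * y + w)) w := by
    intro w hw
    have hw' : 0 < 2 * y + w := by have : (0 : ℝ) ≤ w := hw; linarith
    have h1 : HasDerivAt (fun w => √(2 * y + w)) (1 / (2 * √(2 * y + w))) w :=
      ((hasDerivAt_id w).const_add (2 * y)).sqrt hw'.ne'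
    have h2 := ((hasDerivAt_E (σ * √c * √(2 * y + w))).comp w (h1.const_mul (σ * √c))).const_mul
      (√c)⁻¹
    refine h2.congr_deriv ?_
    have h3 : (σ * √c * √(2 * y + w)) ^ 2 = σ ^ 2 * c * (2 * y + w) := by
      rw [mul_pow, mul_pow, Real.sq_sqrt hc.le, Real.sq_sqrt hw'.le]
    have h4 : 0 < √(2 * y + w) := Real.sqrt_pos.mpr hw'
    rw [h3, show -(Real.pi * c * σ ^ 2) * (2 * y + w) = -Real.pi * (σ ^ 2 * c * (2 * y + w)) by ring]
    field_simp
  have hpos : ∀ w ∈ Set.Ioi (0 : ℝ),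
      0 ≤ σ * Real.exp (-(Real.pi * c * σ ^ 2) * (2 * y + w)) / √(2 * y + w) :=
    fun w _ => by positivity
  have hlim : Filter.Tendsto (fun w => (√c)⁻¹ * E (σ * √c * √(2 * y + w))) Filter.atTop
      (nhds ((√c)⁻¹ * 1)) := by
    refine (tendsto_E_atTop.comp ?_).const_mul _
    refine Filter.Tendsto.const_mul_atTop (by positivity) ?_
    exact Real.tendsto_sqrt_atTop.comp
      (Filter.tendsto_atTop_add_const_left _ _ Filter.tendsto_id)
  refine ⟨integrableOn_Ioi_deriv_of_nonneg' hd hpos hlim, ?_⟩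
  rw [integral_Ioi_of_hasDerivAt_of_nonneg' hd hpos hlim]
  have h5 : √(2 * c * y) = √c * √(2 * y) := by
    rw [← Real.sqrt_mul hc.le]; congr 1; ring
  have h6 : 0 < √(2 * c * y) * σ := by positivity
  unfold errc
  rw [Real.sign_of_pos h6, h5, add_zero]
  ring_nf

theorem integral_gaussian_div_sqrt' {c y σ : ℝ} (hc : 0 < c) (hy : 0 < y) (hσ : σ ≠ 0) :
    IntegrableOn (fun w => σ * Real.exp (-(Real.pi * c * σ ^ 2) * (2 * y + w)) / √(2 * y + w))
      (Set.Ioi 0) ∧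
    ∫ w in Set.Ioi (0 : ℝ), σ * Real.exp (-(Real.pi * c * σ ^ 2) * (2 * y + w)) / √(2 * y + w) =
      (√c)⁻¹ * errc (√(2 * c * y) * σ) := by
  rcases lt_or_gt_of_ne hσ with h | h
  · obtain ⟨h1, h2⟩ := integral_gaussian_div_sqrt hc hy (neg_pos.mpr h)
    simp only [neg_sq, neg_mul σ, neg_div] at h1 h2
    rw [integral_neg, mul_neg, errc_neg, mul_neg] at h2
    refine ⟨?_, neg_injective h2⟩
    have := h1.neg
    simpa using this
  · exact integral_gaussian_div_sqrt hc hy h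

/-- Absolute convergence of a series in L¹ gives integrability of its pointwise sum. -/
theorem integrable_tsum {α : Type*} [MeasurableSpace α] {μ : Measure α} {F : ℤ → α → ℂ}
    (hF : ∀ i, Integrable (F i) μ) (hsum : Summable fun i => ∫ a, ‖F i a‖ ∂μ)
    (hpt : ∀ᵐ a ∂μ, Summable fun i => F i a) : Integrable (fun a => ∑' i, F i a) μ := by
  refine ⟨?_, ?_⟩
  · refine aestronglyMeasurable_of_tendsto_ae Filter.atTop
      (f := fun (S : Finset ℤ) a => ∑ i ∈ S, F i a) (fun S => ?_) ?_
    · exact (integrable_finsetSum S fun i _ => hF i).1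
    · filter_upwards [hpt] with a ha using ha.hasSum
  · have h1 : ∑' i, ∫⁻ a, ‖F i a‖ₑ ∂μ ≠ ⊤ := by
      have (i : ℤ) : ∫⁻ a, ‖F i a‖ₑ ∂μ = ENNReal.ofReal (∫ a, ‖F i a‖ ∂μ) :=
        (ofReal_integral_norm_eq_lintegral_enorm (hF i)).symm
      simp only [this]
      exact hsum.tsum_ofReal_ne_top
    rw [← lintegral_tsum fun i => (hF i).1.enorm] at h1
    refine lt_of_le_of_lt (lintegral_mono_ae ?_) h1.lt_top
    filter_upwards [hpt] with a ha
    exact enorm_tsum_le_tsum_enorm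

/-- The point `-conj τ + i w` of the path of integration. -/
def pathPoint (τ : ℂ) (w : ℝ) : ℂ := -(starRingEnd ℂ) τ + I * w

theorem pathPoint_eq (τ : ℂ) (w : ℝ) : pathPoint τ w = -τ + I * (2 * τ.im + w : ℝ) := by
  unfold pathPoint
  apply Complex.ext <;> simp
  ring

theorem pathPoint_im (τ : ℂ) (w : ℝ) : (pathPoint τ w).im = τ.im + w := by
  unfold pathPoint; simp

theorem period_denominator {τ : ℂ} (hτ : 0 < τ.im) {w : ℝ} (hw : 0 < w) :
    (-I * (pathPoint τ w + τ)) ^ (1 / 2 : ℂ) = (√(2 * τ.im + w) : ℝ) := by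
  have h1 : -I * (pathPoint τ w + τ) = ((2 * τ.im + w : ℝ) : ℂ) := by
    rw [pathPoint_eq]
    have := I_mul_I
    linear_combination (-(2 * τ.im + w : ℝ) : ℂ) * this
  rw [h1, Real.sqrt_eq_rpow, ofReal_cpow (by linarith)]
  norm_num

/-- On the path z = -τ + i(2y+w), so the exponential splits into a factor q^{-cσ²/2} independent of
w and a real exponential in 2y + w. All the w-dependence is that of `integral_gaussian_div_sqrt'`.
-/
theorem gTerm_path (s t c : ℝ) (τ : ℂ) (w : ℝ) (n : ℤ) :
    gTerm s t (c * pathPoint τ w) n / (√(2 * τ.im + w) : ℝ) =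
      (qpow τ (-(c / 2) * ((n : ℝ) + s) ^ 2) * ex1 ((n + s) * t)) *
        ((((n : ℝ) + s) * Real.exp (-(Real.pi * c * ((n : ℝ) + s) ^ 2) * (2 * τ.im + w)) /
          √(2 * τ.im + w) : ℝ) : ℂ) := by
  have h1 : qpow (c * pathPoint τ w) (((n : ℝ) + s) ^ 2 / 2) =
      qpow τ (-(c / 2) * ((n : ℝ) + s) ^ 2) *
        (Real.exp (-(Real.pi * c * ((n : ℝ) + s) ^ 2) * (2 * τ.im + w)) : ℝ) := by
    rw [pathPoint_eq]
    unfold qpow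
    rw [ofReal_exp, ← exp_add]
    congr 1
    push_cast
    linear_combination (Real.pi * c * ((n : ℂ) + s) ^ 2 * (2 * τ.im + w)) * I_mul_I
  have h2 : exp (2 * Real.pi * I * ((n : ℝ) + s : ℝ) * t) = ex1 (((n : ℝ) + s) * t) := by
    unfold ex1; congr 1; push_cast; ring
  unfold gTerm
  rw [h1, h2]
  push_cast
  ring

section period
variable {s c : ℝ} (t : ℝ) {τ : ℂ} (hs : ∀ n : ℤ, (n : ℝ) + s ≠ 0) (hc : 0 < c) (hτ : 0 < τ.im)
include hs hc hτ

/-- The absolute integrals are again values of `errc`, now at |σ|, so the Gaussian bound on `errc`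
makes them summable. This justifies the termwise integration. -/
theorem period_g_aux :
    (∀ n : ℤ, IntegrableOn (fun w => gTerm s t (c * pathPoint τ w) n / (√(2 * τ.im + w) : ℝ))
      (Set.Ioi 0)) ∧
    (Summable fun n : ℤ => ∫ w in Set.Ioi (0 : ℝ),
      ‖gTerm s t (c * pathPoint τ w) n / (√(2 * τ.im + w) : ℝ)‖) := by
  constructor
  · intro n
    simp only [gTerm_path]
    exact ((integral_gaussian_div_sqrt' hc hτ (hs n)).1.ofReal (𝕜 := ℂ)).const_mul _
  · have hp := Real.pi_pos
    refine Summable.of_nonneg_of_le (fun _ => integral_nonneg fun _ => norm_nonneg _) (fun n => ?_)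
      ((summable_gaussian (c := Real.pi * c * τ.im) (by positivity) s).mul_left (√c)⁻¹)
    have h1 : ∀ w ∈ Set.Ioi (0 : ℝ), ‖gTerm s t (c * pathPoint τ w) n / (√(2 * τ.im + w) : ℝ)‖ =
        Real.exp (-(2 * Real.pi * -(c / 2) * τ.im) * ((n : ℝ) + s) ^ 2) *
          (|(n : ℝ) + s| * Real.exp (-(Real.pi * c * |(n : ℝ) + s| ^ 2) * (2 * τ.im + w)) /
            √(2 * τ.im + w)) := by
      intro w _
      rw [gTerm_path, norm_mul, norm_mul, norm_ex1, mul_one, norm_qpow_sq, norm_real,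
        Real.norm_eq_abs, abs_div, abs_mul, Real.abs_exp, abs_of_nonneg (Real.sqrt_nonneg _), sq_abs]
    rw [setIntegral_congr_fun measurableSet_Ioi h1, integral_const_mul,
      (integral_gaussian_div_sqrt hc hτ (abs_pos.mpr (hs n))).2, mul_left_comm]
    gcongr
    calc _ ≤ Real.exp (-(2 * Real.pi * -(c / 2) * τ.im) * ((n : ℝ) + s) ^ 2) *
          Real.exp (-Real.pi * (√(2 * c * τ.im) * |(n : ℝ) + s|) ^ 2) := by
          gcongr; exact (le_abs_self _).trans (abs_errc_le _)
      _ = _ := by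
        rw [← Real.exp_add, mul_pow, Real.sq_sqrt (by positivity), sq_abs]
        congr 1; ring

theorem integrableOn_period_g :
    IntegrableOn (fun w => g s t (c * pathPoint τ w) / (√(2 * τ.im + w) : ℝ)) (Set.Ioi 0) := by
  obtain ⟨h1, h2⟩ := period_g_aux t hs hc hτ
  unfold g
  simp only [← tsum_div_const]
  refine integrable_tsum h1 h2 ?_
  filter_upwards [ae_restrict_mem measurableSet_Ioi] with w hw
  refine (summable_gTerm ?_ s t).div_const _
  have hw' : (0 : ℝ) < w := hw
  rw [im_ofReal_mul, pathPoint_im]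
  positivity

theorem integral_period_g :
    ∫ w in Set.Ioi (0 : ℝ), g s t (c * pathPoint τ w) / (√(2 * τ.im + w) : ℝ) =
      ((√c)⁻¹ : ℝ) * unary s t c τ := by
  obtain ⟨h1, h2⟩ := period_g_aux t hs hc hτ
  unfold g
  simp only [← tsum_div_const]
  rw [← integral_tsum_of_summable_integral_norm h1 h2]
  unfold unary
  rw [← tsum_mul_left]
  congr 1; ext n
  simp only [gTerm_path]
  rw [integral_const_mul, integral_complex_ofReal, (integral_gaussian_div_sqrt' hc hτ (hs n)).2]
  unfold unaryTerm
  push_cast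
  ring

end period

/-! ### Classical theta functions -/

theorem alt_two_mul (k : ℤ) : alt (2 * k) = 1 := by rw [two_mul, alt_add, alt_mul_self]

theorem alt_sq (k : ℤ) : alt (k ^ 2) = alt k := by
  obtain ⟨m, rfl | rfl⟩ := Int.even_or_odd' k
  · rw [show (2 * m) ^ 2 = 2 * (2 * m ^ 2) by ring, alt_two_mul, alt_two_mul]
  · rw [show (2 * m + 1) ^ 2 = 2 * (2 * m ^ 2 + 2 * m) + 1 by ring, alt_add, alt_add,
      alt_two_mul, alt_two_mul]

theorem alt_three_mul (k : ℤ) : alt (3 * k) = alt k := by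
  rw [show 3 * k = 2 * k + k by ring, alt_add, alt_two_mul, one_mul]

theorem tsum_int_even_odd {f : ℤ → ℂ} (hf : Summable f) :
    ∑' n, f n = ∑' k, f (2 * k) + ∑' k, f (2 * k + 1) := by
  have hi : Function.Injective fun k : ℤ => 2 * k := mul_right_injective₀ two_ne_zero
  have hi' : Function.Injective fun k : ℤ => 2 * k + 1 := (add_left_injective 1).comp hi
  have he := (hf.comp_injective hi).hasSum
  have ho := (hf.comp_injective hi').hasSum
  refine ((hi.hasSum_range_iff.2 he).add_isCompl ?_ (hi'.hasSum_range_iff.2 ho)).tsum_eq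
  have : Set.range (fun k : ℤ => 2 * k) = {n | Even n} := by
    ext n; simp [even_iff_exists_two_mul]
  have h' : Set.range (fun k : ℤ => 2 * k + 1) = {n | Odd n} := by
    ext n; simp [Odd]
  rw [this, h']
  exact Int.isCompl_even_odd

/-- The theta series `∑ q^{(n+a)²}`. -/
def thetaShift (τ : ℂ) (a : ℝ) : ℂ := ∑' n : ℤ, qpow τ (((n : ℝ) + a) ^ 2)

/-- The theta series `∑ (-1)^n q^{(n+a)²}`. -/
def thetaAlt (τ : ℂ) (a : ℝ) : ℂ := ∑' n : ℤ, alt n * qpow τ (((n : ℝ) + a) ^ 2)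

theorem thetaShift_add_int (τ : ℂ) (a : ℝ) (m : ℤ) : thetaShift τ (a + m) = thetaShift τ a := by
  unfold thetaShift
  rw [← (Equiv.addRight m).tsum_eq fun n : ℤ => qpow τ (((n : ℝ) + a) ^ 2)]
  congr 1; ext n
  rw [Equiv.coe_addRight]; push_cast; congr 1; ring

theorem thetaShift_neg (τ : ℂ) (a : ℝ) : thetaShift τ (-a) = thetaShift τ a := by
  unfold thetaShift
  rw [← (Equiv.neg ℤ).tsum_eq fun n : ℤ => qpow τ (((n : ℝ) + a) ^ 2)]
  congr 1; ext n
  rw [Equiv.neg_apply]; push_cast; congr 1; ring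

theorem thetaAlt_add_int (τ : ℂ) (a : ℝ) (m : ℤ) :
    thetaAlt τ (a + m) = alt m * thetaAlt τ a := by
  unfold thetaAlt
  rw [← (Equiv.addRight m).tsum_eq fun n : ℤ => alt n * qpow τ (((n : ℝ) + a) ^ 2), ← tsum_mul_left]
  congr 1; ext n
  have : qpow τ (((n : ℝ) + (a + m)) ^ 2) = qpow τ ((((n + m : ℤ) : ℝ) + a) ^ 2) := by
    congr 1; push_cast; ring
  rw [Equiv.coe_addRight, this, alt_add]
  linear_combination (-alt n * qpow τ ((((n + m : ℤ) : ℝ) + a) ^ 2)) * alt_mul_self m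

theorem thetaAlt_neg (τ : ℂ) (a : ℝ) : thetaAlt τ (-a) = thetaAlt τ a := by
  unfold thetaAlt
  rw [← (Equiv.neg ℤ).tsum_eq fun n : ℤ => alt n * qpow τ (((n : ℝ) + a) ^ 2)]
  congr 1; ext n
  rw [Equiv.neg_apply, alt_neg]; push_cast; congr 2; ring

/-- Evenness and the sign change under a ↦ a + 1 conflict at a = 1/2. -/
theorem thetaAlt_half (τ : ℂ) : thetaAlt τ (1 / 2) = 0 := by
  have h1 := thetaAlt_add_int τ (-(1 / 2)) 1
  rw [thetaAlt_neg, show (-(1 / 2) + ((1 : ℤ) : ℝ) : ℝ) = 1 / 2 by norm_num] at h1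
  have : alt 1 = -1 := by simp [alt]
  rw [this] at h1
  linear_combination h1 / 2

theorem theta4_two_mul (τ : ℂ) : theta4 (2 * τ) = thetaAlt τ 0 := by
  unfold theta4 thetaAlt theta4Term alt qpow
  congr 1; ext n
  congr 2; push_cast; ring

theorem theta2_half {τ : ℂ} (hτ : 0 < τ.im) : theta2 (τ / 2) = 2 * thetaShift τ (1 / 4) := by
  unfold theta2
  rw [tsum_int_even_odd (summable_theta2Term (by rw [div_ofNat_im]; positivity))]
  have h1 : ∑' k : ℤ, theta2Term (τ / 2) (2 * k) = thetaShift τ (1 / 4) := by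
    unfold thetaShift theta2Term qpow
    congr 1; ext n; congr 1; push_cast; ring
  have h2 : ∑' k : ℤ, theta2Term (τ / 2) (2 * k + 1) = thetaShift τ (-(1 / 4) + (1 : ℤ)) := by
    unfold thetaShift theta2Term qpow
    congr 1; ext n; congr 1; push_cast; ring
  rw [h1, h2, thetaShift_add_int, thetaShift_neg]; ring

theorem thetaAlt_zero_eq (τ : ℂ) : thetaAlt τ 0 = ∑' r : ℤ, alt r * qpow τ 1 ^ (r ^ 2) := by
  unfold thetaAlt
  congr 1; ext r
  rw [qpow_zpow]; push_cast; congr 2; ring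

theorem thetaShift_quarter_eq (τ : ℂ) :
    ∑' r : ℤ, qpow τ (1 / 2) ^ (2 * r ^ 2 + r) = qpow τ (-1 / 16) * thetaShift τ (1 / 4) := by
  unfold thetaShift
  rw [← tsum_mul_left]
  congr 1; ext r
  rw [qpow_zpow, ← qpow_add]; push_cast; congr 1; ring

/-- The Bailey identity δ · theta = 1 exhibits an inverse. -/
theorem theta4_ne_zero {τ : ℂ} (hτ : 0 < τ.im) : theta4 τ ≠ 0 := by
  have h := deltaPhi_mul_theta (q := qpow (τ / 2) 1)
    (norm_qpow_lt_one (by rw [div_ofNat_im]; positivity) one_pos) (qpow_ne_zero _ _)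
  rw [← thetaAlt_zero_eq, ← theta4_two_mul, mul_div_cancel₀ _ (two_ne_zero' ℂ)] at h
  exact right_ne_zero_of_mul_eq_one h

theorem theta4_add_one (τ : ℂ) : theta4 (τ + 1) = theta3 τ := by
  unfold theta4 theta3 theta4Term theta3Term
  congr 1; ext n
  rw [qpow_add_one, ← alt, show ((n : ℝ) ^ 2 / 2) = ((n ^ 2 : ℤ) : ℝ) / 2 by push_cast; ring,
    ex1_int_half, alt_sq, ← mul_assoc, alt_mul_self, one_mul]

theorem theta3_ne_zero {τ : ℂ} (hτ : 0 < τ.im) : theta3 τ ≠ 0 := by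
  rw [← theta4_add_one]; exact theta4_ne_zero (by simpa using hτ)

/-- The identity `deltaX_mul_theta` exhibits the quarter-shifted theta series, half of θ₂, as
invertible. -/
theorem theta2_ne_zero {τ : ℂ} (hτ : 0 < τ.im) : theta2 τ ≠ 0 := by
  have h2 : 0 < (2 * τ).im := by simpa using hτ
  have h := deltaX_mul_theta (q := qpow (2 * τ) (1 / 2))
    (norm_qpow_lt_one h2 (by norm_num)) (qpow_ne_zero _ _)
  rw [thetaShift_quarter_eq] at h
  have h3 : thetaShift (2 * τ) (1 / 4) ≠ 0 :=
    right_ne_zero_of_mul (right_ne_zero_of_mul_eq_one h)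
  have h4 := theta2_half h2
  rw [mul_div_cancel_left₀ _ (two_ne_zero' ℂ)] at h4
  rw [h4]
  exact mul_ne_zero two_ne_zero h3

/-! ### Decomposition of the indefinite theta series -/

/-- The indefinite theta series over `(ℤ + s)²` twisted by a character of the coordinate sum. -/
def indefTheta (s : ℝ) (σ : ℤ → ℂ) (τ : ℂ) : ℂ :=
  ∑' p : ℤ × ℤ, σ (p.1 + p.2) * dblTerm τ (p.1 + s) (p.2 + s)

theorem summable_twist {σ : ℤ → ℂ} (hσ : ∀ r, ‖σ r‖ = 1) {f : ℤ × ℤ → ℂ}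
    (hf : Summable fun p => ‖f p‖) : Summable fun p : ℤ × ℤ => σ (p.1 + p.2) * f p := by
  apply Summable.of_norm
  simpa only [norm_mul, hσ, one_mul] using hf

theorem errcTerm_eq (τ : ℂ) (x v : ℝ) : errcTerm τ x v =
    (errc (√(5 * τ.im) * x) : ℂ) * qpow τ (-(5 / 4) * x ^ 2) * qpow τ ((v + 3 / 2 * x) ^ 2) := by
  unfold errcTerm
  rw [mul_assoc _ (qpow _ _) (qpow _ _), ← qpow_add]; congr 2; ring

/-- The two `errc` contributions agree after exchanging the coordinates, hence the factor 2.
Completing the square in v leaves an inner theta series whose shift depends on u. -/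
theorem indefTheta_eq {τ : ℂ} (hτ : 0 < τ.im) (s : ℝ) {σ : ℤ → ℂ} (hσ : ∀ r, ‖σ r‖ = 1)
    (hσ' : ∀ r u, σ (r + u) = σ r * σ u) :
    indefTheta s σ τ = ∑' p : ℤ × ℤ, σ (p.1 + p.2) * signTerm τ (p.1 + s) (p.2 + s) -
      2 * ∑' u : ℤ, (σ u * ((errc (√(5 * τ.im) * (u + s)) : ℂ) *
        qpow τ (-(5 / 4) * ((u : ℝ) + s) ^ 2))) *
        ∑' v : ℤ, σ v * qpow τ (((v : ℝ) + (3 / 2 * u + 5 / 2 * s)) ^ 2) := by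
  have h1 := summable_twist hσ (summable_norm_signTerm hτ s s)
  have h2 := summable_twist hσ (summable_norm_errcTerm hτ s s)
  have e3 (p : ℤ × ℤ) : σ (p.1 + p.2) * errcTerm τ (p.2 + s) (p.1 + s) =
      (fun p : ℤ × ℤ => σ (p.1 + p.2) * errcTerm τ (p.1 + s) (p.2 + s)) (Equiv.prodComm ℤ ℤ p) := by
    simp [add_comm p.1 p.2]
  have h3 : Summable fun p : ℤ × ℤ => σ (p.1 + p.2) * errcTerm τ (p.2 + s) (p.1 + s) := by
    simp only [e3]
    exact (Equiv.prodComm ℤ ℤ).summable_iff.mpr h2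
  unfold indefTheta
  simp only [dblTerm_eq hτ, mul_sub, mul_add]
  rw [h1.tsum_sub (h2.add h3), h2.tsum_add h3]
  congr 1
  have h4 : ∑' p : ℤ × ℤ, σ (p.1 + p.2) * errcTerm τ (p.2 + s) (p.1 + s) =
      ∑' p : ℤ × ℤ, σ (p.1 + p.2) * errcTerm τ (p.1 + s) (p.2 + s) := by
    simp only [e3]
    exact (Equiv.prodComm ℤ ℤ).tsum_eq fun p : ℤ × ℤ =>
      σ (p.1 + p.2) * errcTerm τ (p.1 + s) (p.2 + s)
  rw [h4, ← two_mul, h2.tsum_prod]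
  congr 2; ext u
  rw [← tsum_mul_left]
  congr 1; ext v
  rw [errcTerm_eq, hσ', show (v : ℝ) + s + 3 / 2 * (u + s) = v + (3 / 2 * u + 5 / 2 * s) by ring]
  ring_nf

/-- For 0 < s < 1 the sign of m + s is positive exactly when m ≥ 0, which matches the convention of
`sg`: closed first quadrant, open third quadrant. -/
theorem signTerm_eq {s : ℝ} (h0 : 0 < s) (h1 : s < 1) (τ : ℂ) (u v : ℤ) :
    signTerm τ (u + s) (v + s) = 2 * ((sg u v : ℂ) *
      qpow τ ((u : ℝ) ^ 2 + 3 * u * v + v ^ 2 + 5 * s * (u + v) + 5 * s ^ 2)) := by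
  have h (m : ℤ) : Real.sign (m + s) = if 0 ≤ m then 1 else -1 := by
    split_ifs with hm
    · have : (0 : ℝ) ≤ m := by exact_mod_cast hm
      exact Real.sign_of_pos (by linarith)
    · have : (m : ℝ) ≤ -1 := by exact_mod_cast (by omega : m ≤ -1)
      exact Real.sign_of_neg (by linarith)
  have h2 : Real.sign (u + s) + Real.sign (v + s) = 2 * (sg u v : ℝ) := by
    rw [h, h]; unfold sg
    split_ifs <;> first | (exfalso; omega) | norm_num
  unfold signTerm
  rw [h2, show ((u : ℝ) + s) ^ 2 + 3 * (u + s) * (v + s) + (v + s) ^ 2 =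
    u ^ 2 + 3 * u * v + v ^ 2 + 5 * s * (u + v) + 5 * s ^ 2 by ring]
  push_cast; ring

/-! ### The four base identities for X, χ, φ and ψ. -/

section base
variable {τ : ℂ} (hτ : 0 < τ.im)
include hτ

/-- At s = 1/10 the linear term is (u+v)/2 and the constant is 5s² = 1/20. The exponent -1/80 is
1/20 - 1/16, the 1/16 coming from the quarter shift of the theta series. -/
theorem tsum_signTerm_X : ∑' p : ℤ × ℤ, signTerm τ (p.1 + (1 / 10 : ℝ)) (p.2 + (1 / 10 : ℝ)) =
    theta2 (τ / 2) * (qpow τ (-1 / 80) * X (qpow τ (1 / 2))) := by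
  have h := X_mul_theta (norm_qpow_lt_one hτ (r := 1 / 2) (by norm_num)) (qpow_ne_zero _ _)
  rw [thetaShift_quarter_eq] at h
  have e (p : ℤ × ℤ) : signTerm τ (p.1 + (1 / 10 : ℝ)) (p.2 + (1 / 10 : ℝ)) =
      (2 * qpow τ (1 / 20)) * ((sg p.1 p.2 : ℂ) *
        qpow τ (1 / 2) ^ (2 * (p.1 + p.2) ^ 2 + (p.1 + p.2) + 2 * (p.1 * p.2))) := by
    rw [signTerm_eq (by norm_num) (by norm_num), qpow_zpow, mul_assoc 2 (qpow τ (1 / 20)),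
      mul_left_comm (qpow τ (1 / 20)), ← qpow_add]
    congr 3; push_cast; ring
  simp only [e, tsum_mul_left]
  rw [← h, theta2_half hτ, show (-1 / 80 : ℝ) = 1 / 20 + -1 / 16 by norm_num, qpow_add]
  ring

theorem tsum_signTerm_chi : ∑' p : ℤ × ℤ, signTerm τ (p.1 + (3 / 10 : ℝ)) (p.2 + (3 / 10 : ℝ)) =
    theta2 (τ / 2) * (qpow τ (-9 / 80) * chi (qpow τ (1 / 2))) := by
  have h := chi_mul_theta (norm_qpow_lt_one hτ (r := 1 / 2) (by norm_num)) (qpow_ne_zero _ _)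
  rw [thetaShift_quarter_eq] at h
  -- The constant 5s² = 9/20 is -1/20 + 1/2; the 1/2 is the summand 1 in the exponent of q^{1/2}.
  have e (p : ℤ × ℤ) : signTerm τ (p.1 + (3 / 10 : ℝ)) (p.2 + (3 / 10 : ℝ)) =
      (2 * qpow τ (-1 / 20)) * ((sg p.1 p.2 : ℂ) *
        qpow τ (1 / 2) ^ (2 * (p.1 + p.2) ^ 2 + 3 * (p.1 + p.2) + 1 + 2 * (p.1 * p.2))) := by
    rw [signTerm_eq (by norm_num) (by norm_num), qpow_zpow, mul_assoc 2 (qpow τ (-1 / 20)),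
      mul_left_comm (qpow τ (-1 / 20)), ← qpow_add]
    congr 3; push_cast; ring
  simp only [e, tsum_mul_left]
  rw [← h, theta2_half hτ, show (-9 / 80 : ℝ) = -1 / 20 + -1 / 16 by norm_num, qpow_add]
  ring

theorem tsum_signTerm_phi :
    ∑' p : ℤ × ℤ, alt (p.1 + p.2) * signTerm τ (p.1 + (1 / 5 : ℝ)) (p.2 + (1 / 5 : ℝ)) =
    2 * theta4 (2 * τ) * (qpow τ (1 / 5) * phi (qpow τ 1)) := by
  have h := phi_mul_theta (norm_qpow_lt_one hτ (r := 1) one_pos) (qpow_ne_zero _ _)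
  rw [← thetaAlt_zero_eq] at h
  have e (p : ℤ × ℤ) : alt (p.1 + p.2) * signTerm τ (p.1 + (1 / 5 : ℝ)) (p.2 + (1 / 5 : ℝ)) =
      (2 * qpow τ (1 / 5)) * ((sg p.1 p.2 : ℂ) * (alt (p.1 + p.2) *
        qpow τ 1 ^ ((p.1 + p.2) ^ 2 + (p.1 + p.2) + p.1 * p.2))) := by
    have : qpow τ ((p.1 : ℝ) ^ 2 + 3 * p.1 * p.2 + p.2 ^ 2 + 5 * (1 / 5) * (p.1 + p.2) +
        5 * (1 / 5) ^ 2) = qpow τ (1 / 5) *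
          qpow τ 1 ^ ((p.1 + p.2) ^ 2 + (p.1 + p.2) + p.1 * p.2) := by
      rw [qpow_zpow, ← qpow_add]; congr 1; push_cast; ring
    rw [signTerm_eq (by norm_num) (by norm_num), this]
    ring
  simp only [e, tsum_mul_left]
  rw [← h, theta4_two_mul]
  ring

theorem tsum_signTerm_psi :
    ∑' p : ℤ × ℤ, alt (p.1 + p.2) * signTerm τ (p.1 + (2 / 5 : ℝ)) (p.2 + (2 / 5 : ℝ)) =
    2 * theta4 (2 * τ) * (qpow τ (-1 / 5) * psi (qpow τ 1)) := by
  have h := psi_mul_theta (norm_qpow_lt_one hτ (r := 1) one_pos) (qpow_ne_zero _ _)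
  rw [← thetaAlt_zero_eq] at h
  have e (p : ℤ × ℤ) : alt (p.1 + p.2) * signTerm τ (p.1 + (2 / 5 : ℝ)) (p.2 + (2 / 5 : ℝ)) =
      (2 * qpow τ (-1 / 5)) * ((sg p.1 p.2 : ℂ) * (alt (p.1 + p.2) *
        qpow τ 1 ^ ((p.1 + p.2 + 1) ^ 2 + p.1 * p.2))) := by
    -- The constant 4/5 is 1 - 1/5, and the 1 completes the square (u+v+1)².
    have : qpow τ ((p.1 : ℝ) ^ 2 + 3 * p.1 * p.2 + p.2 ^ 2 + 5 * (2 / 5) * (p.1 + p.2) +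
        5 * (2 / 5) ^ 2) = qpow τ (-1 / 5) *
          qpow τ 1 ^ ((p.1 + p.2 + 1) ^ 2 + p.1 * p.2) := by
      rw [qpow_zpow, ← qpow_add]; congr 1; push_cast; ring
    rw [signTerm_eq (by norm_num) (by norm_num), this]
    ring
  simp only [e, tsum_mul_left]
  rw [← h, theta4_two_mul]
  ring

omit hτ in
theorem unaryTerm_five_halves (s : ℝ) (u : ℤ) : unaryTerm s 0 (5 / 2) τ u =
    (errc (√(5 * τ.im) * (u + s)) : ℂ) * qpow τ (-(5 / 4) * ((u : ℝ) + s) ^ 2) := by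
  unfold unaryTerm
  rw [mul_zero, ex1_zero, mul_one]; norm_num

/-- `X` in terms of an indefinite theta series. -/
theorem indefTheta_X : indefTheta (1 / 10) (fun _ => 1) τ =
    theta2 (τ / 2) * (qpow τ (-1 / 80) * X (qpow τ (1 / 2)) - unary (1 / 10) 0 (5 / 2) τ) := by
  rw [indefTheta_eq hτ _ (fun _ => norm_one) (fun _ _ => (one_mul 1).symm)]
  simp only [one_mul]
  rw [tsum_signTerm_X hτ]
  -- The shift 3u/2 + 1/4 is 1/4 modulo 1 for u even and -1/4 for u odd, and the theta series is
  -- even in its shift. So it does not depend on u.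
  have h (u : ℤ) : ∑' v : ℤ, qpow τ (((v : ℝ) + (3 / 2 * u + 5 / 2 * (1 / 10))) ^ 2) =
      thetaShift τ (1 / 4) := by
    change thetaShift τ _ = _
    obtain ⟨k, rfl | rfl⟩ := Int.even_or_odd' u
    · refine Eq.trans ?_ (thetaShift_add_int τ (1 / 4) (3 * k)); push_cast; congr 1; ring
    · refine Eq.trans ?_ ((thetaShift_add_int τ (-(1 / 4)) (3 * k + 2)).trans (thetaShift_neg τ _))
      push_cast; congr 1; ring
  simp only [h, ← unaryTerm_five_halves, tsum_mul_right]
  rw [theta2_half hτ]; unfold unary; ring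

/-- `χ` in terms of an indefinite theta series. -/
theorem indefTheta_chi : indefTheta (3 / 10) (fun _ => 1) τ =
    theta2 (τ / 2) * (qpow τ (-9 / 80) * chi (qpow τ (1 / 2)) - unary (3 / 10) 0 (5 / 2) τ) := by
  rw [indefTheta_eq hτ _ (fun _ => norm_one) (fun _ _ => (one_mul 1).symm)]
  simp only [one_mul]
  rw [tsum_signTerm_chi hτ]
  -- Here the shift 3u/2 + 3/4 is -1/4 modulo 1 for u even and 1/4 for u odd.
  have h (u : ℤ) : ∑' v : ℤ, qpow τ (((v : ℝ) + (3 / 2 * u + 5 / 2 * (3 / 10))) ^ 2) =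
      thetaShift τ (1 / 4) := by
    change thetaShift τ _ = _
    obtain ⟨k, rfl | rfl⟩ := Int.even_or_odd' u
    · refine Eq.trans ?_ ((thetaShift_add_int τ (-(1 / 4)) (3 * k + 1)).trans (thetaShift_neg τ _))
      push_cast; congr 1; ring
    · refine Eq.trans ?_ (thetaShift_add_int τ (1 / 4) (3 * k + 2)); push_cast; congr 1; ring
  simp only [h, ← unaryTerm_five_halves, tsum_mul_right]
  rw [theta2_half hτ]; unfold unary; ring

omit hτ in
theorem sqrt_twenty (k s : ℝ) : √(5 * τ.im) * (2 * k + 2 * s) = √(2 * 10 * τ.im) * (k + s) := by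
  rw [show 2 * 10 * τ.im = 2 ^ 2 * (5 * τ.im) by ring, Real.sqrt_mul (by positivity : (0 : ℝ) ≤ 2 ^ 2) (5 * τ.im),
    Real.sqrt_sq (by norm_num)]
  ring

omit hτ in
-- Rescaling by 2 turns 5/2 into 10, and the sign (-1)^k becomes the character t = 1/2 at the price
-- of the phase e(-s/2).
theorem errc_unaryTerm_ten (s : ℝ) (k : ℤ) : alt k * ((errc (√(5 * τ.im) * (2 * k + 2 * s)) : ℂ) *
    qpow τ (-(5 / 4) * (2 * (k : ℝ) + 2 * s) ^ 2)) =
      ex1 (-(s / 2)) * unaryTerm s (1 / 2) 10 τ k := by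
  unfold unaryTerm
  have h1 : ex1 (((k : ℝ) + s) * (1 / 2)) = alt k * ex1 (s / 2) := by
    rw [← ex1_int_half, ← ex1_add]; congr 1; ring
  have h2 : ex1 (-(s / 2)) * ex1 (s / 2) = 1 := by rw [← ex1_add, neg_add_cancel, ex1_zero]
  rw [sqrt_twenty (τ := τ), h1, show -(5 / 4) * (2 * (k : ℝ) + 2 * s) ^ 2 = -(10 / 2) * (k + s) ^ 2 by ring]
  linear_combination (-alt k * (errc (√(2 * 10 * τ.im) * (k + s)) : ℂ) *
    qpow τ (-(10 / 2) * ((k : ℝ) + s) ^ 2)) * h2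

/-- `φ` in terms of an indefinite theta series. -/
theorem indefTheta_phi : indefTheta (1 / 5) alt τ = 2 * theta4 (2 * τ) *
    (qpow τ (1 / 5) * phi (qpow τ 1) + ex1 (-(3 / 10)) * unary (3 / 5) (1 / 2) 10 τ) := by
  rw [indefTheta_eq hτ _ norm_alt alt_add, tsum_signTerm_phi hτ]
  set f : ℤ → ℂ := fun u => (alt u * ((errc (√(5 * τ.im) * (u + 1 / 5)) : ℂ) *
        qpow τ (-(5 / 4) * ((u : ℝ) + 1 / 5) ^ 2))) *
        ∑' v : ℤ, alt v * qpow τ (((v : ℝ) + (3 / 2 * u + 5 / 2 * (1 / 5))) ^ 2) with hf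
  -- For even u the shift 3u/2 + 1/2 is a half-integer and the alternating theta series vanishes.
  -- For odd u it is an integer, and u + 1/5 = 2(k + 3/5).
  have h0 (k : ℤ) : f (2 * k) = 0 := by
    have : ∑' v : ℤ, alt v * qpow τ (((v : ℝ) + (3 / 2 * (2 * k : ℤ) + 5 / 2 * (1 / 5))) ^ 2) =
        thetaAlt τ (1 / 2 + (3 * k : ℤ)) := by
      unfold thetaAlt; congr 1; ext v; push_cast; congr 2; ring
    simp only [hf]
    rw [this, thetaAlt_add_int, thetaAlt_half]; ring
  have h1 (k : ℤ) : f (2 * k + 1) =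
      -(thetaAlt τ 0 * (ex1 (-(3 / 10)) * unaryTerm (3 / 5) (1 / 2) 10 τ k)) := by
    have : ∑' v : ℤ, alt v * qpow τ (((v : ℝ) + (3 / 2 * (2 * k + 1 : ℤ) + 5 / 2 * (1 / 5))) ^ 2) =
        thetaAlt τ (0 + (2 * 1 + 3 * k : ℤ)) := by
      unfold thetaAlt; congr 1; ext v; push_cast; congr 2; ring
    have h2 := errc_unaryTerm_ten (τ := τ) (3 / 5) k
    rw [show (3 / 5 / 2 : ℝ) = 3 / 10 by norm_num] at h2
    have e1 : ((2 * k + 1 : ℤ) : ℝ) + 1 / 5 = 2 * k + 2 * (3 / 5) := by push_cast; ring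
    simp only [hf]
    rw [this, thetaAlt_add_int, alt_add (2 * 1), alt_two_mul 1, alt_three_mul, alt_add_one, alt_two_mul k, ← h2,
      e1]
    ring
  have hz : ∀ u, u ∉ Set.range (fun k : ℤ => 2 * k + 1) → f u = 0 := by
    intro u hu
    obtain ⟨k, rfl | rfl⟩ := Int.even_or_odd' u
    · exact h0 k
    · exact absurd ⟨k, rfl⟩ hu
  have hi : Function.Injective fun k : ℤ => 2 * k + 1 :=
    (add_left_injective 1).comp (mul_right_injective₀ two_ne_zero)
  have h3 : ∑' u, f u = ∑' k, f (2 * k + 1) :=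
    (hi.tsum_eq (Function.support_subset_iff'.mpr hz)).symm
  rw [h3]
  simp only [h1]
  rw [tsum_neg, tsum_mul_left, tsum_mul_left, theta4_two_mul]
  unfold unary; ring

/-- `ψ` in terms of an indefinite theta series. -/
theorem indefTheta_psi : indefTheta (2 / 5) alt τ = 2 * theta4 (2 * τ) *
    (qpow τ (-1 / 5) * psi (qpow τ 1) + ex1 (-(1 / 10)) * unary (1 / 5) (1 / 2) 10 τ) := by
  rw [indefTheta_eq hτ _ norm_alt alt_add, tsum_signTerm_psi hτ]
  set f : ℤ → ℂ := fun u => (alt u * ((errc (√(5 * τ.im) * (u + 2 / 5)) : ℂ) *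
        qpow τ (-(5 / 4) * ((u : ℝ) + 2 / 5) ^ 2))) *
        ∑' v : ℤ, alt v * qpow τ (((v : ℝ) + (3 / 2 * u + 5 / 2 * (2 / 5))) ^ 2) with hf
  -- Parities are exchanged compared with φ: the shift is 3u/2 + 1, so odd u drop out and u + 2/5 =
  -- 2(k + 1/5) for even u.
  have h0 (k : ℤ) : f (2 * k + 1) = 0 := by
    have : ∑' v : ℤ, alt v * qpow τ (((v : ℝ) + (3 / 2 * (2 * k + 1 : ℤ) + 5 / 2 * (2 / 5))) ^ 2) =
        thetaAlt τ (1 / 2 + (3 * k + 2 : ℤ)) := by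
      unfold thetaAlt; congr 1; ext v; push_cast; congr 2; ring
    simp only [hf]
    rw [this, thetaAlt_add_int, thetaAlt_half]; ring
  have h1 (k : ℤ) : f (2 * k) =
      -(thetaAlt τ 0 * (ex1 (-(1 / 10)) * unaryTerm (1 / 5) (1 / 2) 10 τ k)) := by
    have : ∑' v : ℤ, alt v * qpow τ (((v : ℝ) + (3 / 2 * (2 * k : ℤ) + 5 / 2 * (2 / 5))) ^ 2) =
        thetaAlt τ (0 + (3 * k + 1 : ℤ)) := by
      unfold thetaAlt; congr 1; ext v; push_cast; congr 2; ring
    have h2 := errc_unaryTerm_ten (τ := τ) (1 / 5) k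
    rw [show (1 / 5 / 2 : ℝ) = 1 / 10 by norm_num] at h2
    have e1 : ((2 * k : ℤ) : ℝ) + 2 / 5 = 2 * k + 2 * (1 / 5) := by push_cast; ring
    simp only [hf]
    rw [this, thetaAlt_add_int, alt_add_one, alt_three_mul, alt_two_mul, ← h2, e1]
    ring
  have hz : ∀ u, u ∉ Set.range (fun k : ℤ => 2 * k) → f u = 0 := by
    intro u hu
    obtain ⟨k, rfl | rfl⟩ := Int.even_or_odd' u
    · exact absurd ⟨k, rfl⟩ hu
    · exact h0 k
  have hi : Function.Injective fun k : ℤ => 2 * k := mul_right_injective₀ two_ne_zero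
  have h3 : ∑' u, f u = ∑' k, f (2 * k) :=
    (hi.tsum_eq (Function.support_subset_iff'.mpr hz)).symm
  rw [h3]
  simp only [h1]
  rw [tsum_neg, tsum_mul_left, tsum_mul_left, theta4_two_mul]
  unfold unary; ring

end base

/-! ### Transformations of the unary series -/

theorem ex1_congr {x y : ℝ} (n : ℤ) (h : x = y + n) : ex1 x = ex1 y := by
  rw [h, ex1_add_int]

theorem ex1_congr_neg {x y : ℝ} (n : ℤ) (h : x = y + 1 / 2 + n) : ex1 x = -ex1 y := by
  rw [h, ex1_add_int, ex1_add, ex1_half]; ring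

theorem ex1_mul_neg (x : ℝ) : ex1 x * ex1 (-x) = 1 := by
  rw [← ex1_add, add_neg_cancel, ex1_zero]

theorem zeta_zpow (n : ℕ) (k : ℤ) : zeta n ^ k = ex1 (k / n) := by
  unfold zeta ex1
  rw [← exp_int_mul]; congr 1; push_cast; ring

theorem unary_add_int (s t c : ℝ) (τ : ℂ) (m : ℤ) : unary (s + m) t c τ = unary s t c τ := by
  unfold unary
  rw [← (Equiv.addRight m).tsum_eq (unaryTerm s t c τ)]
  congr 1; ext n
  unfold unaryTerm
  have : (n : ℝ) + (s + m) = ((n + m : ℤ) : ℝ) + s := by push_cast; ring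
  rw [Equiv.coe_addRight, this]

theorem unary_neg (s t c : ℝ) (τ : ℂ) : unary (-s) (-t) c τ = -unary s t c τ := by
  unfold unary
  rw [← (Equiv.neg ℤ).tsum_eq (unaryTerm s t c τ), ← tsum_neg]
  congr 1; ext n
  unfold unaryTerm
  have : ((-n : ℤ) : ℝ) + s = -(n + -s) := by push_cast; ring
  rw [Equiv.neg_apply, this, mul_neg (√_), errc_neg, neg_sq, neg_mul_comm _ t]
  push_cast; ring

theorem unary_char_add_one (s t c : ℝ) (τ : ℂ) :
    unary s (t + 1) c τ = ex1 s * unary s t c τ := by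
  unfold unary
  rw [← tsum_mul_left]
  congr 1; ext n
  unfold unaryTerm
  have : ex1 (((n : ℝ) + s) * (t + 1)) = ex1 s * ex1 ((n + s) * t) := by
    rw [← ex1_add]
    exact ex1_congr n (by ring)
  rw [this]; ring

theorem unary_real_mul (s t c m : ℝ) (τ : ℂ) : unary s t c (m * τ) = unary s t (m * c) τ := by
  unfold unary unaryTerm
  congr 1; ext n
  rw [qpow_mul_left, im_ofReal_mul, show 2 * c * (m * τ.im) = 2 * (m * c) * τ.im by ring]
  congr 3; ring

/-- Splitting n by parity writes n + s as 2(k + s/2) or 2(k + (s+1)/2), so the quadratic coefficient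
is multiplied by 4. -/
theorem unary_split {c : ℝ} (hc : 0 < c) {τ : ℂ} (hτ : 0 < τ.im) (s t : ℝ) : unary s t c τ =
    unary (s / 2) (2 * t) (4 * c) τ + unary ((s + 1) / 2) (2 * t) (4 * c) τ := by
  have h1 (k r : ℝ) : √(2 * c * τ.im) * (2 * k + r) = √(2 * (4 * c) * τ.im) * (k + r / 2) := by
    rw [show 2 * (4 * c) * τ.im = 2 ^ 2 * (2 * c * τ.im) by ring,
      Real.sqrt_mul (by positivity : (0 : ℝ) ≤ 2 ^ 2) (2 * c * τ.im),
      Real.sqrt_sq (by norm_num)]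
    ring
  unfold unary
  rw [tsum_int_even_odd (summable_unaryTerm hc hτ s t)]
  congr 2
  · ext k
    unfold unaryTerm
    rw [← h1, show -(4 * c / 2) * ((k : ℝ) + s / 2) ^ 2 = -(c / 2) * (2 * k + s) ^ 2 by ring,
      show ((k : ℝ) + s / 2) * (2 * t) = (2 * k + s) * t by ring]
    push_cast; rfl
  · ext k
    unfold unaryTerm
    rw [← h1, show -(4 * c / 2) * ((k : ℝ) + (s + 1) / 2) ^ 2 = -(c / 2) * (2 * k + (s + 1)) ^ 2 by
        ring,
      show ((k : ℝ) + (s + 1) / 2) * (2 * t) = (2 * k + (s + 1)) * t by ring,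
      show (2 * (k : ℝ) + (s + 1)) = ((2 * k + 1 : ℤ) : ℝ) + s by push_cast; ring]

/-- With 20s integral, 10(n+s)² is constant modulo 1. -/
theorem unary_twenty_add_one {s : ℝ} (m : ℤ) (hm : 20 * s = m) (τ : ℂ) :
    unary s 0 20 (τ + 1) = ex1 (-(10 * s ^ 2)) * unary s 0 20 τ := by
  unfold unary
  rw [← tsum_mul_left]
  congr 1; ext n
  unfold unaryTerm
  have h1 : ex1 (-(20 / 2) * ((n : ℝ) + s) ^ 2) = ex1 (-(10 * s ^ 2)) :=
    ex1_congr (-(10 * n ^ 2 + n * m)) (by push_cast; rw [← hm]; ring)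
  rw [qpow_add_one, h1, add_im, one_im, add_zero]
  ring

/-- With 20s odd, 5(n+s)² varies by n/2 modulo 1, which creates the character t = 1/2. -/
theorem unary_ten_add_one {s : ℝ} (m : ℤ) (hm : 20 * s = 2 * m + 1) (τ : ℂ) :
    unary s 0 10 (τ + 1) = ex1 (-(5 * s ^ 2) - s / 2) * unary s (1 / 2) 10 τ := by
  unfold unary
  rw [← tsum_mul_left]
  congr 1; ext n
  unfold unaryTerm
  have h1 : ex1 (-(10 / 2) * ((n : ℝ) + s) ^ 2) =
      ex1 (-(5 * s ^ 2) - s / 2) * ex1 (((n : ℝ) + s) * (1 / 2)) := by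
    rw [← ex1_add]
    refine ex1_congr (-(5 * n ^ 2 + n * (m + 1))) ?_
    push_cast
    linear_combination (-(n : ℝ) / 2) * hm
  rw [qpow_add_one, h1, add_im, one_im, add_zero, mul_zero, ex1_zero]
  ring

/-! ### Evaluation of the period integrals -/

theorem not_int_of_twenty {s : ℝ} (k : ℤ) (hs : 20 * s = k) (hk : ¬(20 : ℤ) ∣ k) (n : ℤ) :
    (n : ℝ) + s ≠ 0 := by
  intro h
  apply hk
  have : (k : ℝ) = 20 * (-n : ℤ) := by push_cast; linarith
  exact ⟨-n, by exact_mod_cast this⟩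

section period
variable {f : ℂ → Fin 6 → ℂ} {j : Fin 6} {c s₁ s₂ : ℝ} {t : ℝ} {a b : ℂ}
  (hf : ∀ z, f z j = (√c : ℝ) * (a * g s₁ t (c * z) + b * g s₂ t (c * z)))
  (h₁ : ∀ n : ℤ, (n : ℝ) + s₁ ≠ 0) (h₂ : ∀ n : ℤ, (n : ℝ) + s₂ ≠ 0) (hc : 0 < c)
  {τ : ℂ} (hτ : 0 < τ.im)
include hf h₁ h₂ hc hτ

omit h₁ h₂ hc in
theorem periodIntegrand_eq {w : ℝ} (hw : 0 < w) : periodIntegrand f τ j w =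
    I * ((√c : ℝ) * (a * (g s₁ t (c * pathPoint τ w) / (√(2 * τ.im + w) : ℝ)) +
      b * (g s₂ t (c * pathPoint τ w) / (√(2 * τ.im + w) : ℝ)))) := by
  change f (pathPoint τ w) j / (-I * (pathPoint τ w + τ)) ^ (1 / 2 : ℂ) * I = _
  rw [period_denominator hτ hw, hf]
  ring

theorem integrableOn_periodIntegrand : IntegrableOn (periodIntegrand f τ j) (Set.Ioi 0) := by
  have i1 := (integrableOn_period_g t h₁ hc hτ).const_mul a
  have i2 := (integrableOn_period_g t h₂ hc hτ).const_mul b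
  refine IntegrableOn.congr_fun (((i1.add i2).const_mul ((√c : ℝ) : ℂ)).const_mul I)
    (fun w hw => ?_) measurableSet_Ioi
  exact (periodIntegrand_eq hf hτ hw).symm

/-- The prefactor -i and dz = i du multiply to 1, and the √c in front of g cancels the (√c)⁻¹ of the
termwise integral. -/
theorem periodIntegral_eq :
    periodIntegral f τ j = a * unary s₁ t c τ + b * unary s₂ t c τ := by
  have i1 := (integrableOn_period_g t h₁ hc hτ).const_mul a
  have i2 := (integrableOn_period_g t h₂ hc hτ).const_mul b
  have hsc : (((√c)⁻¹ : ℝ) : ℂ) * ((√c : ℝ) : ℂ) = 1 := by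
    rw [← ofReal_mul, inv_mul_cancel₀ (Real.sqrt_pos.mpr hc).ne', ofReal_one]
  unfold periodIntegral
  rw [setIntegral_congr_fun measurableSet_Ioi
    (fun w hw => periodIntegrand_eq hf hτ hw), integral_const_mul, integral_const_mul,
    integral_add i1 i2, integral_const_mul, integral_const_mul, integral_period_g t h₁ hc hτ,
    integral_period_g t h₂ hc hτ]
  linear_combination (-(((√c)⁻¹ : ℝ) : ℂ) * ((√c : ℝ) : ℂ) *
    (a * unary s₁ t c τ + b * unary s₂ t c τ)) * I_mul_I +
    (a * unary s₁ t c τ + b * unary s₂ t c τ) * hsc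

end period

/-! ### Shifted indefinite theta series -/

/-- The indefinite theta series without twist over `(ℤ + a) × (ℤ + b)`. -/
def shiftTheta (a b : ℝ) (τ : ℂ) : ℂ := ∑' p : ℤ × ℤ, dblTerm (2 * τ) (p.1 + a) (p.2 + b)

theorem vt_zero (a : Fin 2 → ℝ) (τ : ℂ) : vt a 0 τ = shiftTheta (a 0) (a 1) τ := by
  rw [vt_eq]; simp [ex1_zero, shiftTheta]

theorem vt_smul_e (s : ℝ) (τ : ℂ) : vt (s • e) 0 τ = shiftTheta s s τ := by
  rw [vt_zero]; simp [e]

theorem vt_smul_e_add (s : ℝ) (τ : ℂ) :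
    vt (s • e + (1 / 2 : ℝ) • ex) 0 τ = shiftTheta (s + 1 / 2) s τ := by
  rw [vt_zero]; simp [e, ex]

theorem shiftTheta_self (s : ℝ) (τ : ℂ) :
    shiftTheta s s τ = indefTheta s (fun _ => 1) (2 * τ) := by
  simp [shiftTheta, indefTheta]

/-- For b = e/20 both coefficients 4b₀+6b₁ and 6b₀+4b₁ equal 1/2, so the character is e(s) times
(-1)^{u+v}. -/
theorem vt_twist (s : ℝ) (τ : ℂ) :
    vt (s • e) ((1 / 20 : ℝ) • e) (τ / 2) = ex1 s * indefTheta s alt τ := by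
  rw [vt_eq]
  unfold indefTheta
  rw [← tsum_mul_left, mul_div_cancel₀ _ (two_ne_zero' ℂ)]
  congr 1; ext p
  simp only [Pi.smul_apply, smul_eq_mul, e, Matrix.cons_val_zero, Matrix.cons_val_one,
    Matrix.cons_val_fin_one, mul_one]
  have : ex1 (((p.1 : ℝ) + s) * (4 * (1 / 20) + 6 * (1 / 20)) +
      ((p.2 : ℝ) + s) * (6 * (1 / 20) + 4 * (1 / 20))) = ex1 s * alt (p.1 + p.2) := by
    rw [← ex1_int_half, ← ex1_add]; congr 1; push_cast; ring
  rw [this]; ring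

theorem shiftTheta_add_int (a b : ℝ) (τ : ℂ) (m k : ℤ) :
    shiftTheta (a + m) (b + k) τ = shiftTheta a b τ := by
  unfold shiftTheta
  rw [← ((Equiv.addRight m).prodCongr (Equiv.addRight k)).tsum_eq
    fun p : ℤ × ℤ => dblTerm (2 * τ) (p.1 + a) (p.2 + b)]
  congr 1; ext p
  simp only [Equiv.prodCongr_apply, Prod.map_fst, Prod.map_snd, Equiv.coe_addRight]
  push_cast
  congr 1 <;> ring

theorem shiftTheta_neg (a b : ℝ) (τ : ℂ) : shiftTheta (-a) (-b) τ = -shiftTheta a b τ := by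
  unfold shiftTheta
  rw [← ((Equiv.neg ℤ).prodCongr (Equiv.neg ℤ)).tsum_eq
    fun p : ℤ × ℤ => dblTerm (2 * τ) (p.1 + a) (p.2 + b), ← tsum_neg]
  congr 1; ext p
  rw [← dblTerm_neg]
  simp only [Equiv.prodCongr_apply, Prod.map_fst, Prod.map_snd, Equiv.neg_apply]
  push_cast
  congr 1 <;> ring

theorem dblTerm_add_one {x v r : ℝ} (n : ℤ) (h : x ^ 2 + 3 * x * v + v ^ 2 = r + n) (τ : ℂ) :
    dblTerm (τ + 1) x v = ex1 r * dblTerm τ x v := by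
  unfold dblTerm
  rw [qpow_add_one, add_im, one_im, add_zero, ex1_congr n h]
  ring

theorem shiftTheta_add_one {a b : ℝ} (m k : ℤ) (hm : 4 * a + 6 * b = m) (hk : 6 * a + 4 * b = k)
    (τ : ℂ) : shiftTheta a b (τ + 1) = ex1 (2 * a ^ 2 + 6 * a * b + 2 * b ^ 2) *
      shiftTheta a b τ := by
  unfold shiftTheta
  rw [← tsum_mul_left]
  congr 1; ext p
  unfold dblTerm
  have h : ex1 (2 * (((p.1 : ℝ) + a) ^ 2 + 3 * (p.1 + a) * (p.2 + b) + (p.2 + b) ^ 2)) =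
      ex1 (2 * a ^ 2 + 6 * a * b + 2 * b ^ 2) := by
    refine ex1_congr (2 * p.1 ^ 2 + 6 * p.1 * p.2 + 2 * p.2 ^ 2 + p.1 * m + p.2 * k) ?_
    push_cast
    rw [← hm, ← hk]; ring
  rw [show 2 * (τ + 1) = 2 * τ + 1 + 1 by ring, qpow_add_one, qpow_add_one, ← mul_assoc (ex1 _),
    ← ex1_add, ← two_mul, h]
  simp only [add_im, one_im, add_zero]
  ring

/-- With 10s odd, the cross term 5s(u+v) is (u+v)/2 modulo 1: translation creates the alternating
twist. -/
theorem indefTheta_add_one {s : ℝ} (m : ℤ) (hm : 10 * s = 2 * m + 1) (τ : ℂ) :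
    indefTheta s (fun _ => 1) (τ + 1) = ex1 (5 * s ^ 2) * indefTheta s alt τ := by
  unfold indefTheta
  rw [← tsum_mul_left]
  congr 1; ext p
  rw [dblTerm_add_one (r := 5 * s ^ 2 + (p.1 + p.2 : ℤ) / 2)
    (p.1 ^ 2 + 3 * p.1 * p.2 + p.2 ^ 2 + (p.1 + p.2) * m) (by
      push_cast; linear_combination (((p.1 : ℝ) + p.2) / 2) * hm),
    ex1_add, ex1_int_half]
  ring

theorem tsum_prod_even_odd {f : ℤ × ℤ → ℂ} (hf : Summable f) : ∑' p, f p =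
    ∑' p : ℤ × ℤ, f (2 * p.1, 2 * p.2) + ∑' p : ℤ × ℤ, f (2 * p.1 + 1, 2 * p.2) +
      ∑' p : ℤ × ℤ, f (2 * p.1, 2 * p.2 + 1) + ∑' p : ℤ × ℤ, f (2 * p.1 + 1, 2 * p.2 + 1) := by
  have hi : Function.Injective fun k : ℤ => 2 * k := mul_right_injective₀ two_ne_zero
  have hi' : Function.Injective fun k : ℤ => 2 * k + 1 := (add_left_injective 1).comp hi
  have h00 : Summable fun p : ℤ × ℤ => f (2 * p.1, 2 * p.2) := hf.comp_injective (hi.prodMap hi)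
  have h10 : Summable fun p : ℤ × ℤ => f (2 * p.1 + 1, 2 * p.2) :=
    hf.comp_injective (hi'.prodMap hi)
  have h01 : Summable fun p : ℤ × ℤ => f (2 * p.1, 2 * p.2 + 1) :=
    hf.comp_injective (hi.prodMap hi')
  have h11 : Summable fun p : ℤ × ℤ => f (2 * p.1 + 1, 2 * p.2 + 1) :=
    hf.comp_injective (hi'.prodMap hi')
  rw [hf.tsum_prod, tsum_int_even_odd hf.prod, h00.tsum_prod, h10.tsum_prod, h01.tsum_prod,
    h11.tsum_prod]
  have e (u : ℤ) : ∑' v, f (u, v) = ∑' v, f (u, 2 * v) + ∑' v, f (u, 2 * v + 1) :=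
    tsum_int_even_odd (hf.prod_factor u)
  simp only [e]
  rw [h00.prod.tsum_add h01.prod, h10.prod.tsum_add h11.prod]
  ring

theorem dblTerm_two_mul (τ : ℂ) (x v : ℝ) :
    dblTerm (τ / 2) (2 * x) (2 * v) = dblTerm (2 * τ) x v := by
  have h1 (x : ℝ) : √(5 * (τ / 2).im) * (2 * x) = √(5 * (2 * τ).im) * x := by
    rw [show 5 * (2 * τ).im = 2 ^ 2 * (5 * (τ / 2).im) by rw [two_mul_im, div_ofNat_im]; ring,
      Real.sqrt_mul (by positivity : (0 : ℝ) ≤ 2 ^ 2) (5 * (τ / 2).im),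
      Real.sqrt_sq (by norm_num)]
    ring
  have h2 : qpow (τ / 2) ((2 * x) ^ 2 + 3 * (2 * x) * (2 * v) + (2 * v) ^ 2) =
      qpow (2 * τ) (x ^ 2 + 3 * x * v + v ^ 2) := by
    unfold qpow; congr 1; push_cast; ring
  unfold dblTerm
  rw [h1, h1, h2]

/-- The twist depends only on parities, so the four parity classes of the lattice give four
untwisted series, signed by the parity of the coordinate sum. -/
theorem indefTheta_half {τ : ℂ} (hτ : 0 < τ.im) (s : ℝ) : indefTheta (2 * s) alt (τ / 2) =
    shiftTheta s s τ - shiftTheta (s + 1 / 2) s τ - shiftTheta s (s + 1 / 2) τ +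
      shiftTheta (s + 1 / 2) (s + 1 / 2) τ := by
  have hτ' : 0 < (τ / 2).im := by rw [div_ofNat_im]; positivity
  unfold indefTheta
  rw [tsum_prod_even_odd (summable_twist norm_alt (summable_norm_dblTerm hτ' _ _))]
  unfold shiftTheta
  simp only [← dblTerm_two_mul τ]
  have a0 (k : ℤ) : ((2 * k : ℤ) : ℝ) + 2 * s = 2 * (k + s) := by push_cast; ring
  have a1 (k : ℤ) : ((2 * k + 1 : ℤ) : ℝ) + 2 * s = 2 * (k + (s + 1 / 2)) := by push_cast; ring
  have b0 (k l : ℤ) : alt (2 * k + 2 * l) = 1 := by rw [← mul_add, alt_two_mul]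
  have b1 (k l : ℤ) : alt (2 * k + 1 + 2 * l) = -1 := by
    rw [add_right_comm, alt_add_one, b0]
  have b2 (k l : ℤ) : alt (2 * k + (2 * l + 1)) = -1 := by
    rw [← add_assoc, alt_add_one, b0]
  have b3 (k l : ℤ) : alt (2 * k + 1 + (2 * l + 1)) = 1 := by
    rw [← add_assoc, alt_add_one, b1, neg_neg]
  simp only [a0, a1, b0, b1, b2, b3, one_mul, neg_mul, tsum_neg]
  ring

/-! ### The period integrals `G⁽¹⁾`, `G⁽²⁾` -/

theorem g1_rows (j : Fin 6) : ∃ (s₁ s₂ : ℝ) (a b : ℂ),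
    (∀ n : ℤ, (n : ℝ) + s₁ ≠ 0) ∧ (∀ n : ℤ, (n : ℝ) + s₂ ≠ 0) ∧
    (∀ z, g1 z j = (√20 : ℝ) * (a * g s₁ 0 ((20 : ℝ) * z) + b * g s₂ 0 ((20 : ℝ) * z))) ∧
    (∀ τ, a * unary s₁ 0 20 τ + b * unary s₂ 0 20 τ =
      (![-unary (4 / 20) 0 20 τ - unary (6 / 20) 0 20 τ,
        -unary (2 / 20) 0 20 τ - unary (8 / 20) 0 20 τ,
        unary (4 / 20) 0 20 τ - unary (6 / 20) 0 20 τ,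
        -unary (2 / 20) 0 20 τ + unary (8 / 20) 0 20 τ,
        unary (1 / 20) 0 20 τ - unary (9 / 20) 0 20 τ,
        unary (3 / 20) 0 20 τ - unary (7 / 20) 0 20 τ] : Fin 6 → ℂ) j) := by
  have h (k : ℤ) (hk : ¬(20 : ℤ) ∣ k) : ∀ n : ℤ, (n : ℝ) + k / 20 ≠ 0 :=
    not_int_of_twenty k (by ring) hk
  have h1 := h 1 (by norm_num)
  have h2 := h 2 (by norm_num)
  have h3 := h 3 (by norm_num)
  have h4 := h 4 (by norm_num)
  have h6 := h 6 (by norm_num)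
  have h7 := h 7 (by norm_num)
  have h8 := h 8 (by norm_num)
  have h9 := h 9 (by norm_num)
  push_cast at h1 h2 h3 h4 h6 h7 h8 h9
  fin_cases j
  · refine ⟨4 / 20, 6 / 20, -1, -1, h4, h6, fun z => ?_, fun τ => ?_⟩
    · change (√20 : ℝ) * (-g (4 / 20) 0 (20 * z) - g (6 / 20) 0 (20 * z)) = _
      push_cast; ring
    · change _ = -unary (4 / 20) 0 20 τ - unary (6 / 20) 0 20 τ
      ring
  · refine ⟨2 / 20, 8 / 20, -1, -1, h2, h8, fun z => ?_, fun τ => ?_⟩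
    · change (√20 : ℝ) * (-g (2 / 20) 0 (20 * z) - g (8 / 20) 0 (20 * z)) = _
      push_cast; ring
    · change _ = -unary (2 / 20) 0 20 τ - unary (8 / 20) 0 20 τ
      ring
  · refine ⟨4 / 20, 6 / 20, 1, -1, h4, h6, fun z => ?_, fun τ => ?_⟩
    · change (√20 : ℝ) * (g (4 / 20) 0 (20 * z) - g (6 / 20) 0 (20 * z)) = _
      push_cast; ring
    · change _ = unary (4 / 20) 0 20 τ - unary (6 / 20) 0 20 τ
      ring
  · refine ⟨2 / 20, 8 / 20, -1, 1, h2, h8, fun z => ?_, fun τ => ?_⟩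
    · change (√20 : ℝ) * (-g (2 / 20) 0 (20 * z) + g (8 / 20) 0 (20 * z)) = _
      push_cast; ring
    · change _ = -unary (2 / 20) 0 20 τ + unary (8 / 20) 0 20 τ
      ring
  · refine ⟨1 / 20, 9 / 20, 1, -1, h1, h9, fun z => ?_, fun τ => ?_⟩
    · change (√20 : ℝ) * (g (1 / 20) 0 (20 * z) - g (9 / 20) 0 (20 * z)) = _
      push_cast; ring
    · change _ = unary (1 / 20) 0 20 τ - unary (9 / 20) 0 20 τ
      ring
  · refine ⟨3 / 20, 7 / 20, 1, -1, h3, h7, fun z => ?_, fun τ => ?_⟩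
    · change (√20 : ℝ) * (g (3 / 20) 0 (20 * z) - g (7 / 20) 0 (20 * z)) = _
      push_cast; ring
    · change _ = unary (3 / 20) 0 20 τ - unary (7 / 20) 0 20 τ
      ring

/-- Every row is put in one two-term shape so that a single evaluation applies. The first two rows
have one term; there the second coefficient is 0. -/
theorem g2_rows (j : Fin 6) : ∃ (s₁ s₂ t : ℝ) (a b : ℂ),
    (∀ n : ℤ, (n : ℝ) + s₁ ≠ 0) ∧ (∀ n : ℤ, (n : ℝ) + s₂ ≠ 0) ∧
    (∀ z, g2 z j = (√10 : ℝ) * (a * g s₁ t ((10 : ℝ) * z) + b * g s₂ t ((10 : ℝ) * z))) ∧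
    (∀ τ, a * unary s₁ t 10 τ + b * unary s₂ t 10 τ =
      (![-(√2 : ℝ) * zeta 5 ^ (-1 : ℤ) * unary (8 / 20) (1 / 2) 10 τ,
        (√2 : ℝ) * zeta 5 ^ (2 : ℤ) * unary (4 / 20) (1 / 2) 10 τ,
        unary (1 / 20) 0 10 τ - unary (9 / 20) 0 10 τ,
        unary (3 / 20) 0 10 τ - unary (7 / 20) 0 10 τ,
        zeta 40 ^ (-1 : ℤ) * unary (1 / 20) (1 / 2) 10 τ
          - zeta 40 ^ (-9 : ℤ) * unary (9 / 20) (1 / 2) 10 τ,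
        zeta 40 ^ (-3 : ℤ) * unary (3 / 20) (1 / 2) 10 τ
          + zeta 40 ^ (-7 : ℤ) * unary (7 / 20) (1 / 2) 10 τ] : Fin 6 → ℂ) j) := by
  have h (k : ℤ) (hk : ¬(20 : ℤ) ∣ k) : ∀ n : ℤ, (n : ℝ) + k / 20 ≠ 0 :=
    not_int_of_twenty k (by ring) hk
  have h1 := h 1 (by norm_num)
  have h3 := h 3 (by norm_num)
  have h4 := h 4 (by norm_num)
  have h7 := h 7 (by norm_num)
  have h8 := h 8 (by norm_num)
  have h9 := h 9 (by norm_num)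
  push_cast at h1 h3 h4 h7 h8 h9
  fin_cases j
  · refine ⟨8 / 20, 8 / 20, 1 / 2, -(√2 : ℝ) * zeta 5 ^ (-1 : ℤ), 0, h8, h8, fun z => ?_,
      fun τ => ?_⟩
    · change (√10 : ℝ) * (-(√2 : ℝ) * zeta 5 ^ (-1 : ℤ) * g (8 / 20) (1 / 2) (10 * z)) = _
      push_cast; ring
    · change _ = -(√2 : ℝ) * zeta 5 ^ (-1 : ℤ) * unary (8 / 20) (1 / 2) 10 τ
      ring
  · refine ⟨4 / 20, 4 / 20, 1 / 2, (√2 : ℝ) * zeta 5 ^ (2 : ℤ), 0, h4, h4, fun z => ?_,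
      fun τ => ?_⟩
    · change (√10 : ℝ) * ((√2 : ℝ) * zeta 5 ^ (2 : ℤ) * g (4 / 20) (1 / 2) (10 * z)) = _
      push_cast; ring
    · change _ = (√2 : ℝ) * zeta 5 ^ (2 : ℤ) * unary (4 / 20) (1 / 2) 10 τ
      ring
  · refine ⟨1 / 20, 9 / 20, 0, 1, -1, h1, h9, fun z => ?_, fun τ => ?_⟩
    · change (√10 : ℝ) * (g (1 / 20) 0 (10 * z) - g (9 / 20) 0 (10 * z)) = _
      push_cast; ring
    · change _ = unary (1 / 20) 0 10 τ - unary (9 / 20) 0 10 τ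
      ring
  · refine ⟨3 / 20, 7 / 20, 0, 1, -1, h3, h7, fun z => ?_, fun τ => ?_⟩
    · change (√10 : ℝ) * (g (3 / 20) 0 (10 * z) - g (7 / 20) 0 (10 * z)) = _
      push_cast; ring
    · change _ = unary (3 / 20) 0 10 τ - unary (7 / 20) 0 10 τ
      ring
  · refine ⟨1 / 20, 9 / 20, 1 / 2, zeta 40 ^ (-1 : ℤ), -zeta 40 ^ (-9 : ℤ), h1, h9, fun z => ?_,
      fun τ => ?_⟩
    · change (√10 : ℝ) * (zeta 40 ^ (-1 : ℤ) * g (1 / 20) (1 / 2) (10 * z) -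
        zeta 40 ^ (-9 : ℤ) * g (9 / 20) (1 / 2) (10 * z)) = _
      push_cast; ring
    · change _ = zeta 40 ^ (-1 : ℤ) * unary (1 / 20) (1 / 2) 10 τ -
        zeta 40 ^ (-9 : ℤ) * unary (9 / 20) (1 / 2) 10 τ
      ring
  · refine ⟨3 / 20, 7 / 20, 1 / 2, zeta 40 ^ (-3 : ℤ), zeta 40 ^ (-7 : ℤ), h3, h7, fun z => ?_,
      fun τ => ?_⟩
    · change (√10 : ℝ) * (zeta 40 ^ (-3 : ℤ) * g (3 / 20) (1 / 2) (10 * z) +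
        zeta 40 ^ (-7 : ℤ) * g (7 / 20) (1 / 2) (10 * z)) = _
      push_cast; ring
    · change _ = zeta 40 ^ (-3 : ℤ) * unary (3 / 20) (1 / 2) 10 τ +
        zeta 40 ^ (-7 : ℤ) * unary (7 / 20) (1 / 2) 10 τ
      ring

section rows
variable {τ : ℂ} (hτ : 0 < τ.im)
include hτ

theorem integrableOn_period_g1 (j : Fin 6) : IntegrableOn (periodIntegrand g1 τ j) (Set.Ioi 0) := by
  obtain ⟨s₁, s₂, a, b, h₁, h₂, hf, -⟩ := g1_rows j
  exact integrableOn_periodIntegrand hf h₁ h₂ (by norm_num) hτ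

theorem integrableOn_period_g2 (j : Fin 6) : IntegrableOn (periodIntegrand g2 τ j) (Set.Ioi 0) := by
  obtain ⟨s₁, s₂, t, a, b, h₁, h₂, hf, -⟩ := g2_rows j
  exact integrableOn_periodIntegrand hf h₁ h₂ (by norm_num) hτ

theorem G1_eq : G1 τ =
    ![-unary (4 / 20) 0 20 τ - unary (6 / 20) 0 20 τ,
      -unary (2 / 20) 0 20 τ - unary (8 / 20) 0 20 τ,
      unary (4 / 20) 0 20 τ - unary (6 / 20) 0 20 τ,
      -unary (2 / 20) 0 20 τ + unary (8 / 20) 0 20 τ,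
      unary (1 / 20) 0 20 τ - unary (9 / 20) 0 20 τ,
      unary (3 / 20) 0 20 τ - unary (7 / 20) 0 20 τ] := by
  ext j
  obtain ⟨s₁, s₂, a, b, h₁, h₂, hf, hu⟩ := g1_rows j
  rw [← hu]
  exact periodIntegral_eq hf h₁ h₂ (by norm_num) hτ

theorem G2_eq : G2 τ =
    ![-(√2 : ℝ) * zeta 5 ^ (-1 : ℤ) * unary (8 / 20) (1 / 2) 10 τ,
      (√2 : ℝ) * zeta 5 ^ (2 : ℤ) * unary (4 / 20) (1 / 2) 10 τ,
      unary (1 / 20) 0 10 τ - unary (9 / 20) 0 10 τ,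
      unary (3 / 20) 0 10 τ - unary (7 / 20) 0 10 τ,
      zeta 40 ^ (-1 : ℤ) * unary (1 / 20) (1 / 2) 10 τ
        - zeta 40 ^ (-9 : ℤ) * unary (9 / 20) (1 / 2) 10 τ,
      zeta 40 ^ (-3 : ℤ) * unary (3 / 20) (1 / 2) 10 τ
        + zeta 40 ^ (-7 : ℤ) * unary (7 / 20) (1 / 2) 10 τ] := by
  ext j
  obtain ⟨s₁, s₂, t, a, b, h₁, h₂, hf, hu⟩ := g2_rows j
  rw [← hu]
  exact periodIntegral_eq hf h₁ h₂ (by norm_num) hτ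

/-! ### The rows of the first decomposition -/

omit hτ in
theorem unary_one_sub (s c : ℝ) (τ : ℂ) : unary (1 - s) 0 c τ = -unary s 0 c τ := by
  have := unary_neg s 0 c τ
  rw [neg_zero] at this
  rw [← this, ← unary_add_int (-s) 0 c τ 1]
  push_cast; congr 1; ring

/-- Splitting by parity gives characters t = 1, which are the phases e(s/2) and e((s+1)/2) =
-e(s/2). -/
theorem unary_ten_half (s : ℝ) : unary s (1 / 2) 10 (τ / 2) =
    ex1 (s / 2) * (unary (s / 2) 0 20 τ - unary ((s + 1) / 2) 0 20 τ) := by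
  have h1 : τ / 2 = ((1 / 2 : ℝ) : ℂ) * τ := by push_cast; ring
  have h2 (s : ℝ) : unary s 1 20 τ = ex1 s * unary s 0 20 τ := by
    rw [← unary_char_add_one, zero_add]
  rw [h1, unary_real_mul, unary_split (by norm_num) hτ]
  norm_num
  rw [h2, h2, ex1_congr_neg (x := (s + 1) / 2) (y := s / 2) 0 (by push_cast; ring)]
  ring

/-- This is the base identity for φ at τ/2, with its twisted series split by parity. -/
theorem F1_row_phi : qpow τ (1 / 10) * phi (qpow τ (1 / 2)) = 1 / theta4 τ * (1 / 2) *
    (shiftTheta (1 / 10) (1 / 10) τ - shiftTheta (1 / 10 + 1 / 2) (1 / 10) τ -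
      shiftTheta (4 / 10) (4 / 10) τ + shiftTheta (4 / 10 + 1 / 2) (4 / 10) τ) +
    (-unary (4 / 20) 0 20 τ - unary (6 / 20) 0 20 τ) := by
  have hτ' : 0 < (τ / 2).im := by rw [div_ofNat_im]; positivity
  have h1 := indefTheta_half hτ (1 / 10)
  rw [show (2 * (1 / 10) : ℝ) = 1 / 5 by norm_num, indefTheta_phi hτ',
    mul_div_cancel₀ _ (two_ne_zero' ℂ), unary_ten_half hτ] at h1
  -- Modulo 1, 4/10 is -(6/10), and the series is odd; this matches the classes of the parity
  -- splitting with the shifts in H⁽¹⁾.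
  have h2 : shiftTheta (4 / 10) (4 / 10) τ = -shiftTheta (1 / 10 + 1 / 2) (1 / 10 + 1 / 2) τ := by
    rw [← shiftTheta_neg]
    refine Eq.trans ?_ (shiftTheta_add_int _ _ τ 1 1)
    congr 1 <;> norm_num
  have h3 : shiftTheta (4 / 10 + 1 / 2) (4 / 10) τ = -shiftTheta (1 / 10) (1 / 10 + 1 / 2) τ := by
    rw [← shiftTheta_neg]
    refine Eq.trans ?_ (shiftTheta_add_int _ _ τ 1 1)
    congr 1 <;> norm_num
  have h4 : unary ((3 / 5 + 1) / 2) 0 20 τ = -unary (4 / 20) 0 20 τ := by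
    rw [← unary_one_sub]; norm_num
  have h5 : qpow (τ / 2) (1 / 5) = qpow τ (1 / 10) := by
    unfold qpow; congr 1; push_cast; ring
  have h6 : qpow (τ / 2) 1 = qpow τ (1 / 2) := by
    unfold qpow; congr 1; push_cast; ring
  have h7 := ex1_mul_neg (3 / 10)
  have h8 := theta4_ne_zero hτ
  rw [h4, h5, h6, show (3 / 5 / 2 : ℝ) = 3 / 10 by norm_num] at h1
  rw [h2, h3, sub_neg_eq_add, add_right_comm, ← sub_eq_add_neg,
    show (6 / 20 : ℝ) = 3 / 10 by norm_num, ← h1]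
  field_simp
  linear_combination (-(unary (3 / 10) 0 20 τ) - unary (4 / 20) 0 20 τ) * h7

theorem F1_row_psi : qpow τ (-1 / 10) * psi (qpow τ (1 / 2)) = 1 / theta4 τ * (1 / 2) *
    (shiftTheta (2 / 10) (2 / 10) τ - shiftTheta (2 / 10 + 1 / 2) (2 / 10) τ -
      shiftTheta (3 / 10) (3 / 10) τ + shiftTheta (3 / 10 + 1 / 2) (3 / 10) τ) +
    (-unary (2 / 20) 0 20 τ - unary (8 / 20) 0 20 τ) := by
  have hτ' : 0 < (τ / 2).im := by rw [div_ofNat_im]; positivity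
  have h1 := indefTheta_half hτ (2 / 10)
  rw [show (2 * (2 / 10) : ℝ) = 2 / 5 by norm_num, indefTheta_psi hτ',
    mul_div_cancel₀ _ (two_ne_zero' ℂ), unary_ten_half hτ] at h1
  have h2 : shiftTheta (3 / 10) (3 / 10) τ = -shiftTheta (2 / 10 + 1 / 2) (2 / 10 + 1 / 2) τ := by
    rw [← shiftTheta_neg]
    refine Eq.trans ?_ (shiftTheta_add_int _ _ τ 1 1)
    congr 1 <;> norm_num
  have h3 : shiftTheta (3 / 10 + 1 / 2) (3 / 10) τ = -shiftTheta (2 / 10) (2 / 10 + 1 / 2) τ := by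
    rw [← shiftTheta_neg]
    refine Eq.trans ?_ (shiftTheta_add_int _ _ τ 1 1)
    congr 1 <;> norm_num
  have h4 : unary ((1 / 5 + 1) / 2) 0 20 τ = -unary (8 / 20) 0 20 τ := by
    rw [← unary_one_sub]; norm_num
  have h5 : qpow (τ / 2) (-1 / 5) = qpow τ (-1 / 10) := by
    unfold qpow; congr 1; push_cast; ring
  have h6 : qpow (τ / 2) 1 = qpow τ (1 / 2) := by
    unfold qpow; congr 1; push_cast; ring
  have h7 := ex1_mul_neg (1 / 10)
  have h8 := theta4_ne_zero hτ
  rw [h4, h5, h6, show (1 / 5 / 2 : ℝ) = 1 / 10 by norm_num] at h1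
  rw [h2, h3, sub_neg_eq_add, add_right_comm, ← sub_eq_add_neg,
    show (2 / 20 : ℝ) = 1 / 10 by norm_num, ← h1]
  field_simp
  linear_combination (-(unary (1 / 10) 0 20 τ) - unary (8 / 20) 0 20 τ) * h7

omit hτ in
theorem qpow_half_add_one (τ : ℂ) : qpow (τ + 1) (1 / 2) = -qpow τ (1 / 2) := by
  rw [qpow_add_one, ex1_half, neg_one_mul]

/-- Replace τ by τ + 1 in the row for φ(q^{1/2}): q^{1/2} changes sign, θ₄ becomes θ₃, and every
remaining term acquires ±e(1/10), which is divided out. The signs account for the different sign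
pattern. -/
theorem F1_row_phi_neg : qpow τ (1 / 10) * phi (-qpow τ (1 / 2)) = 1 / theta3 τ * (1 / 2) *
    (shiftTheta (1 / 10) (1 / 10) τ - shiftTheta (1 / 10 + 1 / 2) (1 / 10) τ +
      shiftTheta (4 / 10) (4 / 10) τ + shiftTheta (4 / 10 + 1 / 2) (4 / 10) τ) +
    (unary (4 / 20) 0 20 τ - unary (6 / 20) 0 20 τ) := by
  have h := F1_row_phi (τ := τ + 1) (by simpa using hτ)
  rw [qpow_half_add_one, theta4_add_one, qpow_add_one,
    shiftTheta_add_one (a := 1 / 10) (b := 1 / 10) 1 1 (by norm_num) (by norm_num),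
    shiftTheta_add_one (a := 1 / 10 + 1 / 2) (b := 1 / 10) 3 4 (by norm_num) (by norm_num),
    shiftTheta_add_one (a := 4 / 10) (b := 4 / 10) 4 4 (by norm_num) (by norm_num),
    shiftTheta_add_one (a := 4 / 10 + 1 / 2) (b := 4 / 10) 6 7 (by norm_num) (by norm_num),
    unary_twenty_add_one (s := 4 / 20) 4 (by norm_num),
    unary_twenty_add_one (s := 6 / 20) 6 (by norm_num),
    ex1_congr (x := 2 * (1 / 10) ^ 2 + 6 * (1 / 10) * (1 / 10) + 2 * (1 / 10) ^ 2)
      (y := 1 / 10) 0 (by norm_num),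
    ex1_congr (x := 2 * (1 / 10 + 1 / 2) ^ 2 + 6 * (1 / 10 + 1 / 2) * (1 / 10) + 2 * (1 / 10) ^ 2)
      (y := 1 / 10) 1 (by norm_num),
    ex1_congr_neg (x := 2 * (4 / 10) ^ 2 + 6 * (4 / 10) * (4 / 10) + 2 * (4 / 10) ^ 2)
      (y := 1 / 10) 1 (by norm_num),
    ex1_congr (x := 2 * (4 / 10 + 1 / 2) ^ 2 + 6 * (4 / 10 + 1 / 2) * (4 / 10) + 2 * (4 / 10) ^ 2)
      (y := 1 / 10) 4 (by norm_num),
    ex1_congr_neg (x := -(10 * (4 / 20) ^ 2)) (y := 1 / 10) (-1) (by norm_num),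
    ex1_congr (x := -(10 * (6 / 20) ^ 2)) (y := 1 / 10) (-1) (by norm_num)] at h
  linear_combination (ex1 (-(1 / 10))) * h +
    (1 / theta3 τ * (1 / 2) *
    (shiftTheta (1 / 10) (1 / 10) τ - shiftTheta (1 / 10 + 1 / 2) (1 / 10) τ +
      shiftTheta (4 / 10) (4 / 10) τ + shiftTheta (4 / 10 + 1 / 2) (4 / 10) τ) +
    (unary (4 / 20) 0 20 τ - unary (6 / 20) 0 20 τ) -
    qpow τ (1 / 10) * phi (-qpow τ (1 / 2))) * ex1_mul_neg (1 / 10)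

theorem F1_row_psi_neg : qpow τ (-1 / 10) * psi (-qpow τ (1 / 2)) = 1 / theta3 τ * (1 / 2) *
    (-shiftTheta (2 / 10) (2 / 10) τ - shiftTheta (2 / 10 + 1 / 2) (2 / 10) τ -
      shiftTheta (3 / 10) (3 / 10) τ + shiftTheta (3 / 10 + 1 / 2) (3 / 10) τ) +
    (-unary (2 / 20) 0 20 τ + unary (8 / 20) 0 20 τ) := by
  have h := F1_row_psi (τ := τ + 1) (by simpa using hτ)
  rw [qpow_half_add_one, theta4_add_one, qpow_add_one,
    shiftTheta_add_one (a := 2 / 10) (b := 2 / 10) 2 2 (by norm_num) (by norm_num),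
    shiftTheta_add_one (a := 2 / 10 + 1 / 2) (b := 2 / 10) 4 5 (by norm_num) (by norm_num),
    shiftTheta_add_one (a := 3 / 10) (b := 3 / 10) 3 3 (by norm_num) (by norm_num),
    shiftTheta_add_one (a := 3 / 10 + 1 / 2) (b := 3 / 10) 5 6 (by norm_num) (by norm_num),
    unary_twenty_add_one (s := 2 / 20) 2 (by norm_num),
    unary_twenty_add_one (s := 8 / 20) 8 (by norm_num),
    ex1_congr_neg (x := 2 * (2 / 10) ^ 2 + 6 * (2 / 10) * (2 / 10) + 2 * (2 / 10) ^ 2)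
      (y := -1 / 10) 0 (by norm_num),
    ex1_congr (x := 2 * (2 / 10 + 1 / 2) ^ 2 + 6 * (2 / 10 + 1 / 2) * (2 / 10) + 2 * (2 / 10) ^ 2)
      (y := -1 / 10) 2 (by norm_num),
    ex1_congr (x := 2 * (3 / 10) ^ 2 + 6 * (3 / 10) * (3 / 10) + 2 * (3 / 10) ^ 2)
      (y := -1 / 10) 1 (by norm_num),
    ex1_congr (x := 2 * (3 / 10 + 1 / 2) ^ 2 + 6 * (3 / 10 + 1 / 2) * (3 / 10) + 2 * (3 / 10) ^ 2)
      (y := -1 / 10) 3 (by norm_num),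
    ex1_congr (x := -(10 * (2 / 20) ^ 2)) (y := -1 / 10) 0 (by norm_num),
    ex1_congr_neg (x := -(10 * (8 / 20) ^ 2)) (y := -1 / 10) (-2) (by norm_num)] at h
  linear_combination (ex1 (-(-1 / 10))) * h +
    (1 / theta3 τ * (1 / 2) *
    (-shiftTheta (2 / 10) (2 / 10) τ - shiftTheta (2 / 10 + 1 / 2) (2 / 10) τ -
      shiftTheta (3 / 10) (3 / 10) τ + shiftTheta (3 / 10 + 1 / 2) (3 / 10) τ) +
    (-unary (2 / 20) 0 20 τ + unary (8 / 20) 0 20 τ) -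
    qpow τ (-1 / 10) * psi (-qpow τ (1 / 2))) * ex1_mul_neg (-1 / 10)

/-- The second parity class is reflected by s ↦ 1 - s, under which the untwisted series is odd. -/
theorem unary_five_halves (s : ℝ) :
    unary s 0 (5 / 2) τ = unary (s / 2) 0 10 τ - unary ((1 - s) / 2) 0 10 τ := by
  rw [unary_split (by norm_num) hτ, show (1 - s) / 2 = 1 - (s + 1) / 2 by ring, unary_one_sub]
  norm_num

theorem F2_row_X : qpow τ (-1 / 80) * X (qpow τ (1 / 2)) =
    1 / theta2 (τ / 2) * indefTheta (1 / 10) (fun _ => 1) τ +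
      (unary (1 / 20) 0 10 τ - unary (9 / 20) 0 10 τ) := by
  have hne := theta2_ne_zero (τ := τ / 2) (by rw [div_ofNat_im]; positivity)
  rw [indefTheta_X hτ, unary_five_halves hτ, show (1 / 10 / 2 : ℝ) = 1 / 20 by norm_num,
    show ((1 - 1 / 10) / 2 : ℝ) = 9 / 20 by norm_num]
  field_simp
  ring

theorem F2_row_chi : qpow τ (-9 / 80) * chi (qpow τ (1 / 2)) =
    1 / theta2 (τ / 2) * indefTheta (3 / 10) (fun _ => 1) τ +
      (unary (3 / 20) 0 10 τ - unary (7 / 20) 0 10 τ) := by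
  have hne := theta2_ne_zero (τ := τ / 2) (by rw [div_ofNat_im]; positivity)
  rw [indefTheta_chi hτ, unary_five_halves hτ, show (3 / 10 / 2 : ℝ) = 3 / 20 by norm_num,
    show ((1 - 3 / 10) / 2 : ℝ) = 7 / 20 by norm_num]
  field_simp
  ring

omit hτ in
theorem unary_ten_two_mul (s : ℝ) : unary s 0 10 (2 * τ) = unary s 0 20 τ := by
  have := unary_real_mul s 0 10 2 τ
  norm_num at this
  exact this

omit hτ in
theorem qpow_two_mul (r : ℝ) : qpow (2 * τ) r = qpow τ (2 * r) := by
  have := qpow_mul_left 2 τ r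
  push_cast at this
  exact this

/-- The base row for X at 2τ. -/
theorem F1_row_X : qpow τ (-1 / 40) * X (qpow τ 1) =
    1 / theta2 τ * shiftTheta (1 / 10) (1 / 10) τ +
      (unary (1 / 20) 0 20 τ - unary (9 / 20) 0 20 τ) := by
  have h := F2_row_X (τ := 2 * τ) (by simpa using hτ)
  rw [mul_div_cancel_left₀ _ (two_ne_zero' ℂ), ← shiftTheta_self, unary_ten_two_mul,
    unary_ten_two_mul, qpow_two_mul, qpow_two_mul, show (2 * (-1 / 80) : ℝ) = -1 / 40 by norm_num,
    show (2 * (1 / 2) : ℝ) = 1 by norm_num] at h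
  exact h

theorem F1_row_chi : qpow τ (-9 / 40) * chi (qpow τ 1) =
    1 / theta2 τ * shiftTheta (3 / 10) (3 / 10) τ +
      (unary (3 / 20) 0 20 τ - unary (7 / 20) 0 20 τ) := by
  have h := F2_row_chi (τ := 2 * τ) (by simpa using hτ)
  rw [mul_div_cancel_left₀ _ (two_ne_zero' ℂ), ← shiftTheta_self, unary_ten_two_mul,
    unary_ten_two_mul, qpow_two_mul, qpow_two_mul, show (2 * (-9 / 80) : ℝ) = -9 / 40 by norm_num,
    show (2 * (1 / 2) : ℝ) = 1 by norm_num] at h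
  exact h

/-! ### The rows of the second decomposition -/

theorem F2_row_phi : (√2 : ℝ) * qpow τ (1 / 5) * phi (qpow τ 1) =
    1 / ((√2 : ℝ) * theta4 (2 * τ)) * zeta 5 ^ (-1 : ℤ) *
      (ex1 (2 / 10) * indefTheta (2 / 10) alt τ) +
    -(√2 : ℝ) * zeta 5 ^ (-1 : ℤ) * unary (8 / 20) (1 / 2) 10 τ := by
  have hne := theta4_ne_zero (τ := 2 * τ) (by simpa using hτ)
  have h2 : ((√2 : ℝ) : ℂ) ≠ 0 := by exact_mod_cast (by positivity : √(2 : ℝ) ≠ 0)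
  have h2' : ((√2 : ℝ) : ℂ) * ((√2 : ℝ) : ℂ) = 2 := by
    rw [← ofReal_mul, Real.mul_self_sqrt (by norm_num)]; norm_num
  -- Modulo 1, 3/5 is -(2/5). Reflection sends the character 1/2 to -1/2, and returning to 1/2 costs
  -- the phase e(-2/5).
  have hu : unary (3 / 5) (1 / 2) 10 τ = -(ex1 (-(2 / 5)) * unary (2 / 5) (1 / 2) 10 τ) := by
    have e1 := unary_char_add_one (2 / 5) (-(1 / 2)) 10 τ
    have e2 := unary_neg (2 / 5) (-(1 / 2)) 10 τ
    have e3 := unary_add_int (-(2 / 5)) (1 / 2) 10 τ 1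
    rw [neg_neg] at e2
    norm_num at e1 e2 e3
    rw [e3, e2, e1, ← mul_assoc, mul_comm (ex1 _), ex1_mul_neg, one_mul]
  have e1 : ex1 (2 / 10) * ex1 (-(1 / 5)) = 1 := by
    rw [← ex1_add, ← ex1_zero]; norm_num
  have e2 : ex1 (-(3 / 10)) * ex1 (-(2 / 5)) = -ex1 (-(1 / 5)) := by
    rw [← ex1_add]; exact ex1_congr_neg (-1) (by norm_num)
  have e3 : zeta 5 ^ (-1 : ℤ) = ex1 (-(1 / 5)) := by rw [zeta_zpow]; norm_num
  rw [e3, show (2 / 10 : ℝ) = 1 / 5 by norm_num] at *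
  rw [indefTheta_phi hτ, hu, show (8 / 20 : ℝ) = 2 / 5 by norm_num]
  field_simp
  linear_combination (qpow τ (1 / 5) * phi (qpow τ 1)) * (h2' - 2 * e1) +
    ex1 (-(1 / 5)) * unary (2 / 5) (1 / 2) 10 τ * (h2' - 2 * e1) +
      2 * ex1 (1 / 5) * ex1 (-(1 / 5)) * unary (2 / 5) (1 / 2) 10 τ * e2

theorem F2_row_psi : (√2 : ℝ) * qpow τ (-1 / 5) * psi (qpow τ 1) =
    1 / ((√2 : ℝ) * theta4 (2 * τ)) * zeta 5 ^ (-2 : ℤ) *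
      (ex1 (4 / 10) * indefTheta (4 / 10) alt τ) +
    (√2 : ℝ) * zeta 5 ^ (2 : ℤ) * unary (4 / 20) (1 / 2) 10 τ := by
  have hne := theta4_ne_zero (τ := 2 * τ) (by simpa using hτ)
  have h2 : ((√2 : ℝ) : ℂ) ≠ 0 := by exact_mod_cast (by positivity : √(2 : ℝ) ≠ 0)
  have h2' : ((√2 : ℝ) : ℂ) * ((√2 : ℝ) : ℂ) = 2 := by
    rw [← ofReal_mul, Real.mul_self_sqrt (by norm_num)]; norm_num
  have e1 : ex1 (4 / 10) * ex1 (-(2 / 5)) = 1 := by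
    rw [← ex1_add, ← ex1_zero]; norm_num
  have e2 : ex1 (2 / 5) = -ex1 (-(1 / 10)) := ex1_congr_neg 0 (by norm_num)
  have e3 : zeta 5 ^ (-2 : ℤ) = ex1 (-(2 / 5)) := by rw [zeta_zpow]; norm_num
  have e4 : zeta 5 ^ (2 : ℤ) = ex1 (2 / 5) := by rw [zeta_zpow]; norm_num
  rw [e3, e4, show (4 / 10 : ℝ) = 2 / 5 by norm_num] at *
  rw [indefTheta_psi hτ, show (4 / 20 : ℝ) = 1 / 5 by norm_num]
  field_simp
  linear_combination (qpow τ (-(1 / 5)) * psi (qpow τ 1)) * (h2' - 2 * e1) -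
    2 * ex1 (-(1 / 10)) * unary (1 / 5) (1 / 2) 10 τ * e1 -
      unary (1 / 5) (1 / 2) 10 τ * ex1 (2 / 5) * h2' - 2 * unary (1 / 5) (1 / 2) 10 τ * e2

/-- The base row at τ + 1, multiplied by e(1/80) to remove the phase of q^{-1/80}. -/
theorem F2_row_X_neg : qpow τ (-1 / 80) * X (-qpow τ (1 / 2)) =
    1 / theta2 ((τ + 1) / 2) * zeta 80 ^ (-3 : ℤ) *
      (ex1 (1 / 10) * indefTheta (1 / 10) alt τ) +
    (zeta 40 ^ (-1 : ℤ) * unary (1 / 20) (1 / 2) 10 τ -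
      zeta 40 ^ (-9 : ℤ) * unary (9 / 20) (1 / 2) 10 τ) := by
  have h := F2_row_X (τ := τ + 1) (by simpa using hτ)
  rw [qpow_half_add_one, qpow_add_one, indefTheta_add_one 0 (by norm_num),
    unary_ten_add_one (s := 1 / 20) 0 (by norm_num),
    unary_ten_add_one (s := 9 / 20) 4 (by norm_num)] at h
  have e1 : ex1 (1 / 80) * ex1 (-1 / 80) = 1 := by rw [← ex1_add, ← ex1_zero]; norm_num
  have e2 : ex1 (1 / 80) * ex1 (5 * (1 / 10) ^ 2) = zeta 80 ^ (-3 : ℤ) * ex1 (1 / 10) := by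
    rw [zeta_zpow, ← ex1_add, ← ex1_add]; norm_num
  have e3 : ex1 (1 / 80) * ex1 (-(5 * (1 / 20) ^ 2) - 1 / 20 / 2) = zeta 40 ^ (-1 : ℤ) := by
    rw [zeta_zpow, ← ex1_add]; norm_num
  have e4 : ex1 (1 / 80) * ex1 (-(5 * (9 / 20) ^ 2) - 9 / 20 / 2) = zeta 40 ^ (-9 : ℤ) := by
    rw [zeta_zpow, ← ex1_add]; exact ex1_congr (-1) (by norm_num)
  rw [← e3, ← e4]
  linear_combination ex1 (1 / 80) * h - qpow τ (-1 / 80) * X (-qpow τ (1 / 2)) * e1 +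
    1 / theta2 ((τ + 1) / 2) * indefTheta (1 / 10) alt τ * e2

theorem F2_row_chi_neg : qpow τ (-9 / 80) * chi (-qpow τ (1 / 2)) =
    1 / theta2 ((τ + 1) / 2) * zeta 80 ^ (21 : ℤ) *
      (ex1 (3 / 10) * indefTheta (3 / 10) alt τ) +
    (zeta 40 ^ (-3 : ℤ) * unary (3 / 20) (1 / 2) 10 τ +
      zeta 40 ^ (-7 : ℤ) * unary (7 / 20) (1 / 2) 10 τ) := by
  have h := F2_row_chi (τ := τ + 1) (by simpa using hτ)
  rw [qpow_half_add_one, qpow_add_one, indefTheta_add_one 1 (by norm_num),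
    unary_ten_add_one (s := 3 / 20) 1 (by norm_num),
    unary_ten_add_one (s := 7 / 20) 3 (by norm_num)] at h
  have e1 : ex1 (9 / 80) * ex1 (-9 / 80) = 1 := by rw [← ex1_add, ← ex1_zero]; norm_num
  have e2 : ex1 (9 / 80) * ex1 (5 * (3 / 10) ^ 2) = zeta 80 ^ (21 : ℤ) * ex1 (3 / 10) := by
    rw [zeta_zpow, ← ex1_add, ← ex1_add]; norm_num
  have e3 : ex1 (9 / 80) * ex1 (-(5 * (3 / 20) ^ 2) - 3 / 20 / 2) = zeta 40 ^ (-3 : ℤ) := by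
    rw [zeta_zpow, ← ex1_add]; norm_num
  -- The phase is -27/40 = -7/40 - 1/2; the half turn explains the plus sign in the last row of
  -- g⁽²⁾.
  have e4 : ex1 (9 / 80) * ex1 (-(5 * (7 / 20) ^ 2) - 7 / 20 / 2) = -zeta 40 ^ (-7 : ℤ) := by
    rw [zeta_zpow, ← ex1_add]; exact ex1_congr_neg (-1) (by norm_num)
  rw [← e3, ← neg_eq_iff_eq_neg.mpr e4]
  linear_combination ex1 (9 / 80) * h - qpow τ (-9 / 80) * chi (-qpow τ (1 / 2)) * e1 +
    1 / theta2 ((τ + 1) / 2) * indefTheta (3 / 10) alt τ * e2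

/-! ### Assembly of the two vector identities. -/

theorem F1_eq : F1 τ = H1 τ + G1 τ := by
  rw [G1_eq hτ]
  unfold F1 H1
  simp only [vt_smul_e, vt_smul_e_add]
  rw [F1_row_phi hτ, F1_row_psi hτ, F1_row_phi_neg hτ, F1_row_psi_neg hτ, F1_row_X hτ,
    F1_row_chi hτ]
  simp only [Matrix.cons_add_cons, Matrix.empty_add_empty]

theorem F2_eq : F2 τ = H2 τ + G2 τ := by
  have h (s : ℝ) : vt (s • e) 0 (τ / 2) = indefTheta s (fun _ => 1) τ := by
    rw [vt_smul_e, shiftTheta_self, mul_div_cancel₀ _ (two_ne_zero' ℂ)]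
  rw [G2_eq hτ]
  unfold F2 H2
  simp only [h, vt_twist]
  rw [F2_row_phi hτ, F2_row_psi hτ, F2_row_X hτ, F2_row_chi hτ, F2_row_X_neg hτ,
    F2_row_chi_neg hτ]
  simp only [Matrix.cons_add_cons, Matrix.empty_add_empty]

end rows

end

end TenthOrder

theorem proposition2 :
    -- every series, quotient and integral below is well defined
    (∀ q : ℂ, ‖q‖ < 1 →
      (∀ n : ℕ, qPoch q (q ^ 2) n ≠ 0 ∧ qPoch (-q) q n ≠ 0) ∧
      Summable (phiTerm q) ∧ Summable (psiTerm q) ∧ Summable (XTerm q) ∧ Summable (chiTerm q)) ∧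
    (∀ τ : ℂ, 0 < τ.im →
      Summable (theta2Term τ) ∧ Summable (theta3Term τ) ∧ Summable (theta4Term τ) ∧
      theta2 τ ≠ 0 ∧ theta3 τ ≠ 0 ∧ theta4 τ ≠ 0 ∧
      (∀ a b : Fin 2 → ℝ, Summable (varthetaTerm A c1 c2 a b τ)) ∧
      (∀ s t : ℝ, Summable (gTerm s t τ)) ∧
      (∀ j : Fin 6, MeasureTheory.IntegrableOn (periodIntegrand g1 τ j) (Set.Ioi 0) ∧
        MeasureTheory.IntegrableOn (periodIntegrand g2 τ j) (Set.Ioi 0))) ∧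
    -- the decompositions
    (∀ τ : ℂ, 0 < τ.im → F1 τ = H1 τ + G1 τ ∧ F2 τ = H2 τ + G2 τ) := by
  refine ⟨fun q hq => ⟨fun n => ⟨?_, ?_⟩, summable_phiTerm hq, summable_psiTerm hq,
    summable_XTerm hq, summable_chiTerm hq⟩, fun τ hτ => ⟨summable_theta2Term hτ,
    summable_theta3Term hτ, summable_theta4Term hτ, theta2_ne_zero hτ, theta3_ne_zero hτ,
    theta4_ne_zero hτ, summable_varthetaTerm hτ, summable_gTerm hτ,
    fun j => ⟨integrableOn_period_g1 hτ j, integrableOn_period_g2 hτ j⟩⟩,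
    fun τ hτ => ⟨F1_eq hτ, F2_eq hτ⟩⟩
  · exact qPoch_ne_zero (norm_sq_lt_one hq).le hq n
  · exact qPoch_ne_zero hq.le (by rwa [norm_neg]) n
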